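/- Let $K$ be a finite subgroup of $SO(3)$, write $[U]$ for the class of $U\in SO(3)$ in $SO(3)/K$, and let $\mathbf t:SO(3)/K\to E$ be a one-to-one $C^1$ map into a real inner product space $E$ on which $SO(3)$ acts by linear isometries, equivariant in the sense that $\mathbf t([gU])=g\,\mathbf t([U])$. Put $\rho^2=\|\mathbf t([I_3])\|^2$ (which equals $\|\mathbf t([U])\|^2$ for every $U$). Fix $A\in SO(3)$. For $n\ge 1$ and $\kappa>0$ let $(U_1,V_1),\dots,(U_n,V_n)$ be random pairs of rotations such that $([U_1],\dots,[U_n])$ has an arbitrary law not depending on $\kappa$ (for instance, is non-random) and, given $([U_1],\dots,[U_n])$, the classes $[V_1],\dots,[V_n]$ are independent, $[V_i]$ having density $$f([V]\mid[U_i];A,\kappa)=c(\kappa)^{-1}\exp\{\kappa\langle\mathbf t([V]),\mathbf t([AU_i])\rangle\}$$ with respect to the uniform distribution on $SO(3)/K$. Let $\hat A$ be a maximum likelihood estimate of $A$, i.e. any maximizer over $B\in SO(3)$ of $\sum_{i=1}^n\langle\mathbf t([V_i]),\mathbf t([BU_i])\rangle$, and for $B\in SO(3)$ put $$S(B)=\sum_{i=1}^n\{\rho^2-\langle\mathbf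 t([I_3]),\mathbf t([V_i^{T}BU_i])\rangle\},\qquad D(B)=\sum_{i=1}^n\{\langle\mathbf t([I_3]),\mathbf t([V_i^{T}\hat AU_i])\rangle-\langle\mathbf t([I_3]),\mathbf t([V_i^{T}BU_i])\rangle\}.$$ (i) For each fixed $n\ge1$, as $\kappa\to\infty$, $2\kappa S(A)$, $2\kappa S(\hat A)$ and $2\kappa D(A)$ converge in distribution to $\chi^2_{3n}$, $\chi^2_{3(n-1)}$ and $\chi^2_3$ respectively ($\chi^2_0$ being the unit mass at $0$), and the last two are asymptotically independent: the pair $(2\kappa S(\hat A),2\kappa D(A))$ converges in distribution to the product law $\chi^2_{3(n-1)}\otimes\chi^2_3$. (ii) For $0<\alpha<1$ let $\chi^2_{3;\alpha}$ be the upper $\alpha$ quantile of $\chi^2_3$. The region $C=\{B\in SO(3): 2\hat\kappa D(B)<\chi^2_{3;\alpha}\}$ is an approximate high-concentration $100(1-\alpha)\%$ confidence region for $A$, in the following senses. (a) For each fixed $n\ge1$, if $\hat\kappa$ is any random variable with $\hat\kappa/\kappa\to1$ in probability as $\kappa\to\infty$ (for instance $\hat\kappa=\kappa$ when $\kappa$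 is known), then $P(A\in C)\to1-\alpha$ as $\kappa\to\infty$. (b) If $\hat\kappa$ is the maximum likelihood estimate of $\kappa$ (the value for which $(\hat A,\hat\kappa)$ maximizes the likelihood over $SO(3)\times(0,\infty)$, whenever the likelihood attains its maximum there; an arbitrary value otherwise), then for every $\varepsilon>0$ there is $N$ such that for each $n\ge N$, $|P(A\in C)-(1-\alpha)|<\varepsilon$ for all sufficiently large $\kappa$. -/

import Mathlib

open MeasureTheory ProbabilityTheory Filter Topology Set

/-- The rotation group `SO(3)`.  In it `V⁻¹` is the transpose of `V`. -/
abbrev SO3 : Type := Matrix.specialOrthogonalGroup (Fin 3) ℝ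

/-- `SO(3)` carries its Borel σ-algebra. -/
instance SO3.instMeasurableSpace : MeasurableSpace SO3 := borel SO3

instance SO3.instBorelSpace : BorelSpace SO3 := ⟨rfl⟩

instance SO3.instIsTopologicalGroup : IsTopologicalGroup SO3 where
  continuous_inv := by
    refine Continuous.subtype_mk ?_ _
    exact continuous_subtype_val.star

instance SO3.instCompactSpace : CompactSpace SO3 := by
  have hcl : IsClosed {M : Matrix (Fin 3) (Fin 3) ℝ |
      M ∈ Matrix.specialOrthogonalGroup (Fin 3) ℝ} := by
    have : {M : Matrix (Fin 3) (Fin 3) ℝ | M ∈ Matrix.specialOrthogonalGroup (Fin 3) ℝ} =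
        {M | M * M.transpose = 1} ∩ {M | M.det = 1} := by
      ext M
      simp only [Set.mem_ofPred_eq, Set.mem_inter_iff, Matrix.mem_specialOrthogonalGroup_iff,
        Matrix.mem_orthogonalGroup_iff]
    rw [this]
    refine IsClosed.inter (isClosed_eq ?_ continuous_const) (isClosed_eq ?_ continuous_const)
    · exact continuous_id.mul continuous_id.matrix_transpose
    · exact continuous_id.matrix_det
  have hcomp : IsCompact (Set.pi Set.univ fun _ : Fin 3 =>
      Set.pi Set.univ fun _ : Fin 3 => Set.Icc (-1 : ℝ) 1) :=
    isCompact_univ_pi fun _ => isCompact_univ_pi fun _ => isCompact_Icc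
  refine isCompact_iff_compactSpace.mp (hcomp.of_isClosed_subset hcl ?_)
  intro M hM i _ j _
  have h := (Matrix.mem_orthogonalGroup_iff (Fin 3) ℝ).1
    (Matrix.mem_specialOrthogonalGroup_iff.1 hM).1
  have hi : ∑ k, M i k * M i k = 1 := by
    have h2 := congrArg (fun N : Matrix (Fin 3) (Fin 3) ℝ => N i i) h
    exact h2.trans (Matrix.one_apply_eq i)
  have hle : M i j * M i j ≤ 1 := by
    rw [← hi]
    exact Finset.single_le_sum (f := fun k => M i k * M i k)
      (fun k _ => mul_self_nonneg _) (Finset.mem_univ j)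
  exact ⟨by nlinarith, by nlinarith⟩

section Model

variable {E : Type*} [NormedAddCommGroup E] [InnerProductSpace ℝ E]

/-- The class `[U]` of a rotation in `SO(3)/K`. -/
abbrev rotClass (K : Subgroup SO3) (U : SO3) : SO3 ⧸ K := QuotientGroup.mk U

/-- `t : SO(3)/K → E` is an equivariant one-to-one map of class `C¹` into an inner product space
on which `SO(3)` acts by linear isometries.  Being `C¹` on the submanifold `SO(3)` of the space of
`3 × 3` matrices means being the restriction of a `C¹` map on that space. -/
structure IsEquivariantEmbedding (K : Subgroup SO3) (act : SO3 →* (E ≃ₗᵢ[ℝ] E))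
    (t : SO3 ⧸ K → E) : Prop where
  equivariant : ∀ (g : SO3) (x : SO3 ⧸ K), t (g • x) = act g (t x)
  injective : Function.Injective t
  contDiff : ∃ F : (Fin 3 → Fin 3 → ℝ) → E, ContDiff ℝ 1 F ∧
    ∀ U : SO3, F (fun i j => (U : Matrix (Fin 3) (Fin 3) ℝ) i j) = t (rotClass K U)

/-- The uniform distribution on `SO(3)/K`: the image of the normalized Haar measure of `SO(3)`. -/
noncomputable def uniformRot (K : Subgroup SO3) : Measure (SO3 ⧸ K) :=
  (Measure.haarMeasure (⊤ : TopologicalSpace.PositiveCompacts SO3)).map (rotClass K)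

/-- The normalizing constant `c(κ)`. -/
noncomputable def normConst (K : Subgroup SO3) (t : SO3 ⧸ K → E) (κ : ℝ) : ℝ :=
  ∫ x, Real.exp (κ * inner ℝ (t x) (t (rotClass K 1))) ∂(uniformRot K)

/-- The regression density
`f([V] | [U]; A, κ) = c(κ)⁻¹ exp {κ ⟨t([V]), t([A U])⟩}` with respect to the uniform distribution,
where `v = [V]`, `u = [U]`. -/
noncomputable def regDensity (K : Subgroup SO3) (t : SO3 ⧸ K → E) (A : SO3) (κ : ℝ)
    (u v : SO3 ⧸ K) : ℝ :=
  (normConst K t κ)⁻¹ * Real.exp (κ * inner ℝ (t v) (t (A • u)))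

/-- The joint law of `([U₁], …, [Uₙ])` and `([V₁], …, [Vₙ])` when the former has law `ν` and, given
the former, `[V₁], …, [Vₙ]` are independent, `[Vᵢ]` having density `f( · | [Uᵢ]; A, κ)`. -/
noncomputable def regressionLaw (K : Subgroup SO3) (t : SO3 ⧸ K → E) (A : SO3) (κ : ℝ) {n : ℕ}
    (ν : Measure (Fin n → SO3 ⧸ K)) : Measure ((Fin n → SO3 ⧸ K) × (Fin n → SO3 ⧸ K)) :=
  (ν.prod (Measure.pi fun _ => uniformRot K)).withDensity fun p =>
    ENNReal.ofReal (∏ i, regDensity K t A κ (p.1 i) (p.2 i))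

/-- `(U₁, V₁), …, (Uₙ, Vₙ)` are random rotations whose classes follow the regression model. -/
structure IsRegressionSample (K : Subgroup SO3) (t : SO3 ⧸ K → E) (A : SO3) (κ : ℝ) {n : ℕ}
    (ν : Measure (Fin n → SO3 ⧸ K)) {Ω : Type*} [MeasurableSpace Ω] (P : Measure Ω)
    (U V : Fin n → Ω → SO3) : Prop where
  measurable_left : ∀ i, Measurable (U i)
  measurable_right : ∀ i, Measurable (V i)
  law : P.map (fun ω => ((fun i => rotClass K (U i ω)), (fun i => rotClass K (V i ω)))) =
    regressionLaw K t A κ ν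

/-- `B` is a maximum likelihood estimate of `A` (for known concentration, whatever its positive
value): it maximizes `∑ᵢ ⟨t([Vᵢ]), t([B Uᵢ])⟩` over `SO(3)`. -/
def IsRotationMLE (K : Subgroup SO3) (t : SO3 ⧸ K → E) {n : ℕ} (U V : Fin n → SO3)
    (B : SO3) : Prop :=
  ∀ B' : SO3, ∑ i, inner ℝ (t (rotClass K (V i))) (t (rotClass K (B' * U i))) ≤
    ∑ i, inner ℝ (t (rotClass K (V i))) (t (rotClass K (B * U i)))

/-- `(B, k)` is a joint maximum likelihood estimate of `(A, κ)`: it maximizes the likelihood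
`∏ᵢ f([Vᵢ] | [Uᵢ]; B, k)` over `SO(3) × (0, ∞)`. -/
def IsJointMLE (K : Subgroup SO3) (t : SO3 ⧸ K → E) {n : ℕ} (U V : Fin n → SO3)
    (B : SO3) (k : ℝ) : Prop :=
  0 < k ∧ ∀ (B' : SO3) (k' : ℝ), 0 < k' →
    ∏ i, regDensity K t B' k' (rotClass K (U i)) (rotClass K (V i)) ≤
      ∏ i, regDensity K t B k (rotClass K (U i)) (rotClass K (V i))

/-- `⟨t([I₃]), t([Vᵀ B U])⟩`. -/
noncomputable def fitInner (K : Subgroup SO3) (t : SO3 ⧸ K → E) (B U V : SO3) : ℝ :=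
  inner ℝ (t (rotClass K 1)) (t (rotClass K (V⁻¹ * B * U)))

/-- `∑ᵢ {ρ² - ⟨t([I₃]), t([Vᵢᵀ B Uᵢ])⟩}`, where `ρ² = ‖t([I₃])‖²`. -/
noncomputable def residualSum (K : Subgroup SO3) (t : SO3 ⧸ K → E) {n : ℕ} (U V : Fin n → SO3)
    (B : SO3) : ℝ :=
  ∑ i, (‖t (rotClass K 1)‖ ^ 2 - fitInner K t B (U i) (V i))

/-- `∑ᵢ {⟨t([I₃]), t([Vᵢᵀ Â Uᵢ])⟩ - ⟨t([I₃]), t([Vᵢᵀ B Uᵢ])⟩}`. -/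
noncomputable def fitGain (K : Subgroup SO3) (t : SO3 ⧸ K → E) {n : ℕ} (U V : Fin n → SO3)
    (Ahat B : SO3) : ℝ :=
  ∑ i, (fitInner K t Ahat (U i) (V i) - fitInner K t B (U i) (V i))

/-- The chi-squared distribution with `k` degrees of freedom: the law of the sum of the squares of
`k` independent standard normal variables (the unit mass at `0` if `k = 0`). -/
noncomputable def chiSq (k : ℕ) : Measure ℝ :=
  (Measure.pi fun _ : Fin k => gaussianReal 0 1).map fun x => ∑ i, x i ^ 2

instance chiSq.instIsProbabilityMeasure (k : ℕ) : IsProbabilityMeasure (chiSq k) :=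
  Measure.isProbabilityMeasure_map
    (by have : Measurable fun x : Fin k → ℝ => ∑ i, x i ^ 2 := by fun_prop
        exact this.aemeasurable)

/-- The upper `α` quantile `χ²_{k;α}`. -/
noncomputable def chiSqUpper (k : ℕ) (α : ℝ) : ℝ :=
  sInf {c : ℝ | (chiSq k).real (Set.Ioi c) ≤ α}

/-- The confidence region
`{B : 2 κ̂ ∑ᵢ {⟨t([I₃]), t([Vᵢᵀ Â Uᵢ])⟩ - ⟨t([I₃]), t([Vᵢᵀ B Uᵢ])⟩} < χ²_{3;α}}`. -/
def confidenceRegion (K : Subgroup SO3) (t : SO3 ⧸ K → E) {n : ℕ} (U V : Fin n → SO3)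
    (Ahat : SO3) (κhat α : ℝ) : Set SO3 :=
  {B | 2 * κhat * fitGain K t U V Ahat B < chiSqUpper 3 α}

end Model

/-! Equivariance makes `‖t x‖` constant, so `⟨t x, t y⟩ = ρ² - ‖t x - t y‖² / 2`. Hence `S(B)` is
half a residual sum of squares (`halfRss`), `Â` is a least squares fit, and `D(A) = S(A) - S(Â)`.
The theorem says that this nonlinear regression becomes a linear Gaussian one at scale `ε =
κ^(-1/2)`.

The map `t` is an immersion: if its derivative at the identity killed a direction, equivariance
would make `t` constant along the corresponding one-parameter group, injectivity would put that
group inside `K`, and `K` is finite (`IsEquivariantEmbedding.injective_of_hasFDerivAt`). So there is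
a chart `toRot` at the identity in which the derivative of `t` is isometric. It is a linear change
of the Cayley parametrization, in which conjugations are linear and Haar measure has density
proportional to `(1 + |x|²)⁻²` (`haarMeasure_eq_map_cayley`).

Write `[V i] = [A U i toRot (ε z i)]`. By Laplace's method the `z i` become independent standard
normal vectors of `ℝ³` (`tendsto_integral_mul_scaledDens`). For fixed `z`, `2κ S(A toRot (ε y))`
tends to `‖z - X y‖²`, where `X : ℝ³ → ℝ³ⁿ` is injective and linear (`design`), and the minimum over
all rotations tends to the minimum over `y` (`tendsto_minRss`). Cochran's theorem for the range of
`X` gives independent chi-squared limits with `3(n-1)` and `3` degrees of freedom. These do not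
depend on the `U i`, so the law of the latter is immaterial (`tendsto_integral_regressionLaw`).

For the confidence region, `2κ̂ D(A) = (κ̂/κ) · 2κ D(A)`, and a factor close to one changes the
coverage little (`exists_coverage_tolerance`). If `κ̂` is the maximum likelihood estimate, it
minimizes `relConst k * exp (k S(Â) / n)`; since `relConst k` decays like `k^(-3/2)`, `κ̂` is close
to `3n / (2 S(Â))`, so `κ/κ̂` is close to `2κ S(Â) / (3n)`. The latter has limit law `χ²_{3(n-1)} /
(3n)`, concentrated near one for large `n` (`exists_concentration_mle_close`,
`exists_forall_chiSq_deviation_lt`). -/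

open scoped ENNReal

/-! ### Quaternions and the rotations they define. -/

/-- The matrix of `v ↦ q v q̄` on imaginary quaternions, for the quaternion `q = s + x`. -/
def quatMat (s : ℝ) (x : Fin 3 → ℝ) : Matrix (Fin 3) (Fin 3) ℝ :=
  !![s ^ 2 + x 0 ^ 2 - x 1 ^ 2 - x 2 ^ 2, 2 * (x 0 * x 1 - s * x 2), 2 * (x 0 * x 2 + s * x 1);
     2 * (x 0 * x 1 + s * x 2), s ^ 2 - x 0 ^ 2 + x 1 ^ 2 - x 2 ^ 2, 2 * (x 1 * x 2 - s * x 0);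
     2 * (x 0 * x 2 - s * x 1), 2 * (x 1 * x 2 + s * x 0), s ^ 2 - x 0 ^ 2 - x 1 ^ 2 + x 2 ^ 2]

/-- The squared norm of the quaternion `s + x`. -/
def quatSq (s : ℝ) (x : Fin 3 → ℝ) : ℝ := s ^ 2 + x 0 ^ 2 + x 1 ^ 2 + x 2 ^ 2

lemma quatMat_mul_transpose (s : ℝ) (x : Fin 3 → ℝ) :
    quatMat s x * (quatMat s x).transpose = (quatSq s x) ^ 2 • 1 := by
  ext i j
  fin_cases i <;> fin_cases j <;>
    simp [quatMat, quatSq, Matrix.mul_apply, Fin.sum_univ_three] <;> ring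

lemma quatMat_det (s : ℝ) (x : Fin 3 → ℝ) : (quatMat s x).det = (quatSq s x) ^ 3 := by
  simp [quatMat, quatSq, Matrix.det_fin_three]; ring

lemma quatMat_smul (a s : ℝ) (x : Fin 3 → ℝ) : quatMat (a * s) (a • x) = a ^ 2 • quatMat s x := by
  ext i j
  fin_cases i <;> fin_cases j <;> simp [quatMat] <;> ring

lemma quatSq_smul (a s : ℝ) (x : Fin 3 → ℝ) : quatSq (a * s) (a • x) = a ^ 2 * quatSq s x := by
  simp [quatSq]; ring

/-- Left multiplication by the quaternion `a + p`, on coordinates. -/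
def quatMulMat (a : ℝ) (p : Fin 3 → ℝ) : Matrix (Fin 4) (Fin 4) ℝ :=
  !![a, -p 0, -p 1, -p 2;
     p 0, a, -p 2, p 1;
     p 1, p 2, a, -p 0;
     p 2, -p 1, p 0, a]

lemma quatMulMat_det (a : ℝ) (p : Fin 3 → ℝ) : (quatMulMat a p).det = quatSq a p ^ 2 := by
  simp [quatMulMat, quatSq, Matrix.det_succ_row_zero, Fin.sum_univ_succ, Fin.succAbove]; ring

-- Multiplicativity of the quaternion parametrization. Left multiplication by a quaternion is linear
-- on `ℝ⁴`, and here it covers left multiplication by its matrix; this is what makes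
-- `quatRotMeasure` left invariant.
open Matrix in
lemma quatMat_quatMulMat (a : ℝ) (p : Fin 3 → ℝ) (q : Fin 4 → ℝ) :
    quatMat ((quatMulMat a p *ᵥ q) 0) (fun i => (quatMulMat a p *ᵥ q) i.succ) =
      quatMat a p * quatMat (q 0) (fun i => q i.succ) := by
  have h : quatMulMat a p *ᵥ q = ![a * q 0 - p 0 * q 1 - p 1 * q 2 - p 2 * q 3,
     p 0 * q 0 + a * q 1 - p 2 * q 2 + p 1 * q 3,
     p 1 * q 0 + p 2 * q 1 + a * q 2 - p 0 * q 3,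
     p 2 * q 0 - p 1 * q 1 + p 0 * q 2 + a * q 3] := by
    ext i
    fin_cases i <;> simp [quatMulMat, Matrix.mulVec, dotProduct, Fin.sum_univ_four] <;> ring
  rw [h]
  ext i j
  fin_cases i <;> fin_cases j <;>
    simp [quatMat, Matrix.mul_apply, Fin.sum_univ_three] <;> ring

open Matrix in
lemma quatSq_quatMulMat (a : ℝ) (p : Fin 3 → ℝ) (q : Fin 4 → ℝ) :
    quatSq ((quatMulMat a p *ᵥ q) 0) (fun i => (quatMulMat a p *ᵥ q) i.succ) =
      quatSq a p * quatSq (q 0) (fun i => q i.succ) := by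
  simp [quatSq, quatMulMat, Matrix.mulVec, dotProduct, Fin.sum_univ_four]
  ring

namespace SO3

lemma coe_mul_transpose (g : SO3) :
    (g : Matrix (Fin 3) (Fin 3) ℝ) * (g : Matrix (Fin 3) (Fin 3) ℝ).transpose = 1 :=
  (Matrix.mem_orthogonalGroup_iff (Fin 3) ℝ).1 (Matrix.mem_specialOrthogonalGroup_iff.1 g.2).1

lemma coe_transpose_mul (g : SO3) :
    (g : Matrix (Fin 3) (Fin 3) ℝ).transpose * (g : Matrix (Fin 3) (Fin 3) ℝ) = 1 :=
  (Matrix.mem_orthogonalGroup_iff' (Fin 3) ℝ).1 (Matrix.mem_specialOrthogonalGroup_iff.1 g.2).1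

lemma coe_det (g : SO3) : (g : Matrix (Fin 3) (Fin 3) ℝ).det = 1 :=
  (Matrix.mem_specialOrthogonalGroup_iff.1 g.2).2

lemma adjugate_coe (g : SO3) : (g : Matrix (Fin 3) (Fin 3) ℝ).adjugate =
    (g : Matrix (Fin 3) (Fin 3) ℝ).transpose := by
  have h1 := Matrix.mul_adjugate (g : Matrix (Fin 3) (Fin 3) ℝ)
  rw [coe_det, one_smul] at h1
  calc _ = ((g : Matrix (Fin 3) (Fin 3) ℝ).transpose * g) *
        (g : Matrix (Fin 3) (Fin 3) ℝ).adjugate := by rw [coe_transpose_mul, one_mul]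
    _ = _ := by rw [mul_assoc, h1, mul_one]

/-- The quadratic relations between the entries of a rotation. -/
structure Rel (g : Matrix (Fin 3) (Fin 3) ℝ) : Prop where
  row : ∀ i j, g i 0 * g j 0 + g i 1 * g j 1 + g i 2 * g j 2 = if i = j then 1 else 0
  col : ∀ i j, g 0 i * g 0 j + g 1 i * g 1 j + g 2 i * g 2 j = if i = j then 1 else 0
  c00 : g 1 1 * g 2 2 - g 1 2 * g 2 1 = g 0 0
  c01 : g 1 2 * g 2 0 - g 1 0 * g 2 2 = g 0 1
  c02 : g 1 0 * g 2 1 - g 1 1 * g 2 0 = g 0 2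
  c10 : g 0 2 * g 2 1 - g 0 1 * g 2 2 = g 1 0
  c11 : g 0 0 * g 2 2 - g 0 2 * g 2 0 = g 1 1
  c12 : g 0 1 * g 2 0 - g 0 0 * g 2 1 = g 1 2
  c20 : g 0 1 * g 1 2 - g 0 2 * g 1 1 = g 2 0
  c21 : g 0 2 * g 1 0 - g 0 0 * g 1 2 = g 2 1
  c22 : g 0 0 * g 1 1 - g 0 1 * g 1 0 = g 2 2

lemma rel (g : SO3) : Rel (g : Matrix (Fin 3) (Fin 3) ℝ) := by
  have hadj := adjugate_coe g
  have hr := coe_mul_transpose g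
  have hc := coe_transpose_mul g
  generalize (g : Matrix (Fin 3) (Fin 3) ℝ) = M at *
  have key : ∀ i j, M.adjugate i j = M j i := fun i j => by rw [hadj]; rfl
  have k00 := key 0 0; have k01 := key 1 0; have k02 := key 2 0
  have k10 := key 0 1; have k11 := key 1 1; have k12 := key 2 1
  have k20 := key 0 2; have k21 := key 1 2; have k22 := key 2 2
  simp [Matrix.adjugate_fin_three] at k00 k01 k02 k10 k11 k12 k20 k21 k22
  constructor
  · intro i j
    have := congrFun (congrFun hr i) j
    simpa [Matrix.mul_apply, Fin.sum_univ_three, Matrix.one_apply] using this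
  · intro i j
    have := congrFun (congrFun hc i) j
    simpa [Matrix.mul_apply, Fin.sum_univ_three, Matrix.one_apply] using this
  all_goals linarith

/-- If `g` comes from a unit quaternion `q`, the four candidates for `(s, x)` are the multiples `4
qⱼ q`, `j = 0, …, 3`, expressed through the entries of `g`. Their diagonal entries `4 qⱼ²` add up to
`4`, so at least one candidate is nonzero. -/
lemma quatMat_of_rel {g : Matrix (Fin 3) (Fin 3) ℝ} (h : Rel g) {s : ℝ} {x : Fin 3 → ℝ}
    (hq : (s = 1 + g 0 0 + g 1 1 + g 2 2 ∧ x = ![g 2 1 - g 1 2, g 0 2 - g 2 0, g 1 0 - g 0 1]) ∨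
      (s = g 2 1 - g 1 2 ∧ x = ![1 + g 0 0 - g 1 1 - g 2 2, g 0 1 + g 1 0, g 0 2 + g 2 0]) ∨
      (s = g 0 2 - g 2 0 ∧ x = ![g 0 1 + g 1 0, 1 - g 0 0 + g 1 1 - g 2 2, g 1 2 + g 2 1]) ∨
      (s = g 1 0 - g 0 1 ∧ x = ![g 0 2 + g 2 0, g 1 2 + g 2 1, 1 - g 0 0 - g 1 1 + g 2 2])) :
    quatMat s x = quatSq s x • g := by
  obtain ⟨row, col, c00, c01, c02, c10, c11, c12, c20, c21, c22⟩ := h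
  have r00 := row 0 0; have r01 := row 0 1; have r02 := row 0 2
  have r11 := row 1 1; have r12 := row 1 2; have r22 := row 2 2
  have l00 := col 0 0; have l01 := col 0 1; have l02 := col 0 2
  have l11 := col 1 1; have l12 := col 1 2; have l22 := col 2 2
  simp at r00 r01 r02 r11 r12 r22 l00 l01 l02 l11 l12 l22
  clear row col
  rcases hq with ⟨rfl, rfl⟩ | ⟨rfl, rfl⟩ | ⟨rfl, rfl⟩ | ⟨rfl, rfl⟩
  · have hn : quatSq (1 + g 0 0 + g 1 1 + g 2 2) ![g 2 1 - g 1 2, g 0 2 - g 2 0, g 1 0 - g 0 1] =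
        4 * (1 + g 0 0 + g 1 1 + g 2 2) := by
      simp [quatSq]; linarith
    rw [hn]
    ext i j
    fin_cases i <;> fin_cases j <;> simp [quatMat] <;> linarith
  · have hn : quatSq (g 2 1 - g 1 2) ![1 + g 0 0 - g 1 1 - g 2 2, g 0 1 + g 1 0, g 0 2 + g 2 0] =
        4 * (1 + g 0 0 - g 1 1 - g 2 2) := by
      simp [quatSq]; linarith
    rw [hn]
    ext i j
    fin_cases i <;> fin_cases j <;> simp [quatMat] <;> linarith
  · have hn : quatSq (g 0 2 - g 2 0) ![g 0 1 + g 1 0, 1 - g 0 0 + g 1 1 - g 2 2, g 1 2 + g 2 1] =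
        4 * (1 - g 0 0 + g 1 1 - g 2 2) := by
      simp [quatSq]; linarith
    rw [hn]
    ext i j
    fin_cases i <;> fin_cases j <;> simp [quatMat] <;> linarith
  · have hn : quatSq (g 1 0 - g 0 1) ![g 0 2 + g 2 0, g 1 2 + g 2 1, 1 - g 0 0 - g 1 1 + g 2 2] =
        4 * (1 - g 0 0 - g 1 1 + g 2 2) := by
      simp [quatSq]; linarith
    rw [hn]
    ext i j
    fin_cases i <;> fin_cases j <;> simp [quatMat] <;> linarith

end SO3

lemma quatSq_nonneg (s : ℝ) (x : Fin 3 → ℝ) : 0 ≤ quatSq s x := by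
  unfold quatSq; positivity

lemma quatSq_eq_zero {s : ℝ} {x : Fin 3 → ℝ} (h : quatSq s x = 0) :
    s = 0 ∧ x 0 = 0 ∧ x 1 = 0 ∧ x 2 = 0 := by
  unfold quatSq at h
  refine ⟨?_, ?_, ?_, ?_⟩ <;> refine pow_eq_zero_iff (two_ne_zero) |>.1 ?_ <;>
    nlinarith [sq_nonneg s, sq_nonneg (x 0), sq_nonneg (x 1), sq_nonneg (x 2)]

lemma quatSq_one_pos (x : Fin 3 → ℝ) : 0 < quatSq 1 x := by
  unfold quatSq; positivity

lemma quatMat_mem {s : ℝ} {x : Fin 3 → ℝ} (h : quatSq s x ≠ 0) :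
    (quatSq s x)⁻¹ • quatMat s x ∈ Matrix.specialOrthogonalGroup (Fin 3) ℝ := by
  rw [Matrix.mem_specialOrthogonalGroup_iff, Matrix.mem_orthogonalGroup_iff]
  constructor
  · rw [Matrix.transpose_smul, smul_mul_smul_comm, quatMat_mul_transpose,
      smul_smul, ← sq, ← mul_pow, inv_mul_cancel₀ h, one_pow, one_smul]
  · rw [Matrix.det_smul, quatMat_det, Fintype.card_fin, ← mul_pow, inv_mul_cancel₀ h, one_pow]

open Classical in
/-- The rotation `v ↦ q v q⁻¹` defined by the quaternion `q = s + x`. -/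
noncomputable def quatRot (s : ℝ) (x : Fin 3 → ℝ) : SO3 :=
  if h : quatSq s x ≠ 0 then ⟨(quatSq s x)⁻¹ • quatMat s x, quatMat_mem h⟩ else 1

lemma coe_quatRot {s : ℝ} {x : Fin 3 → ℝ} (h : quatSq s x ≠ 0) :
    (quatRot s x : Matrix (Fin 3) (Fin 3) ℝ) = (quatSq s x)⁻¹ • quatMat s x := by
  rw [quatRot, dif_pos h]

lemma quatRot_smul {a : ℝ} (ha : a ≠ 0) (s : ℝ) (x : Fin 3 → ℝ) :
    quatRot (a * s) (a • x) = quatRot s x := by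
  by_cases h : quatSq s x = 0
  · rw [quatRot, quatRot, dif_neg (by simp [quatSq_smul, h]), dif_neg (by simp [h])]
  · have h' : quatSq (a * s) (a • x) ≠ 0 := by rw [quatSq_smul]; positivity
    apply Subtype.ext
    rw [coe_quatRot h, coe_quatRot h', quatMat_smul, quatSq_smul, smul_smul]
    congr 1
    field_simp

lemma eq_quatRot_of_quatMat_eq {g : SO3} {s : ℝ} {x : Fin 3 → ℝ} (h0 : quatSq s x ≠ 0)
    (h : quatMat s x = quatSq s x • (g : Matrix (Fin 3) (Fin 3) ℝ)) : quatRot s x = g := by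
  apply Subtype.ext
  rw [coe_quatRot h0, h, smul_smul, inv_mul_cancel₀ h0, one_smul]

lemma exists_quatRot_eq (g : SO3) : ∃ s x, quatSq s x = 1 ∧ quatRot s x = g := by
  suffices H : ∃ s x, quatSq s x ≠ 0 ∧ quatRot s x = g by
    obtain ⟨s, x, h, rfl⟩ := H
    have hp : 0 < quatSq s x := lt_of_le_of_ne (quatSq_nonneg _ _) (Ne.symm h)
    have hs : 0 < Real.sqrt (quatSq s x) := Real.sqrt_pos.2 hp
    refine ⟨(Real.sqrt (quatSq s x))⁻¹ * s, (Real.sqrt (quatSq s x))⁻¹ • x, ?_,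
      quatRot_smul (inv_ne_zero hs.ne') s x⟩
    rw [quatSq_smul, inv_pow, Real.sq_sqrt hp.le, inv_mul_cancel₀ h]
  have hr := SO3.rel g
  set M := (g : Matrix (Fin 3) (Fin 3) ℝ) with hM
  have hex : 1 + M 0 0 + M 1 1 + M 2 2 ≠ 0 ∨ 1 + M 0 0 - M 1 1 - M 2 2 ≠ 0 ∨
      1 - M 0 0 + M 1 1 - M 2 2 ≠ 0 ∨ 1 - M 0 0 - M 1 1 + M 2 2 ≠ 0 := by
    by_contra! hcon
    linarith [hcon.1, hcon.2.1, hcon.2.2.1, hcon.2.2.2]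
  rcases hex with h | h | h | h
  · have h0 : quatSq (1 + M 0 0 + M 1 1 + M 2 2) ![M 2 1 - M 1 2, M 0 2 - M 2 0, M 1 0 - M 0 1] ≠ 0 :=
      fun hc => h (quatSq_eq_zero hc).1
    exact ⟨_, _, h0, eq_quatRot_of_quatMat_eq h0 (SO3.quatMat_of_rel hr (Or.inl ⟨rfl, rfl⟩))⟩
  · have h0 : quatSq (M 2 1 - M 1 2) ![1 + M 0 0 - M 1 1 - M 2 2, M 0 1 + M 1 0, M 0 2 + M 2 0] ≠ 0 :=
      fun hc => h (quatSq_eq_zero hc).2.1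
    exact ⟨_, _, h0, eq_quatRot_of_quatMat_eq h0
      (SO3.quatMat_of_rel hr (Or.inr (Or.inl ⟨rfl, rfl⟩)))⟩
  · have h0 : quatSq (M 0 2 - M 2 0) ![M 0 1 + M 1 0, 1 - M 0 0 + M 1 1 - M 2 2, M 1 2 + M 2 1] ≠ 0 :=
      fun hc => h (quatSq_eq_zero hc).2.2.1
    exact ⟨_, _, h0, eq_quatRot_of_quatMat_eq h0
      (SO3.quatMat_of_rel hr (Or.inr (Or.inr (Or.inl ⟨rfl, rfl⟩))))⟩
  · have h0 : quatSq (M 1 0 - M 0 1) ![M 0 2 + M 2 0, M 1 2 + M 2 1, 1 - M 0 0 - M 1 1 + M 2 2] ≠ 0 :=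
      fun hc => h (quatSq_eq_zero hc).2.2.2
    exact ⟨_, _, h0, eq_quatRot_of_quatMat_eq h0
      (SO3.quatMat_of_rel hr (Or.inr (Or.inr (Or.inr ⟨rfl, rfl⟩))))⟩

/-! ### The Cayley parametrization and conjugation. -/

/-- The Cayley parametrization of the rotations of angle other than `π`. -/
noncomputable def cayley (x : Fin 3 → ℝ) : SO3 := quatRot 1 x

lemma coe_cayley (x : Fin 3 → ℝ) :
    (cayley x : Matrix (Fin 3) (Fin 3) ℝ) = (quatSq 1 x)⁻¹ • quatMat 1 x :=
  coe_quatRot (quatSq_one_pos x).ne'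

lemma cayley_zero : cayley 0 = 1 := by
  refine eq_quatRot_of_quatMat_eq (quatSq_one_pos 0).ne' ?_
  ext i j
  fin_cases i <;> fin_cases j <;> simp [quatMat, quatSq]

lemma contDiff_quatSq_one : ContDiff ℝ 1 (quatSq 1) := by
  unfold quatSq; fun_prop

lemma contDiff_cayley (i j : Fin 3) :
    ContDiff ℝ 1 (fun x => (cayley x : Matrix (Fin 3) (Fin 3) ℝ) i j) := by
  have h : (fun x => (cayley x : Matrix (Fin 3) (Fin 3) ℝ) i j) =
      fun x => (quatSq 1 x)⁻¹ * quatMat 1 x i j := by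
    ext x; rw [coe_cayley]; rfl
  rw [h]
  refine (contDiff_quatSq_one.inv fun x => (quatSq_one_pos x).ne').mul ?_
  fin_cases i <;> fin_cases j <;> simp [quatMat] <;> fun_prop

lemma continuous_cayley : Continuous cayley :=
  continuous_induced_rng.2 (continuous_pi fun i => continuous_pi fun j =>
    (contDiff_cayley i j).continuous)

/-- The inverse of the Cayley parametrization. -/
noncomputable def cayleyInv (g : SO3) : Fin 3 → ℝ :=
  (1 + g.1 0 0 + g.1 1 1 + g.1 2 2)⁻¹ • ![g.1 2 1 - g.1 1 2, g.1 0 2 - g.1 2 0, g.1 1 0 - g.1 0 1]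

lemma cayleyInv_cayley (x : Fin 3 → ℝ) : cayleyInv (cayley x) = x := by
  have hp := quatSq_one_pos x
  have h : ∀ i j, (cayley x).1 i j = (quatSq 1 x)⁻¹ * quatMat 1 x i j := fun i j => by
    rw [coe_cayley]; rfl
  have ht : 1 + (cayley x).1 0 0 + (cayley x).1 1 1 + (cayley x).1 2 2 = 4 * (quatSq 1 x)⁻¹ := by
    rw [h, h, h]; field_simp; simp [quatMat, quatSq]; ring
  rw [cayleyInv, ht]
  simp only [h]
  ext i
  fin_cases i <;> simp [quatMat] <;> field_simp <;> ring

lemma cayley_injective : Function.Injective cayley :=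
  Function.LeftInverse.injective cayleyInv_cayley

lemma cayley_cayleyInv {g : SO3} (h : 1 + g.1 0 0 + g.1 1 1 + g.1 2 2 ≠ 0) :
    cayley (cayleyInv g) = g := by
  have h0 : quatSq (1 + g.1 0 0 + g.1 1 1 + g.1 2 2)
      ![g.1 2 1 - g.1 1 2, g.1 0 2 - g.1 2 0, g.1 1 0 - g.1 0 1] ≠ 0 :=
    fun hc => h (quatSq_eq_zero hc).1
  have := eq_quatRot_of_quatMat_eq h0 (SO3.quatMat_of_rel (SO3.rel g) (Or.inl ⟨rfl, rfl⟩))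
  rw [← quatRot_smul (inv_ne_zero h), inv_mul_cancel₀ h] at this
  exact this

lemma SO3.continuous_coe_apply (i j : Fin 3) : Continuous fun g : SO3 => g.1 i j :=
  continuous_subtype_val.matrix_elem i j

/-- The explicit inverse `cayleyInv` is continuous where `1 + trace` does not vanish, in particular
at the identity. Thus `cayley` maps neighbourhoods of `0` onto neighbourhoods of `1`, and no inverse
function theorem is needed. -/
lemma nhds_one_le_map_cayley : 𝓝 (1 : SO3) ≤ map cayley (𝓝 0) := by
  have hc : ∀ i j, Continuous fun g : SO3 => g.1 i j := SO3.continuous_coe_apply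
  have h1 : (1 + (1 : SO3).1 0 0 + (1 : SO3).1 1 1 + (1 : SO3).1 2 2 : ℝ) ≠ 0 := by
    simp; norm_num
  have hcont : Continuous fun g : SO3 => 1 + g.1 0 0 + g.1 1 1 + g.1 2 2 := by
    exact ((continuous_const.add (hc 0 0)).add (hc 1 1)).add (hc 2 2)
  have hinv : ContinuousAt cayleyInv 1 := by
    refine (hcont.continuousAt.inv₀ h1).smul ?_
    refine continuousAt_pi.2 fun i => ?_
    fin_cases i
    · exact ((hc 2 1).sub (hc 1 2)).continuousAt
    · exact ((hc 0 2).sub (hc 2 0)).continuousAt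
    · exact ((hc 1 0).sub (hc 0 1)).continuousAt
  have h0 : cayleyInv 1 = 0 := by rw [← cayley_zero, cayleyInv_cayley]
  have ht : Tendsto cayleyInv (𝓝 1) (𝓝 0) := by simpa [ContinuousAt, h0] using hinv
  intro s hs
  filter_upwards [ht hs, hcont.continuousAt.eventually_ne h1] with g hg hg1
  have : cayley (cayleyInv g) ∈ s := hg
  rwa [cayley_cayleyInv hg1] at this

-- `quatMat s x` is `(s² - |x|²) I + 2 x xᵀ + 2 s [x]`, with `[x]` (called `cr x`) the matrix of the
-- cross product by `x`. Rotations preserve the dot product and, by the cofactor relations, the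
-- cross product.
open Matrix in
lemma SO3.transpose_mul_quatMat_mul (g : SO3) (s : ℝ) (x : Fin 3 → ℝ) :
    (g.1)ᵀ * quatMat s x * g.1 = quatMat s ((g.1)ᵀ *ᵥ x) := by
  obtain ⟨row, col, c00, c01, c02, c10, c11, c12, c20, c21, c22⟩ := SO3.rel g
  have htm := SO3.coe_transpose_mul g
  generalize g.1 = M at *
  let cr : (Fin 3 → ℝ) → Matrix (Fin 3) (Fin 3) ℝ := fun x =>
    !![0, -x 2, x 1; x 2, 0, -x 0; -x 1, x 0, 0]
  have hq : ∀ x, quatMat s x = (s ^ 2 - x ⬝ᵥ x) • 1 + (2 : ℝ) • vecMulVec x x + (2 * s) • cr x := by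
    intro x
    ext i j
    fin_cases i <;> fin_cases j <;>
      simp [quatMat, cr, vecMulVec_apply, dotProduct, Fin.sum_univ_three] <;> ring
  have hcr : Mᵀ * cr x * M = cr (Mᵀ *ᵥ x) := by
    ext i j
    fin_cases i <;> fin_cases j <;>
      simp [cr, Matrix.mul_apply, Fin.sum_univ_three, Matrix.mulVec, dotProduct]
    · ring
    · linear_combination -x 0 * c02 - x 1 * c12 - x 2 * c22
    · linear_combination x 0 * c01 + x 1 * c11 + x 2 * c21
    · linear_combination x 0 * c02 + x 1 * c12 + x 2 * c22
    · ring
    · linear_combination -x 0 * c00 - x 1 * c10 - x 2 * c20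
    · linear_combination -x 0 * c01 - x 1 * c11 - x 2 * c21
    · linear_combination x 0 * c00 + x 1 * c10 + x 2 * c20
    · ring
  have hdot : (Mᵀ *ᵥ x) ⬝ᵥ (Mᵀ *ᵥ x) = x ⬝ᵥ x := by
    have hmt : M * Mᵀ = 1 := mul_eq_one_comm.1 htm
    rw [Matrix.dotProduct_mulVec, Matrix.vecMul_transpose, Matrix.mulVec_mulVec, hmt,
      Matrix.one_mulVec]
  rw [hq, hq, hdot, ← hcr, mul_add, mul_add, add_mul, add_mul, mul_smul_comm, mul_smul_comm,
    mul_smul_comm, smul_mul_assoc, smul_mul_assoc, smul_mul_assoc, mul_one, htm, Matrix.mul_vecMulVec,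
    Matrix.vecMulVec_mul, Matrix.mulVec_transpose]

-- Conjugation is exactly linear in Cayley coordinates, not just to first order. This provides the
-- field `conj` of `RotChart`, hence the linear design of the limiting regression.
open Matrix in
lemma inv_mul_cayley_mul (g : SO3) (x : Fin 3 → ℝ) :
    g⁻¹ * cayley x * g = cayley ((g.1)ᵀ *ᵥ x) := by
  have hmt := SO3.coe_mul_transpose g
  have hdot : quatSq 1 ((g.1)ᵀ *ᵥ x) = quatSq 1 x := by
    have h1 : ∀ y : Fin 3 → ℝ, quatSq 1 y = 1 + y ⬝ᵥ y := fun y => by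
      simp [quatSq, dotProduct, Fin.sum_univ_three]; ring
    rw [h1, h1, Matrix.dotProduct_mulVec, Matrix.vecMul_transpose, Matrix.mulVec_mulVec, hmt,
      Matrix.one_mulVec]
  apply Subtype.ext
  change (g.1)ᵀ * (cayley x).1 * g.1 = (cayley ((g.1)ᵀ *ᵥ x)).1
  rw [coe_cayley, coe_cayley, hdot, mul_smul_comm, smul_mul_assoc, SO3.transpose_mul_quatMat_mul]

/-! ### Haar measure in Cayley coordinates. -/

instance SO3.instSecondCountableTopology : SecondCountableTopology SO3 :=
  haveI : SecondCountableTopology (Matrix (Fin 3) (Fin 3) ℝ) :=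
    inferInstanceAs (SecondCountableTopology (Fin 3 → Fin 3 → ℝ))
  Topology.IsEmbedding.subtypeVal.secondCountableTopology

lemma continuous_quatSq : Continuous fun p : ℝ × (Fin 3 → ℝ) => quatSq p.1 p.2 := by
  unfold quatSq; fun_prop

lemma measurable_quatRot : Measurable fun p : ℝ × (Fin 3 → ℝ) => quatRot p.1 p.2 := by
  classical
  set s : Set (ℝ × (Fin 3 → ℝ)) := {p | quatSq p.1 p.2 ≠ 0} with hs
  have hso : IsOpen s := continuous_quatSq.isOpen_preimage _ isOpen_ne
  have hf : ContinuousOn (fun p : ℝ × (Fin 3 → ℝ) => quatRot p.1 p.2) s := by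
    rw [Topology.IsInducing.subtypeVal.continuousOn_iff]
    have h1 : ContinuousOn (fun p : ℝ × (Fin 3 → ℝ) => (quatSq p.1 p.2)⁻¹ • quatMat p.1 p.2) s := by
      refine (continuous_quatSq.continuousOn.inv₀ fun p hp => hp).smul (Continuous.continuousOn ?_)
      refine continuous_pi fun i => continuous_pi fun j => ?_
      fin_cases i <;> fin_cases j <;> simp [quatMat] <;> fun_prop
    exact h1.congr fun p hp => coe_quatRot hp
  have hpw : (fun p : ℝ × (Fin 3 → ℝ) => quatRot p.1 p.2) =
      s.piecewise (fun p => quatRot p.1 p.2) (fun _ => 1) := by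
    ext1 p
    by_cases hp : p ∈ s
    · simp [hp]
    · rw [Set.piecewise_eq_of_notMem _ _ _ hp]
      exact dif_neg hp
  rw [hpw]
  exact hf.measurable_piecewise continuousOn_const hso.measurableSet

lemma lintegral_smul_coord {s : ℝ} (hs : s ≠ 0) {g : (Fin 3 → ℝ) → ℝ≥0∞} (hg : Measurable g) :
    ∫⁻ y, g y = ENNReal.ofReal (|s| ^ 3) * ∫⁻ x, g (s • x) := by
  have h := Measure.map_addHaar_smul (volume : Measure (Fin 3 → ℝ)) hs
  rw [← lintegral_map hg (measurable_const_smul s), h, lintegral_smul_measure, smul_eq_mul,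
    ← mul_assoc, ← ENNReal.ofReal_mul (by positivity), Module.finrank_fin_fun, abs_inv, abs_pow,
    mul_inv_cancel₀ (by positivity), ENNReal.ofReal_one, one_mul]

lemma lintegral_mul_coord {s : ℝ} (hs : 0 < s) {g : ℝ → ℝ≥0∞} (hg : Measurable g) :
    ∫⁻ x, g (s * x) = ENNReal.ofReal s⁻¹ * ∫⁻ y, g y := by
  have h := Measure.map_addHaar_smul (volume : Measure ℝ) hs.ne'
  have h1 : ∫⁻ x, g (s * x) = ∫⁻ x, g (s • x) := rfl
  rw [h1, ← lintegral_map hg (measurable_const_smul s), h, lintegral_smul_measure, smul_eq_mul,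
    Module.finrank_self, pow_one, abs_of_pos (inv_pos.2 hs)]

/-- The quaternions of norm in `(0, 1)`, in coordinates. -/
def quatBall : Set (Fin 4 → ℝ) := {q | 0 < quatSq (q 0) (Fin.tail q) ∧ quatSq (q 0) (Fin.tail q) < 1}

lemma continuous_quatSq_tail : Continuous fun q : Fin 4 → ℝ => quatSq (q 0) (Fin.tail q) := by
  unfold quatSq Fin.tail; fun_prop

lemma isOpen_quatBall : IsOpen quatBall :=
  (isOpen_lt continuous_const continuous_quatSq_tail).inter
    (isOpen_lt continuous_quatSq_tail continuous_const)

lemma volume_quatBall_ne_top : volume quatBall ≠ ∞ := by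
  have hsub : quatBall ⊆ Metric.closedBall 0 1 := by
    intro q hq
    have h := hq.2
    rw [mem_closedBall_zero_iff, pi_norm_le_iff_of_nonneg zero_le_one]
    intro i
    simp only [quatSq, Fin.tail] at h
    rw [Real.norm_eq_abs, abs_le_one_iff_mul_self_le_one]
    have h0 : (q 0)^2 + (q 1)^2 + (q 2)^2 + (q 3)^2 < 1 := h
    fin_cases i <;> simp <;> nlinarith [sq_nonneg (q 0), sq_nonneg (q 1), sq_nonneg (q 2), sq_nonneg (q 3)]
  exact ((measure_mono hsub).trans_lt (isCompact_closedBall _ _).measure_lt_top).ne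

lemma volume_quatBall_ne_zero : volume quatBall ≠ 0 := by
  refine (isOpen_quatBall.measure_pos volume ⟨fun _ => 1 / 4, ?_⟩).ne'
  simp only [quatBall, quatSq, Fin.tail, Set.mem_ofPred_eq]
  norm_num

/-- The rotation defined by a quaternion uniformly distributed in the unit ball. -/
noncomputable def quatRotMeasure : Measure SO3 :=
  (volume.restrict quatBall).map fun q => quatRot (q 0) (Fin.tail q)

lemma measurable_quatRot_tail : Measurable fun q : Fin 4 → ℝ => quatRot (q 0) (Fin.tail q) :=
  measurable_quatRot.comp (f := fun q : Fin 4 → ℝ => (q 0, Fin.tail q))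
    (Continuous.measurable (by unfold Fin.tail; fun_prop))

lemma quatRotMeasure_univ : quatRotMeasure univ = volume quatBall := by
  rw [quatRotMeasure, Measure.map_apply measurable_quatRot_tail .univ]; simp

instance quatRotMeasure.isFiniteMeasure : IsFiniteMeasure quatRotMeasure :=
  ⟨by rw [quatRotMeasure_univ]; exact volume_quatBall_ne_top.lt_top⟩

-- Every rotation comes from a unit quaternion, whose left multiplication has determinant one and
-- preserves the norm. It therefore preserves Lebesgue measure on the ball, and it covers left
-- translation of rotations.
open Matrix in
instance quatRotMeasure.isMulLeftInvariant : quatRotMeasure.IsMulLeftInvariant := by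
  refine ⟨fun g => ?_⟩
  obtain ⟨a, p, hap, rfl⟩ := exists_quatRot_eq g
  have hdet : (quatMulMat a p).det = 1 := by rw [quatMulMat_det, hap, one_pow]
  have hmp : MeasurePreserving (fun q : Fin 4 → ℝ => quatMulMat a p *ᵥ q) := by
    refine ⟨Continuous.measurable (by fun_prop), ?_⟩
    have := Real.map_matrix_volume_pi_eq_smul_volume_pi (M := quatMulMat a p) (by simp [hdet])
    rw [hdet, inv_one, abs_one, ENNReal.ofReal_one, one_smul] at this
    exact this
  have hsq : ∀ q : Fin 4 → ℝ, quatSq ((quatMulMat a p *ᵥ q) 0) (Fin.tail (quatMulMat a p *ᵥ q)) =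
      quatSq (q 0) (Fin.tail q) := fun q => by
    have := quatSq_quatMulMat a p q
    rw [hap, one_mul] at this
    exact this
  have hpre : (fun q : Fin 4 → ℝ => quatMulMat a p *ᵥ q) ⁻¹' quatBall = quatBall := by
    ext q
    simp only [quatBall, Set.mem_preimage, Set.mem_ofPred_eq, hsq]
  have hmp' := hmp.restrict_preimage isOpen_quatBall.measurableSet
  rw [hpre] at hmp'
  rw [quatRotMeasure, Measure.map_map (measurable_const_mul _) measurable_quatRot_tail]
  conv_rhs => rw [← hmp'.map_eq]
  rw [Measure.map_map measurable_quatRot_tail hmp'.measurable]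
  refine Measure.map_congr ?_
  filter_upwards [ae_restrict_mem isOpen_quatBall.measurableSet] with q hq
  have h0 : quatSq (q 0) (Fin.tail q) ≠ 0 := hq.1.ne'
  have hap0 : quatSq a p ≠ 0 := by rw [hap]; exact one_ne_zero
  simp only [Function.comp_apply]
  symm
  refine eq_quatRot_of_quatMat_eq (by rw [hsq]; exact h0) ?_
  have := quatMat_quatMulMat a p q
  rw [hsq]
  refine this.trans ?_
  change _ = quatSq (q 0) (Fin.tail q) • ((quatRot a p).1 * (quatRot (q 0) (Fin.tail q)).1)
  rw [coe_quatRot hap0, coe_quatRot h0, hap, inv_one, one_smul, mul_smul_comm, smul_smul,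
    mul_inv_cancel₀ h0, one_smul]
  rfl

/-- In the integral over quaternions `s + y`, put `y = s x`: the rotation becomes `cayley x`,
whatever `s` is, with Jacobian `|s|³`. The ball condition bears on `a s`, `a² = quatSq 1 x`, so
rescaling `s` by `a` produces the factor `a⁻³ · a⁻¹ = (quatSq 1 x ^ 2)⁻¹` and leaves the constant `J
= ∫ k`. -/
lemma quatRotMeasure_eq_smul_map_cayley : ∃ J : ℝ≥0∞, quatRotMeasure =
    J • (volume.withDensity fun x => ENNReal.ofReal ((quatSq 1 x ^ 2)⁻¹)).map cayley := by
  have hcay : Measurable cayley := continuous_cayley.measurable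
  set k : ℝ → ℝ≥0∞ := fun s => ({s : ℝ | 0 < s ^ 2 ∧ s ^ 2 < 1}).indicator
    (fun s => ENNReal.ofReal (|s| ^ 3)) s with hk
  have hkset : MeasurableSet {s : ℝ | 0 < s ^ 2 ∧ s ^ 2 < 1} := by
    refine MeasurableSet.inter ?_ ?_
    · exact measurableSet_lt measurable_const (measurable_id.pow_const 2)
    · exact measurableSet_lt (measurable_id.pow_const 2) measurable_const
  have hkm : Measurable k := Measurable.indicator (by fun_prop) hkset
  have hdm : Measurable fun x : Fin 3 → ℝ => ENNReal.ofReal ((quatSq 1 x ^ 2)⁻¹) := by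
    have := contDiff_quatSq_one.continuous.measurable
    fun_prop
  refine ⟨∫⁻ s, k s, ?_⟩
  refine Measure.ext_of_lintegral _ fun f hf => ?_
  rw [lintegral_smul_measure, lintegral_map hf hcay, lintegral_withDensity_eq_lintegral_mul _ hdm
    (g := fun x => f (cayley x)) (hf.comp hcay), quatRotMeasure, lintegral_map hf measurable_quatRot_tail,
    ← lintegral_indicator isOpen_quatBall.measurableSet]
  set B : Set (ℝ × (Fin 3 → ℝ)) := {p | 0 < quatSq p.1 p.2 ∧ quatSq p.1 p.2 < 1} with hB
  have hBm : MeasurableSet B :=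
    ((isOpen_lt continuous_const continuous_quatSq).inter
      (isOpen_lt continuous_quatSq continuous_const)).measurableSet
  set g : ℝ × (Fin 3 → ℝ) → ℝ≥0∞ := B.indicator fun p => f (quatRot p.1 p.2) with hg
  have hgm : Measurable g := (hf.comp measurable_quatRot).indicator hBm
  have hmp := volume_preserving_piFinSuccAbove (fun _ : Fin 4 => ℝ) 0
  have e1 : ∀ q : Fin 4 → ℝ, quatBall.indicator (fun q => f (quatRot (q 0) (Fin.tail q))) q =
      g (MeasurableEquiv.piFinSuccAbove (fun _ : Fin 4 => ℝ) 0 q) := fun q => rfl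
  rw [lintegral_congr e1, hmp.lintegral_comp hgm]
  change ∫⁻ p, g p ∂((volume : Measure ℝ).prod (volume : Measure (Fin 3 → ℝ))) = _
  rw [lintegral_prod _ hgm.aemeasurable]
  have e2 : ∀ᵐ s : ℝ, ∫⁻ y, g (s, y) = ∫⁻ x, ENNReal.ofReal (|s| ^ 3) * g (s, s • x) := by
    filter_upwards [Measure.ae_ne volume 0] with s hs
    rw [lintegral_smul_coord hs (g := fun y => g (s, y)) (by fun_prop),
      lintegral_const_mul _ (by fun_prop)]
  rw [lintegral_congr_ae e2, lintegral_lintegral_swap (Measurable.aemeasurable (by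
    unfold Function.uncurry; fun_prop)), smul_eq_mul, ← lintegral_const_mul _ (by
    exact hdm.mul (hf.comp hcay))]
  refine lintegral_congr fun x => ?_
  have hq := quatSq_one_pos x
  set a := Real.sqrt (quatSq 1 x) with ha
  have hapos : 0 < a := Real.sqrt_pos.2 hq
  have hasq : a ^ 2 = quatSq 1 x := Real.sq_sqrt hq.le
  have e3 : ∀ᵐ s : ℝ, ENNReal.ofReal (|s| ^ 3) * g (s, s • x) =
      ENNReal.ofReal (a⁻¹ ^ 3) * f (cayley x) * k (a * s) := by
    filter_upwards [Measure.ae_ne volume 0] with s hs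
    have h1 : quatSq s (s • x) = (a * s) ^ 2 := by
      have := quatSq_smul s 1 x
      rw [mul_one] at this
      rw [this, ← hasq]; ring
    have h2 : quatRot s (s • x) = cayley x := by
      have := quatRot_smul hs 1 x
      rwa [mul_one] at this
    have hgs : g (s, s • x) = ({s : ℝ | 0 < s ^ 2 ∧ s ^ 2 < 1}).indicator
        (fun _ => f (cayley x)) (a * s) := by
      simp only [hg, hB, Set.indicator, Set.mem_ofPred_eq, h1, h2]
    rw [hgs, hk]
    by_cases hmem : a * s ∈ {s : ℝ | 0 < s ^ 2 ∧ s ^ 2 < 1}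
    · simp only [Set.indicator_of_mem hmem]
      rw [mul_right_comm, ← ENNReal.ofReal_mul (by positivity), abs_mul, abs_of_pos hapos]
      congr 2
      field_simp
    · simp only [Set.indicator_of_notMem hmem, mul_zero]
  rw [lintegral_congr_ae e3, lintegral_const_mul _ (by fun_prop), lintegral_mul_coord hapos hkm]
  simp only [Pi.mul_apply]
  rw [← hasq]
  have h3 : ENNReal.ofReal (((a ^ 2) ^ 2)⁻¹) = ENNReal.ofReal (a⁻¹ ^ 3) * ENNReal.ofReal a⁻¹ := by
    rw [← ENNReal.ofReal_mul (by positivity)]; congr 1; field_simp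
  rw [h3]; ring

/-- The normalized Haar measure of `SO(3)` in the Cayley parametrization. -/
theorem haarMeasure_eq_map_cayley : ∃ C : ℝ, 0 < C ∧
    Measure.haarMeasure (⊤ : TopologicalSpace.PositiveCompacts SO3) =
      (volume.withDensity fun x => ENNReal.ofReal (C * (quatSq 1 x ^ 2)⁻¹)).map cayley := by
  obtain ⟨J, hJ⟩ := quatRotMeasure_eq_smul_map_cayley
  have hu := Measure.haarMeasure_unique quatRotMeasure (⊤ : TopologicalSpace.PositiveCompacts SO3)
  rw [TopologicalSpace.PositiveCompacts.coe_top, quatRotMeasure_univ] at hu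
  set w := volume quatBall
  have hw0 : w ≠ 0 := volume_quatBall_ne_zero
  have hwt : w ≠ ∞ := volume_quatBall_ne_top
  have huniv := congrArg (fun μ : Measure SO3 => μ univ) hJ
  simp only [quatRotMeasure_univ, Measure.smul_apply, smul_eq_mul] at huniv
  change w = _ at huniv
  -- The total mass of `quatRotMeasure` is neither zero nor infinite, so `J` need not be computed.
  have hJ0 : J ≠ 0 := by rintro rfl; simp at huniv; exact hw0 huniv
  have hJt : J ≠ ∞ := by
    rintro rfl
    rcases eq_or_ne (((volume.withDensity fun x => ENNReal.ofReal ((quatSq 1 x ^ 2)⁻¹)).map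
      cayley) univ) 0 with h | h
    · rw [h, mul_zero] at huniv; exact hw0 huniv
    · rw [ENNReal.top_mul h] at huniv; exact hwt huniv
  have hC0 : w⁻¹ * J ≠ 0 := mul_ne_zero (ENNReal.inv_ne_zero.2 hwt) hJ0
  have hCt : w⁻¹ * J ≠ ∞ := ENNReal.mul_ne_top (ENNReal.inv_ne_top.2 hw0) hJt
  refine ⟨(w⁻¹ * J).toReal, ENNReal.toReal_pos hC0 hCt, ?_⟩
  have hdm : Measurable fun x : Fin 3 → ℝ => ENNReal.ofReal ((quatSq 1 x ^ 2)⁻¹) := by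
    have := contDiff_quatSq_one.continuous.measurable
    fun_prop
  have hd : (fun x : Fin 3 → ℝ => ENNReal.ofReal ((w⁻¹ * J).toReal * (quatSq 1 x ^ 2)⁻¹)) =
      (w⁻¹ * J) • fun x : Fin 3 → ℝ => ENNReal.ofReal ((quatSq 1 x ^ 2)⁻¹) := by
    ext x
    rw [ENNReal.ofReal_mul ENNReal.toReal_nonneg, ENNReal.ofReal_toReal hCt]; rfl
  rw [hd, withDensity_smul _ hdm, Measure.map_smul, mul_smul, ← hJ, hu, smul_smul,
    ENNReal.inv_mul_cancel hw0 hwt, one_smul]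

instance SO3.instPolishSpace : PolishSpace SO3 := by
  let _ := TopologicalSpace.metrizableSpaceMetric SO3
  infer_instance

/-- Unimodularity of a compact group: a right translate of Haar measure is left invariant with the
same total mass. -/
instance haar_isMulRightInvariant :
    (Measure.haarMeasure (⊤ : TopologicalSpace.PositiveCompacts SO3)).IsMulRightInvariant := by
  refine ⟨fun g => ?_⟩
  set μ := Measure.haarMeasure (⊤ : TopologicalSpace.PositiveCompacts SO3) with hμ
  have : IsFiniteMeasure (μ.map fun x => x * g) := by
    have : IsFiniteMeasure μ := inferInstance
    infer_instance
  have hl : (μ.map fun x => x * g).IsMulLeftInvariant := by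
    refine ⟨fun h => ?_⟩
    rw [Measure.map_map (measurable_const_mul h) (measurable_mul_const g)]
    have : ((fun x => h * x) ∘ fun x : SO3 => x * g) = (fun x => x * g) ∘ fun x => h * x := by
      ext1 x; simp [mul_assoc]
    rw [this, ← Measure.map_map (measurable_mul_const g) (measurable_const_mul h), map_mul_left_eq_self]
  have hu := Measure.haarMeasure_unique (μ.map fun x => x * g)
    (⊤ : TopologicalSpace.PositiveCompacts SO3)
  rw [← hμ, TopologicalSpace.PositiveCompacts.coe_top,
    Measure.map_apply (measurable_mul_const g) .univ, preimage_univ] at hu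
  have h1 : μ univ = 1 := Measure.haarMeasure_self
  rw [hu, h1, one_smul]

instance haar_isProbabilityMeasure :
    IsProbabilityMeasure (Measure.haarMeasure (⊤ : TopologicalSpace.PositiveCompacts SO3)) :=
  ⟨Measure.haarMeasure_self⟩

/-! ### The quotient `SO(3)/K` as a Borel space. -/

section Quotient

variable (K : Subgroup SO3)

/-- The σ-algebra of the quotient is the image of the Borel one. It agrees with the Borel σ-algebra
of the quotient topology because `SO(3)` is Polish and the quotient by a finite subgroup is
Hausdorff. -/
instance quotient_borelSpace [Finite K] : BorelSpace (SO3 ⧸ K) := by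
  refine ⟨?_⟩
  have h := (QuotientGroup.continuous_mk (N := K)).map_borel_eq (QuotientGroup.mk_surjective)
  rw [← h]; rfl

lemma measurable_rotClass : Measurable (rotClass K) := fun _ h => h

instance uniformRot_isProbabilityMeasure : IsProbabilityMeasure (uniformRot K) :=
  Measure.isProbabilityMeasure_map (measurable_rotClass K).aemeasurable

lemma continuous_rotClass : Continuous (rotClass K) := QuotientGroup.continuous_mk

end Quotient

/-! ### An equivariant embedding is an immersion. -/

section Embedding

variable {E : Type*} [NormedAddCommGroup E] [InnerProductSpace ℝ E] {K : Subgroup SO3}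
  {act : SO3 →* (E ≃ₗᵢ[ℝ] E)} {t : SO3 ⧸ K → E}

namespace IsEquivariantEmbedding

lemma apply_mul (ht : IsEquivariantEmbedding K act t) (g h : SO3) :
    t (rotClass K (g * h)) = act g (t (rotClass K h)) := ht.equivariant g (rotClass K h)

lemma continuous_comp (ht : IsEquivariantEmbedding K act t) :
    Continuous fun U : SO3 => t (rotClass K U) := by
  obtain ⟨F, hF, hFt⟩ := ht.contDiff
  simp_rw [← hFt]
  exact hF.continuous.comp (continuous_pi fun i => continuous_pi fun j =>
    SO3.continuous_coe_apply i j)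

lemma continuous (ht : IsEquivariantEmbedding K act t) : Continuous t :=
  (QuotientGroup.isQuotientMap_mk (N := K)).continuous_iff.2 ht.continuous_comp

lemma apply_eq_iff (ht : IsEquivariantEmbedding K act t) (g : SO3) :
    t (rotClass K g) = t (rotClass K 1) ↔ g ∈ K := by
  rw [ht.injective.eq_iff, eq_comm, QuotientGroup.eq]
  simp

lemma differentiableAt_cayley (ht : IsEquivariantEmbedding K act t) :
    DifferentiableAt ℝ (fun x => t (rotClass K (cayley x))) 0 := by
  obtain ⟨F, hF, hFt⟩ := ht.contDiff
  simp_rw [← hFt]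
  have hc : DifferentiableAt ℝ (fun x => fun i j => (cayley x : Matrix (Fin 3) (Fin 3) ℝ) i j) 0 :=
    differentiableAt_pi.2 fun i => differentiableAt_pi.2 fun j =>
      ((contDiff_cayley i j).differentiable one_ne_zero).differentiableAt
  exact ((hF.differentiable one_ne_zero).differentiableAt).comp _ hc

end IsEquivariantEmbedding

/-- The rotations about a fixed axis. -/
noncomputable def axisRot (e : Fin 3 → ℝ) (θ : ℝ) : SO3 :=
  quatRot (Real.cos θ) (Real.sin θ • e)

lemma quatSq_axis {e : Fin 3 → ℝ} (he : quatSq 0 e = 1) (θ : ℝ) :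
    quatSq (Real.cos θ) (Real.sin θ • e) = 1 := by
  simp only [quatSq, Pi.smul_apply, smul_eq_mul] at *
  linear_combination Real.sin_sq_add_cos_sq θ + Real.sin θ ^ 2 * he

open Matrix in
lemma axisRot_add {e : Fin 3 → ℝ} (he : quatSq 0 e = 1) (a b : ℝ) :
    axisRot e (a + b) = axisRot e a * axisRot e b := by
  have h1 := quatSq_axis he
  refine eq_quatRot_of_quatMat_eq (by rw [h1]; exact one_ne_zero) ?_
  change _ = _ • ((axisRot e a).1 * (axisRot e b).1)
  rw [axisRot, axisRot, coe_quatRot (by rw [h1]; exact one_ne_zero),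
    coe_quatRot (by rw [h1]; exact one_ne_zero), h1, h1, h1]
  simp only [inv_one, one_smul]
  have hq := quatMat_quatMulMat (Real.cos a) (Real.sin a • e)
    (Fin.cons (Real.cos b) (Real.sin b • e))
  have hv : quatMulMat (Real.cos a) (Real.sin a • e) *ᵥ (Fin.cons (Real.cos b) (Real.sin b • e)) =
      Fin.cons (Real.cos (a + b)) (Real.sin (a + b) • e) := by
    have h0 : e 0 ^ 2 + e 1 ^ 2 + e 2 ^ 2 = 1 := by simpa [quatSq] using he
    have k1 : (Fin.cons (Real.cos b) (Real.sin b • e) : Fin 4 → ℝ) =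
      ![Real.cos b, Real.sin b * e 0, Real.sin b * e 1, Real.sin b * e 2] := by
      ext i; fin_cases i <;> rfl
    have k2 : (Fin.cons (Real.cos (a + b)) (Real.sin (a + b) • e) : Fin 4 → ℝ) =
      ![Real.cos (a + b), Real.sin (a + b) * e 0, Real.sin (a + b) * e 1, Real.sin (a + b) * e 2] := by
      ext i; fin_cases i <;> rfl
    rw [k1, k2, Real.cos_add, Real.sin_add]
    ext i
    fin_cases i <;> simp [quatMulMat, Matrix.mulVec, dotProduct, Fin.sum_univ_four]
    · linear_combination -(Real.sin a * Real.sin b) * h0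
    all_goals ring
  rw [hv] at hq
  exact hq

lemma axisRot_eq_cayley (e : Fin 3 → ℝ) {θ : ℝ} (h : Real.cos θ ≠ 0) :
    axisRot e θ = cayley (Real.tan θ • e) := by
  rw [cayley, ← quatRot_smul h, mul_one, smul_smul, mul_comm, Real.tan_mul_cos h]; rfl

/-- A one-to-one `C¹` map may have a singular derivative; equivariance and the finiteness of `K`
exclude it. A unit vector `e` in the kernel gives the one-parameter group `axisRot e` along which
`t` has derivative zero at the identity, hence everywhere, so the group lies in the stabilizer `K`.
-/
lemma IsEquivariantEmbedding.injective_of_hasFDerivAt [Finite K]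
    (ht : IsEquivariantEmbedding K act t) {T : (Fin 3 → ℝ) →L[ℝ] E}
    (hT : HasFDerivAt (fun x => t (rotClass K (cayley x))) T 0) : Function.Injective T := by
  rw [injective_iff_map_eq_zero]
  intro x hx
  by_contra hx0
  obtain ⟨e, he, hTe⟩ : ∃ e, quatSq 0 e = 1 ∧ T e = 0 := by
    have h0 : quatSq 0 x ≠ 0 := by
      intro h
      obtain ⟨-, h0, h1, h2⟩ := quatSq_eq_zero h
      exact hx0 (by ext i; fin_cases i <;> simp [h0, h1, h2])
    have hp : 0 < quatSq 0 x := lt_of_le_of_ne (quatSq_nonneg _ _) (Ne.symm h0)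
    refine ⟨(Real.sqrt (quatSq 0 x))⁻¹ • x, ?_, by rw [map_smul, hx, smul_zero]⟩
    have := quatSq_smul (Real.sqrt (quatSq 0 x))⁻¹ 0 x
    rwa [mul_zero, inv_pow, Real.sq_sqrt hp.le, inv_mul_cancel₀ h0] at this
  set φ : ℝ → E := fun θ => t (rotClass K (axisRot e θ)) with hφ
  have hd0 : HasDerivAt φ 0 0 := by
    have htan : HasDerivAt (fun θ => Real.tan θ • e) ((1 : ℝ) • e) 0 := by
      have := (Real.hasDerivAt_tan (x := 0) (by simp)).smul_const e
      simpa using this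
    have hT' : HasFDerivAt (fun x => t (rotClass K (cayley x))) T (Real.tan 0 • e) := by
      simpa using hT
    have := hT'.comp_hasDerivAt 0 htan
    rw [one_smul, hTe] at this
    refine this.congr_of_eventuallyEq ?_
    filter_upwards [Real.continuous_cos.continuousAt.eventually_ne (show Real.cos 0 ≠ 0 by simp)]
      with θ hθ
    simp only [hφ, Function.comp_apply, axisRot_eq_cayley e hθ]
  -- Since `φ x` is the image of `φ (x - θ)` under the isometry `act (axisRot e θ)`, the zero
  -- derivative is carried from `0` to `θ`.
  have hd : ∀ θ, HasDerivAt φ 0 θ := by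
    intro θ
    have h1 : HasDerivAt (fun x => φ (x - θ)) 0 θ :=
      HasDerivAt.comp_sub_const θ θ (by simpa using hd0)
    have h2 := ((act (axisRot e θ)).toContinuousLinearEquiv.toContinuousLinearMap.hasFDerivAt
      (x := φ (θ - θ))).comp_hasDerivAt θ h1
    rw [map_zero] at h2
    refine h2.congr_of_eventuallyEq (Eventually.of_forall fun x => ?_)
    change φ x = act (axisRot e θ) (φ (x - θ))
    rw [hφ]
    simp only
    rw [← ht.apply_mul, ← axisRot_add he, add_sub_cancel]
  have hconst : ∀ θ, φ θ = φ 0 := fun θ =>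
    is_const_of_deriv_eq_zero (fun x => (hd x).differentiableAt) (fun x => (hd x).deriv) θ 0
  have h0 : axisRot e 0 = 1 := by
    rw [axisRot_eq_cayley e (by simp)]; simp [cayley_zero]
  have hK : ∀ r : ℝ, cayley (r • e) ∈ K := by
    intro r
    have := hconst (Real.arctan r)
    simp only [hφ, h0] at this
    rw [ht.apply_eq_iff, axisRot_eq_cayley e (Real.cos_arctan_pos r).ne', Real.tan_arctan] at this
    exact this
  have he0 : e ≠ 0 := by rintro rfl; simp [quatSq] at he
  have hinj : Function.Injective fun r : ℝ => (⟨cayley (r • e), hK r⟩ : K) := by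
    intro r s hrs
    exact smul_left_injective ℝ he0 (cayley_injective (congrArg Subtype.val hrs))
  exact (Finite.of_injective _ hinj).false

end Embedding

/-! ### Charts at the identity adapted to `t` and to the uniform distribution. -/

/-- A parametrization of `SO(3)` around the identity, isometric to first order for the metric
induced by `t`, in which the uniform distribution of `SO(3)/K` has a density that charges only the
parameters of a neighbourhood of the identity and of rotations away from `K`. -/
structure RotChart {E : Type*} [NormedAddCommGroup E] [InnerProductSpace ℝ E] (K : Subgroup SO3)
    (t : SO3 ⧸ K → E) where
  /-- the parametrization -/
  toRot : EuclideanSpace ℝ (Fin 3) → SO3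
  /-- the derivative of `t` in the parametrization -/
  diff : EuclideanSpace ℝ (Fin 3) →ₗᵢ[ℝ] E
  /-- the density of the uniform distribution -/
  dens : EuclideanSpace ℝ (Fin 3) → ℝ
  continuous_toRot : Continuous toRot
  toRot_zero : toRot 0 = 1
  /-- a local inverse of the parametrization -/
  symm : SO3 → EuclideanSpace ℝ (Fin 3)
  tendsto_symm : Tendsto symm (𝓝 1) (𝓝 0)
  toRot_symm : ∀ᶠ g in 𝓝 (1 : SO3), toRot (symm g) = g
  conj : ∀ g : SO3, ∃ ρ : EuclideanSpace ℝ (Fin 3) →ₗ[ℝ] EuclideanSpace ℝ (Fin 3),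
    Function.Injective ρ ∧ ∀ z, g⁻¹ * toRot z * g = toRot (ρ z)
  hasFDerivAt : HasFDerivAt (fun z => t (rotClass K (toRot z))) diff.toContinuousLinearMap 0
  measurable_dens : Measurable dens
  dens_nonneg : ∀ z, 0 ≤ dens z
  -- This decay, integrable on `ℝ³`, controls parameters so large that the exponential factor no
  -- longer helps.
  dens_le : ∃ C, 0 < C ∧ ∀ z, dens z ≤ C * ((1 + ‖z‖ ^ 2) ^ 2)⁻¹
  continuousAt_dens : ContinuousAt dens 0
  dens_zero_pos : 0 < dens 0
  uniformRot_eq : uniformRot K =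
    (volume.withDensity fun z => ENNReal.ofReal (dens z)).map fun z => rotClass K (toRot z)
  -- Near the nontrivial elements of `K` the embedding returns to `t [1]`, and the bound would fail
  -- there; this is why the density is made to vanish near them.
  lower : ∃ a, 0 < a ∧ ∀ z, dens z ≠ 0 →
    a * min (‖z‖ ^ 2) 1 ≤ ‖t (rotClass K (toRot z)) - t (rotClass K 1)‖ ^ 2

lemma eventually_half_norm_le {F E : Type*} [NormedAddCommGroup F] [NormedSpace ℝ F]
    [NormedAddCommGroup E] [NormedSpace ℝ E] {f : F → E} {L : F →ₗᵢ[ℝ] E}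
    (hf : HasFDerivAt f L.toContinuousLinearMap 0) :
    ∀ᶠ z in 𝓝 0, 1 / 2 * ‖z‖ ≤ ‖f z - f 0‖ := by
  filter_upwards [hf.isLittleO.def (show (0 : ℝ) < 1 / 2 by norm_num)] with z hz
  rw [sub_zero] at hz
  have h2 : ‖L.toContinuousLinearMap z‖ = ‖z‖ := L.norm_map z
  have h3 := norm_sub_norm_le (L.toContinuousLinearMap z) (f z - f 0)
  rw [norm_sub_rev (L.toContinuousLinearMap z)] at h3
  linarith

lemma exists_isometric_coordinates {E : Type*} [NormedAddCommGroup E] [InnerProductSpace ℝ E]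
    {T : (Fin 3 → ℝ) →L[ℝ] E} (hT : Function.Injective T) :
    ∃ (l : EuclideanSpace ℝ (Fin 3) ≃L[ℝ] (Fin 3 → ℝ)) (L : EuclideanSpace ℝ (Fin 3) →ₗᵢ[ℝ] E),
      ∀ z, T (l z) = L z := by
  have hfin : Module.finrank ℝ (T : (Fin 3 → ℝ) →ₗ[ℝ] E).range = 3 := by
    rw [LinearMap.finrank_range_of_inj hT]; simp
  let b := (stdOrthonormalBasis ℝ (T : (Fin 3 → ℝ) →ₗ[ℝ] E).range).reindex (finCongr hfin)
  let T' := LinearEquiv.ofInjective (T : (Fin 3 → ℝ) →ₗ[ℝ] E) hT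
  refine ⟨(b.repr.symm.toLinearEquiv.trans T'.symm).toContinuousLinearEquiv,
    (Submodule.subtypeₗᵢ _).comp b.repr.symm.toLinearIsometry, fun z => ?_⟩
  change T (T'.symm (b.repr.symm z)) = ((b.repr.symm z : _) : E)
  exact congrArg Subtype.val (T'.apply_symm_apply (b.repr.symm z))

/-- The density of the Haar measure of `SO(3)` in linear Cayley coordinates. -/
lemma exists_haar_density (l : EuclideanSpace ℝ (Fin 3) ≃L[ℝ] (Fin 3 → ℝ)) :
    ∃ C : ℝ, 0 < C ∧ ∀ f : SO3 → ℝ≥0∞, Measurable f →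
      ∫⁻ g, f g ∂(Measure.haarMeasure (⊤ : TopologicalSpace.PositiveCompacts SO3)) =
        ∫⁻ z, ENNReal.ofReal (C * (quatSq 1 (l z) ^ 2)⁻¹) * f (cayley (l z)) := by
  obtain ⟨C, hC, hH⟩ := haarMeasure_eq_map_cayley
  have : (Measure.map l (volume : Measure (EuclideanSpace ℝ (Fin 3)))).IsAddHaarMeasure :=
    l.isAddHaarMeasure_map volume
  set β := (volume : Measure (Fin 3 → ℝ)).addHaarScalarFactor
    (Measure.map l (volume : Measure (EuclideanSpace ℝ (Fin 3)))) with hβ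
  have hβpos : 0 < β := Measure.addHaarScalarFactor_pos_of_isAddHaarMeasure _ _
  have hvol : (volume : Measure (Fin 3 → ℝ)) =
      β • Measure.map l (volume : Measure (EuclideanSpace ℝ (Fin 3))) :=
    Measure.isAddLeftInvariant_eq_smul _ _
  have hq : Measurable (quatSq 1) := contDiff_quatSq_one.continuous.measurable
  refine ⟨C * β, by positivity, fun f hf => ?_⟩
  have hcay : Measurable cayley := continuous_cayley.measurable
  have hlm : Measurable l := l.continuous.measurable
  rw [hH, lintegral_map hf hcay, lintegral_withDensity_eq_lintegral_mul _ (by fun_prop)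
    (g := fun x => f (cayley x)) (hf.comp hcay), hvol, lintegral_smul_measure,
    lintegral_map (by fun_prop) hlm]
  rw [ENNReal.smul_def, smul_eq_mul, ← lintegral_const_mul _ (by fun_prop)]
  refine lintegral_congr fun z => ?_
  simp only [Pi.mul_apply]
  rw [mul_right_comm C, mul_comm _ (β : ℝ), ENNReal.ofReal_mul (p := (β : ℝ)) (by positivity), ENNReal.ofReal_coe_nnreal,
    mul_assoc]

section Weight

variable {K : Subgroup SO3}

open Classical in
/-- A weight whose sum over the orbits of `K` is the order of `K`. -/
noncomputable def orbitWeight (K : Subgroup SO3) (N : Set SO3) (W : SO3) : ℝ :=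
  if W ∈ N then (Nat.card K : ℝ) else if ∀ k ∈ K, W * k ∉ N then 1 else 0

/-- Hausdorff separation of `1` from each of the finitely many other elements of `K`. It makes every
orbit `W K` meet `N` at most once. -/
lemma exists_separating_nhds [Finite K] {s : Set SO3} (hs : s ∈ 𝓝 (1 : SO3)) :
    ∃ N : Set SO3, IsOpen N ∧ (1 : SO3) ∈ N ∧ N ⊆ s ∧ ∀ k ∈ K, k ≠ 1 → ∀ W ∈ N, W * k ∉ N := by
  have h1 : ∀ k : K, ∃ M : Set SO3, IsOpen M ∧ (1 : SO3) ∈ M ∧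
      ((k : SO3) ≠ 1 → ∀ W ∈ M, W * k ∉ M) := by
    intro k
    by_cases hk : (k : SO3) = 1
    · exact ⟨univ, isOpen_univ, mem_univ _, fun h => absurd hk h⟩
    obtain ⟨A, B, hA, hB, h1A, hkB, hAB⟩ := t2_separation (Ne.symm hk)
    refine ⟨A ∩ (fun W => W * k) ⁻¹' B, hA.inter (hB.preimage (continuous_mul_const _)),
      ⟨h1A, by simpa using hkB⟩, fun _ W hW hWk => ?_⟩
    exact Set.disjoint_left.1 hAB hWk.1 hW.2
  choose M hM h1M hMk using h1
  obtain ⟨O, hOs, hO, h1O⟩ := mem_nhds_iff.1 hs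
  refine ⟨O ∩ ⋂ k, M k, hO.inter (isOpen_iInter_of_finite hM), ⟨h1O, mem_iInter.2 h1M⟩,
    inter_subset_left.trans hOs, fun k hk hk1 W hW hWk => ?_⟩
  exact hMk ⟨k, hk⟩ hk1 W (mem_iInter.1 hW.2 _) (mem_iInter.1 hWk.2 _)

lemma isClosed_avoiding {N : Set SO3} (hN : IsOpen N) : IsClosed {W : SO3 | ∀ k ∈ K, W * k ∉ N} := by
  have : {W : SO3 | ∀ k ∈ K, W * k ∉ N} = ⋂ k ∈ K, ((fun W => W * k) ⁻¹' N)ᶜ := by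
    ext W; simp
  rw [this]
  exact isClosed_biInter fun k _ => (hN.preimage (continuous_mul_const k)).isClosed_compl

lemma measurable_orbitWeight {N : Set SO3} (hN : IsOpen N) : Measurable (orbitWeight K N) := by
  classical
  unfold orbitWeight
  exact Measurable.ite hN.measurableSet measurable_const
    (Measurable.ite (isClosed_avoiding hN).measurableSet measurable_const measurable_const)

lemma orbitWeight_nonneg (N : Set SO3) (W : SO3) : 0 ≤ orbitWeight K N W := by
  unfold orbitWeight; split_ifs <;> positivity

lemma orbitWeight_le [Finite K] (N : Set SO3) (W : SO3) : orbitWeight K N W ≤ Nat.card K := by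
  have : (1 : ℝ) ≤ Nat.card K := by exact_mod_cast Nat.card_pos
  unfold orbitWeight; split_ifs <;> linarith

/-- An orbit of `K` either avoids `N`, and each of its points has weight one, or meets `N` in one
point, which carries the whole weight `Nat.card K`. Right invariance of Haar measure lets the mass
be moved along the orbits when the integrand is `K`-invariant. -/
lemma lintegral_mul_orbitWeight [Finite K] {N : Set SO3} (hN : IsOpen N)
    (hNK : ∀ k ∈ K, k ≠ 1 → ∀ W ∈ N, W * k ∉ N) {f : SO3 → ℝ≥0∞} (hf : Measurable f)
    (hfK : ∀ W, ∀ k ∈ K, f (W * k) = f W) :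
    ∫⁻ W, f W ∂(Measure.haarMeasure (⊤ : TopologicalSpace.PositiveCompacts SO3)) =
    ∫⁻ W, ENNReal.ofReal (orbitWeight K N W) * f W
      ∂(Measure.haarMeasure (⊤ : TopologicalSpace.PositiveCompacts SO3)) := by
  classical
  have := Fintype.ofFinite K
  set μ := Measure.haarMeasure (⊤ : TopologicalSpace.PositiveCompacts SO3) with hμ
  set R : Set SO3 := {W : SO3 | ∀ k ∈ K, W * k ∉ N} with hR
  have hRm : MeasurableSet R := (isClosed_avoiding hN).measurableSet
  have e1 : ∀ W, f W = R.indicator f W + ∑ k : K, N.indicator f (W * k) := by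
    intro W
    by_cases hW : W ∈ R
    · rw [Set.indicator_of_mem hW, Finset.sum_eq_zero, add_zero]
      intro k _
      exact Set.indicator_of_notMem (hW k k.2) _
    · rw [Set.indicator_of_notMem hW, zero_add]
      obtain ⟨k, hk, hWk⟩ : ∃ k ∈ K, W * k ∈ N := by simpa [hR] using hW
      rw [Finset.sum_eq_single ⟨k, hk⟩, Set.indicator_of_mem hWk, hfK W k hk]
      · intro k' _ hk'
        refine Set.indicator_of_notMem (fun hmem => ?_) _
        refine hNK (k⁻¹ * k') (K.mul_mem (K.inv_mem hk) k'.2) ?_ _ hWk ?_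
        · intro h
          exact hk' (Subtype.ext (inv_mul_eq_one.1 h).symm)
        · rwa [mul_assoc, mul_inv_cancel_left]
      · simp
  have e2 : ∀ W, ENNReal.ofReal (orbitWeight K N W) * f W =
      R.indicator f W + (Nat.card K : ℝ≥0∞) * N.indicator f W := by
    intro W
    have hdisj : W ∈ N → W ∉ R := fun h hr => hr 1 K.one_mem (by simpa using h)
    unfold orbitWeight
    by_cases hWN : W ∈ N
    · rw [if_pos hWN, Set.indicator_of_notMem (hdisj hWN), Set.indicator_of_mem hWN, zero_add,
        ENNReal.ofReal_natCast]
    · rw [if_neg hWN, Set.indicator_of_notMem hWN, mul_zero, add_zero]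
      by_cases hWR : W ∈ R
      · rw [if_pos (show ∀ k ∈ K, W * k ∉ N from hWR), Set.indicator_of_mem hWR]; simp
      · rw [if_neg (show ¬ ∀ k ∈ K, W * k ∉ N from hWR), Set.indicator_of_notMem hWR]; simp
  have hNm : Measurable (N.indicator f) := hf.indicator hN.measurableSet
  rw [lintegral_congr e1, lintegral_congr e2, lintegral_add_left (hf.indicator hRm),
    lintegral_add_left (hf.indicator hRm), lintegral_finsetSum (f := fun (k : K) W => N.indicator f (W * k)) _
      (fun k _ => hNm.comp (measurable_mul_const (k : SO3))), lintegral_const_mul _ hNm]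
  congr 1
  simp_rw [lintegral_mul_right_eq_self (μ := μ) (N.indicator f)]
  rw [Finset.sum_const, Finset.card_univ, nsmul_eq_mul, Nat.card_eq_fintype_card]

end Weight

/-- An equivariant embedding of `SO(3)/K`, `K` finite, has a chart at the class of the identity. -/
theorem IsEquivariantEmbedding.nonempty_rotChart {E : Type*} [NormedAddCommGroup E]
    [InnerProductSpace ℝ E] {K : Subgroup SO3} [Finite K] {act : SO3 →* (E ≃ₗᵢ[ℝ] E)}
    {t : SO3 ⧸ K → E} (ht : IsEquivariantEmbedding K act t) : Nonempty (RotChart K t) := by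
  obtain ⟨T, hT⟩ : ∃ T, HasFDerivAt (fun x => t (rotClass K (cayley x))) T 0 :=
    ht.differentiableAt_cayley
  obtain ⟨l, L, hlL⟩ := exists_isometric_coordinates (ht.injective_of_hasFDerivAt hT)
  obtain ⟨C, hC, hH⟩ := exists_haar_density l
  set c : EuclideanSpace ℝ (Fin 3) → SO3 := fun z => cayley (l z) with hc
  have hcc : Continuous c := continuous_cayley.comp l.continuous
  have hcinj : Function.Injective c := cayley_injective.comp l.injective
  have hc0 : c 0 = 1 := by simp [hc, cayley_zero]
  have hnhds : 𝓝 1 ≤ map c (𝓝 0) := by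
    have h1 : map l (𝓝 0) = 𝓝 0 := by
      have := l.toHomeomorph.map_nhds_eq 0
      rwa [show l.toHomeomorph 0 = 0 from map_zero l] at this
    have h2 : map c (𝓝 0) = map cayley (map l (𝓝 0)) := Filter.map_map.symm
    rw [h2, h1]
    exact nhds_one_le_map_cayley
  have hderiv : HasFDerivAt (fun z => t (rotClass K (c z))) L.toContinuousLinearMap 0 := by
    have hT' : HasFDerivAt (fun x => t (rotClass K (cayley x))) T (l 0) := by rwa [map_zero]
    have h := hT'.comp (0 : EuclideanSpace ℝ (Fin 3)) l.toContinuousLinearMap.hasFDerivAt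
    have hTL : T.comp l.toContinuousLinearMap = L.toContinuousLinearMap := by
      ext1 z; exact hlL z
    rw [hTL] at h
    exact h
  obtain ⟨r, hr, hlow⟩ : ∃ r > 0, ∀ z, ‖z‖ < r →
      1 / 2 * ‖z‖ ≤ ‖t (rotClass K (c z)) - t (rotClass K 1)‖ := by
    obtain ⟨r, hr, h⟩ := Metric.eventually_nhds_iff.1 (eventually_half_norm_le hderiv)
    rw [hc0] at h
    exact ⟨r, hr, fun z hz => h (by simpa using hz)⟩
  -- `N` lies in the image of the ball on which the first-order lower bound for `t` holds, and its
  -- translates by `K` are disjoint from it.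
  obtain ⟨N, hN, h1N, hNr, hNK⟩ := exists_separating_nhds (K := K)
    (hnhds (Filter.image_mem_map (Metric.ball_mem_nhds 0 hr)))
  have hNball : ∀ z, c z ∈ N → ‖z‖ < r := fun z hz => by
    obtain ⟨y, hy, hyz⟩ := hNr hz
    rw [← hcinj hyz]; simpa using hy
  set w : EuclideanSpace ℝ (Fin 3) → ℝ := fun z => C * (quatSq 1 (l z) ^ 2)⁻¹ with hw
  have hqc : Continuous fun z => quatSq 1 (l z) := contDiff_quatSq_one.continuous.comp l.continuous
  have hwc : Continuous w :=
    continuous_const.mul ((hqc.pow 2).inv₀ fun z => (pow_pos (quatSq_one_pos _) 2).ne')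
  have hwpos : ∀ z, 0 < w z := fun z => by have := quatSq_one_pos (l z); positivity
  have hcardpos : (0 : ℝ) < Nat.card K := by exact_mod_cast Nat.card_pos
  have hJm : Measurable fun z => orbitWeight K N (c z) * w z :=
    ((measurable_orbitWeight hN).comp hcc.measurable).mul hwc.measurable
  refine ⟨⟨c, L, fun z => orbitWeight K N (c z) * w z, hcc, hc0,
    Function.invFun c, ?_, ?_, ?_, hderiv, hJm, ?_, ?_, ?_,
    ?_, ?_, ?_⟩⟩
  · intro s hs
    have h1 : c '' s ∈ 𝓝 1 := hnhds (Filter.image_mem_map hs)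
    refine Filter.mem_map.2 (mem_of_superset h1 ?_)
    rintro _ ⟨y, hy, rfl⟩
    rwa [mem_preimage, Function.leftInverse_invFun hcinj y]
  · filter_upwards [hnhds (Filter.image_mem_map univ_mem)] with g hg
    obtain ⟨y, -, rfl⟩ := hg
    exact Function.invFun_eq ⟨y, rfl⟩
  · intro g
    refine ⟨l.symm.toLinearMap ∘ₗ (Matrix.mulVecLin (g.1).transpose) ∘ₗ l.toLinearMap, ?_, ?_⟩
    · intro x y hxy
      have h1 : Matrix.mulVec (g.1).transpose (l x) = Matrix.mulVec (g.1).transpose (l y) :=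
        l.symm.injective hxy
      have h2 := congrArg (fun v => Matrix.mulVec g.1 v) h1
      simp only [Matrix.mulVec_mulVec, SO3.coe_mul_transpose, Matrix.one_mulVec] at h2
      exact l.injective h2
    · intro z
      change g⁻¹ * cayley (l z) * g = cayley (l (l.symm (Matrix.mulVec (g.1).transpose (l z))))
      rw [inv_mul_cayley_mul, l.apply_symm_apply]
  · exact fun z => mul_nonneg (orbitWeight_nonneg N _) (hwpos z).le
  · refine ⟨Nat.card K * (C * (1 + ‖T‖ ^ 2) ^ 2), by positivity, fun z => ?_⟩
    have hz : ‖z‖ ≤ ‖T‖ * ‖l z‖ := by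
      have h1 := T.le_opNorm (l z)
      rw [hlL, L.norm_map] at h1
      exact h1
    have hl : ‖l z‖ ^ 2 ≤ quatSq 0 (l z) := by
      rw [← Real.sqrt_le_sqrt_iff (quatSq_nonneg _ _), Real.sqrt_sq (norm_nonneg _)]
      refine (pi_norm_le_iff_of_nonneg (Real.sqrt_nonneg _)).2 fun i => ?_
      refine Real.abs_le_sqrt ?_
      simp only [quatSq]
      fin_cases i <;> simp <;> nlinarith [sq_nonneg (l z 0), sq_nonneg (l z 1), sq_nonneg (l z 2)]
    have hq1 : quatSq 1 (l z) = 1 + quatSq 0 (l z) := by simp only [quatSq]; ring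
    have hq0 := quatSq_nonneg 0 (l z)
    have h2 : 1 + ‖z‖ ^ 2 ≤ (1 + ‖T‖ ^ 2) * quatSq 1 (l z) := by
      have : ‖z‖ ^ 2 ≤ ‖T‖ ^ 2 * ‖l z‖ ^ 2 := by
        rw [← mul_pow]; exact pow_le_pow_left₀ (norm_nonneg _) hz 2
      rw [hq1]
      nlinarith [sq_nonneg ‖T‖, mul_le_mul_of_nonneg_left hl (sq_nonneg ‖T‖)]
    have h3 : (quatSq 1 (l z) ^ 2)⁻¹ ≤ (1 + ‖T‖ ^ 2) ^ 2 * ((1 + ‖z‖ ^ 2) ^ 2)⁻¹ := by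
      have hqp := quatSq_one_pos (l z)
      rw [← div_eq_mul_inv, inv_le_iff_one_le_mul₀ (by positivity), div_mul_eq_mul_div,
        le_div_iff₀ (by positivity), one_mul, ← mul_pow]
      exact pow_le_pow_left₀ (by positivity) h2 2
    calc orbitWeight K N (c z) * w z ≤ Nat.card K * w z :=
          mul_le_mul_of_nonneg_right (orbitWeight_le N _) (hwpos z).le
      _ ≤ Nat.card K * (C * ((1 + ‖T‖ ^ 2) ^ 2 * ((1 + ‖z‖ ^ 2) ^ 2)⁻¹)) := by
          exact mul_le_mul_of_nonneg_left (mul_le_mul_of_nonneg_left h3 hC.le) hcardpos.le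
      _ = _ := by ring
  · have h1 : (fun z => orbitWeight K N (c z) * w z) =ᶠ[𝓝 0] fun z => (Nat.card K : ℝ) * w z := by
      have : ∀ᶠ z in 𝓝 0, c z ∈ N :=
        hcc.continuousAt.preimage_mem_nhds (by rw [hc0]; exact hN.mem_nhds h1N)
      filter_upwards [this] with z hz
      rw [orbitWeight, if_pos hz]
    exact ((continuous_const.mul hwc).continuousAt).congr h1.symm
  · rw [orbitWeight, if_pos (by rwa [hc0])]
    exact mul_pos hcardpos (hwpos 0)
  · refine Measure.ext_of_lintegral _ fun f hf => ?_
    have hfm : Measurable fun W => f (rotClass K W) := hf.comp (measurable_rotClass K)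
    rw [uniformRot, lintegral_map hf (measurable_rotClass K),
      lintegral_map hf (show Measurable fun z => rotClass K (c z) from
        (measurable_rotClass K).comp hcc.measurable),
      lintegral_withDensity_eq_lintegral_mul _ (by fun_prop)
        (g := fun z => f (rotClass K (c z))) (hfm.comp hcc.measurable),
      lintegral_mul_orbitWeight hN hNK hfm, hH]
    · refine lintegral_congr fun z => ?_
      simp only [Pi.mul_apply]
      rw [ENNReal.ofReal_mul (orbitWeight_nonneg N _), ← mul_assoc, mul_comm (ENNReal.ofReal (w z))]
    · exact ((measurable_orbitWeight hN).ennreal_ofReal).mul hfm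
    · intro W k hk
      congr 1
      rw [QuotientGroup.eq]
      simpa using hk
  -- The rotations whose orbit avoids `N` form a compact set, disjoint from `K` because `1 ∈ N`; on
  -- it the distance of `t` to `t [1]` has a positive minimum.
  · obtain ⟨η, hη, hfar⟩ : ∃ η > 0, ∀ W : SO3, (∀ k ∈ K, W * k ∉ N) →
        η ≤ ‖t (rotClass K W) - t (rotClass K 1)‖ := by
      rcases eq_empty_or_nonempty {W : SO3 | ∀ k ∈ K, W * k ∉ N} with hemp | hne
      · refine ⟨1, one_pos, fun W hW => ?_⟩
        have : W ∈ (∅ : Set SO3) := hemp ▸ hW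
        exact absurd this (notMem_empty W)
      · obtain ⟨W₀, hW₀, hmin⟩ := (isClosed_avoiding hN).isCompact.exists_isMinOn hne
          (f := fun W => ‖t (rotClass K W) - t (rotClass K 1)‖)
          ((ht.continuous_comp.sub continuous_const).norm.continuousOn)
        refine ⟨_, norm_pos_iff.2 (sub_ne_zero.2 fun h => ?_), fun W hW => hmin hW⟩
        have hWK := (ht.apply_eq_iff W₀).1 h
        exact hW₀ _ (K.inv_mem hWK) (by rwa [mul_inv_cancel])
    refine ⟨min (1 / 4) (η ^ 2), by positivity, fun z hz => ?_⟩
    have hmin0 : 0 ≤ min (‖z‖ ^ 2) 1 := by positivity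
    have hz' := left_ne_zero_of_mul hz
    by_cases hzN : c z ∈ N
    · calc min (1 / 4) (η ^ 2) * min (‖z‖ ^ 2) 1 ≤ 1 / 4 * ‖z‖ ^ 2 :=
            mul_le_mul (min_le_left _ _) (min_le_left _ _) hmin0 (by norm_num)
        _ = (1 / 2 * ‖z‖) ^ 2 := by ring
        _ ≤ _ := pow_le_pow_left₀ (by positivity) (hlow z (hNball z hzN)) 2
    · have hzR : ∀ k ∈ K, c z * k ∉ N := by
        by_contra h
        exact hz' (by rw [orbitWeight, if_neg hzN, if_neg h])
      calc min (1 / 4) (η ^ 2) * min (‖z‖ ^ 2) 1 ≤ η ^ 2 * 1 :=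
            mul_le_mul (min_le_right _ _) (min_le_right _ _) hmin0 (by positivity)
        _ ≤ _ := by rw [mul_one]; exact pow_le_pow_left₀ hη.le (hfar _ hzR) 2

/-! ### Gaussian vectors and chi-squared laws. -/

/-- A finite product of measures with integrable real densities has the product density. -/
lemma pi_withDensity_ofReal {ι X : Type*} [Fintype ι] [MeasurableSpace X] (μ : Measure X)
    [SigmaFinite μ] {f : X → ℝ} (hf0 : ∀ x, 0 ≤ f x) (hf : Integrable f μ) :
    (Measure.pi fun _ : ι => μ.withDensity fun x => ENNReal.ofReal (f x)) =
      (Measure.pi fun _ : ι => μ).withDensity fun x => ENNReal.ofReal (∏ i, f (x i)) := by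
  classical
  have : IsFiniteMeasure (μ.withDensity fun x => ENNReal.ofReal (f x)) :=
    isFiniteMeasure_withDensity_ofReal hf.2
  refine Measure.pi_eq fun s hs => ?_
  rw [withDensity_apply _ (MeasurableSet.univ_pi hs), ← lintegral_indicator (MeasurableSet.univ_pi hs)]
  have h1 : ∀ x : ι → X, (univ.pi s).indicator (fun x => ENNReal.ofReal (∏ i, f (x i))) x =
      ENNReal.ofReal (∏ i, (s i).indicator f (x i)) := by
    intro x
    by_cases hx : x ∈ univ.pi s
    · rw [Set.indicator_of_mem hx]
      congr 1
      exact Finset.prod_congr rfl fun i _ => (Set.indicator_of_mem (hx i (mem_univ i)) f).symm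
    · rw [Set.indicator_of_notMem hx]
      obtain ⟨i, hi⟩ : ∃ i, x i ∉ s i := by simpa using hx
      rw [Finset.prod_eq_zero (Finset.mem_univ i) (Set.indicator_of_notMem hi f), ENNReal.ofReal_zero]
  have h0 : ∀ i x, 0 ≤ (s i).indicator f x := fun i x => Set.indicator_nonneg (fun x _ => hf0 x) x
  have hint : ∀ i, Integrable ((s i).indicator f) μ := fun i => hf.indicator (hs i)
  rw [lintegral_congr h1, ← ofReal_integral_eq_lintegral_ofReal
    (Integrable.fintype_prod_dep fun i => hint i)
    (ae_of_all _ fun x => Finset.prod_nonneg fun i _ => h0 i _),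
    integral_fintype_prod_eq_prod, ENNReal.ofReal_prod_of_nonneg
      (fun i _ => integral_nonneg (h0 i))]
  refine Finset.prod_congr rfl fun i _ => ?_
  rw [ofReal_integral_eq_lintegral_ofReal (hint i) (ae_of_all _ (h0 i)),
    withDensity_apply _ (hs i), ← lintegral_indicator (hs i)]
  refine lintegral_congr fun x => ?_
  by_cases hx : x ∈ s i <;> simp [hx]

/-- The density of the standard Gaussian distribution of `ℝ³`. -/
noncomputable def gaussDens (z : EuclideanSpace ℝ (Fin 3)) : ℝ :=
  (Real.sqrt (2 * Real.pi))⁻¹ ^ 3 * Real.exp (-(‖z‖ ^ 2 / 2))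

lemma stdGaussian_eq_withDensity : stdGaussian (EuclideanSpace ℝ (Fin 3)) =
    volume.withDensity fun z => ENNReal.ofReal (gaussDens z) := by
  have h1 : gaussianReal 0 1 = volume.withDensity fun x => ENNReal.ofReal (gaussianPDFReal 0 1 x) :=
    gaussianReal_of_var_ne_zero _ one_ne_zero
  have hvp := PiLp.volume_preserving_toLp (Fin 3)
  rw [← map_pi_eq_stdGaussian, h1, pi_withDensity_ofReal _
    (gaussianPDFReal_nonneg 0 1) (integrable_gaussianPDFReal 0 1)]
  have hgd : Measurable fun z => ENNReal.ofReal (gaussDens z) := by unfold gaussDens; fun_prop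
  refine Measure.ext_of_lintegral _ fun f hf => ?_
  have hp : Measurable fun x : Fin 3 → ℝ => ∏ i, gaussianPDFReal 0 1 (x i) :=
    Finset.measurable_prod _ fun i _ => (measurable_gaussianPDFReal 0 1).comp (measurable_pi_apply i)
  rw [lintegral_map hf hvp.measurable, lintegral_withDensity_eq_lintegral_mul _ hp.ennreal_ofReal
    (g := fun x => f (WithLp.toLp 2 x)) (hf.comp hvp.measurable),
    lintegral_withDensity_eq_lintegral_mul _ hgd hf, ← hvp.map_eq, lintegral_map (hgd.mul hf)
    hvp.measurable]
  refine lintegral_congr fun x => ?_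
  simp only [Pi.mul_apply]
  congr 2
  rw [gaussDens, EuclideanSpace.real_norm_sq_eq, Fin.prod_univ_three, Fin.sum_univ_three]
  simp only [gaussianPDFReal, sub_zero, NNReal.coe_one, mul_one]
  rw [show -((x 0 ^ 2 + x 1 ^ 2 + x 2 ^ 2) / 2) = -x 0 ^ 2 / 2 + -x 1 ^ 2 / 2 + -x 2 ^ 2 / 2 by ring,
    Real.exp_add, Real.exp_add]
  ring

section StdGaussian

variable {F : Type*} [NormedAddCommGroup F] [InnerProductSpace ℝ F] [FiniteDimensional ℝ F]
  [MeasurableSpace F] [BorelSpace F]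

lemma stdGaussian_map_norm_sq : (stdGaussian F).map (fun x => ‖x‖ ^ 2) =
    chiSq (Module.finrank ℝ F) := by
  rw [stdGaussian, Measure.map_map (by fun_prop) (by fun_prop), chiSq]
  congr 1
  ext x
  simp only [Function.comp_apply]
  have h := (stdOrthonormalBasis ℝ F).sum_repr_symm (WithLp.toLp 2 x)
  simp only at h
  rw [h, LinearIsometryEquiv.norm_map, EuclideanSpace.real_norm_sq_eq]

lemma stdGaussian_withLp_prod {G : Type*} [NormedAddCommGroup G] [InnerProductSpace ℝ G]
    [FiniteDimensional ℝ G] [MeasurableSpace G] [BorelSpace G] :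
    stdGaussian (WithLp 2 (F × G)) =
      ((stdGaussian F).prod (stdGaussian G)).map (WithLp.toLp 2) := by
  have hm : Measurable (WithLp.toLp 2 : F × G → WithLp 2 (F × G)) := by fun_prop
  have : IsProbabilityMeasure (((stdGaussian F).prod (stdGaussian G)).map
    (WithLp.toLp 2 : F × G → WithLp 2 (F × G))) := Measure.isProbabilityMeasure_map hm.aemeasurable
  refine Measure.ext_of_charFun (funext fun t => ?_)
  rw [charFun_prod, charFun_stdGaussian, charFun_stdGaussian, charFun_stdGaussian, ← Complex.exp_add,
    ← Complex.ofReal_pow, WithLp.prod_norm_sq_eq_of_L2]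
  congr 1
  push_cast
  ring_nf
  rfl

lemma stdGaussian_piLp {ι : Type*} [Fintype ι] :
    stdGaussian (PiLp 2 fun _ : ι => F) =
      (Measure.pi fun _ : ι => stdGaussian F).map (WithLp.toLp 2) := by
  have hm : Measurable (WithLp.toLp 2 : (ι → F) → PiLp 2 fun _ : ι => F) := by fun_prop
  have : IsProbabilityMeasure ((Measure.pi fun _ : ι => stdGaussian F).map
    (WithLp.toLp 2 : (ι → F) → PiLp 2 fun _ : ι => F)) :=
    Measure.isProbabilityMeasure_map hm.aemeasurable
  refine Measure.ext_of_charFun (funext fun t => ?_)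
  rw [charFun_pi, charFun_stdGaussian, ← Complex.ofReal_pow, PiLp.norm_sq_eq_of_L2]
  simp_rw [charFun_stdGaussian]
  rw [← Complex.exp_sum]
  congr 1
  push_cast
  rw [← Finset.sum_neg_distrib, Finset.sum_div]

/-- **Cochran's theorem** for a subspace and its orthogonal complement. -/
lemma stdGaussian_map_norm_sq_projections (L : Submodule ℝ F) :
    (stdGaussian F).map (fun x => (‖Lᗮ.orthogonalProjectionOnto x‖ ^ 2,
      ‖L.orthogonalProjectionOnto x‖ ^ 2)) =
      (chiSq (Module.finrank ℝ Lᗮ)).prod (chiSq (Module.finrank ℝ L)) := by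
  have h1 : (fun x => (‖Lᗮ.orthogonalProjectionOnto x‖ ^ 2, ‖L.orthogonalProjectionOnto x‖ ^ 2)) =
      ((fun p : L × Lᗮ => (‖p.2‖ ^ 2, ‖p.1‖ ^ 2)) ∘ (WithLp.ofLp : WithLp 2 (L × Lᗮ) → L × Lᗮ)) ∘
        L.orthogonalDecomposition := by
    ext x <;> simp [Submodule.orthogonalDecomposition_apply]
  have h2 : (fun p : L × Lᗮ => (‖p.2‖ ^ 2, ‖p.1‖ ^ 2)) =
      Prod.map (fun y : Lᗮ => ‖y‖ ^ 2) (fun x : L => ‖x‖ ^ 2) ∘ Prod.swap := rfl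
  have hm1 : Measurable fun p : L × Lᗮ => (‖p.2‖ ^ 2, ‖p.1‖ ^ 2) := by fun_prop
  have hm2 : Measurable (WithLp.ofLp : WithLp 2 (L × Lᗮ) → L × Lᗮ) := by fun_prop
  rw [h1, ← Measure.map_map (hm1.comp hm2) (by fun_prop), stdGaussian_map, stdGaussian_withLp_prod,
    Measure.map_map (hm1.comp hm2) (by fun_prop)]
  have h3 : ((fun p : L × Lᗮ => (‖p.2‖ ^ 2, ‖p.1‖ ^ 2)) ∘
      (WithLp.ofLp : WithLp 2 (L × Lᗮ) → L × Lᗮ)) ∘ WithLp.toLp 2 =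
      fun p : L × Lᗮ => (‖p.2‖ ^ 2, ‖p.1‖ ^ 2) := rfl
  rw [h3, h2, ← Measure.map_map (by fun_prop) measurable_swap, Measure.prod_swap,
    ← Measure.map_prod_map _ _ (by fun_prop) (by fun_prop), stdGaussian_map_norm_sq,
    stdGaussian_map_norm_sq]

end StdGaussian

lemma chiSq_prod_map_add (a b : ℕ) :
    ((chiSq a).prod (chiSq b)).map (fun p => p.1 + p.2) = chiSq (a + b) := by
  have h (k : ℕ) : chiSq k = (stdGaussian (EuclideanSpace ℝ (Fin k))).map (fun x => ‖x‖ ^ 2) := by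
    rw [stdGaussian_map_norm_sq]; simp
  rw [h a, h b, Measure.map_prod_map _ _ (by fun_prop) (by fun_prop),
    Measure.map_map (by fun_prop) (by fun_prop)]
  have h1 : ((fun p : ℝ × ℝ => p.1 + p.2) ∘ Prod.map (fun x : EuclideanSpace ℝ (Fin a) => ‖x‖ ^ 2)
      (fun x : EuclideanSpace ℝ (Fin b) => ‖x‖ ^ 2)) =
      (fun x => ‖x‖ ^ 2) ∘ (WithLp.toLp 2 : EuclideanSpace ℝ (Fin a) × EuclideanSpace ℝ (Fin b) →
        WithLp 2 (EuclideanSpace ℝ (Fin a) × EuclideanSpace ℝ (Fin b))) := by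
    ext x; simp [WithLp.prod_norm_sq_eq_of_L2]
  rw [h1, ← Measure.map_map (by fun_prop) (by fun_prop), ← stdGaussian_withLp_prod,
    stdGaussian_map_norm_sq]
  congr 1
  rw [(WithLp.linearEquiv 2 ℝ _).finrank_eq]; simp

/-- Spheres are Lebesgue null. The absence of atoms makes the limiting distribution function
continuous, as the coverage statements require. -/
lemma chiSq_three_singleton (c : ℝ) : chiSq 3 {c} = 0 := by
  have h : chiSq 3 = (stdGaussian (EuclideanSpace ℝ (Fin 3))).map (fun x => ‖x‖ ^ 2) := by
    rw [stdGaussian_map_norm_sq]; simp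
  rw [h, Measure.map_apply (by fun_prop) (measurableSet_singleton c), stdGaussian_eq_withDensity]
  refine withDensity_absolutelyContinuous _ _ ?_
  refine measure_mono_null (t := Metric.sphere 0 (Real.sqrt c)) ?_ (Measure.addHaar_sphere _ _ _)
  intro x hx
  have : ‖x‖ ^ 2 = c := hx
  simp [← this, Real.sqrt_sq (norm_nonneg x)]

instance chiSq_three_nullSingletonClass : NullSingletonClass (chiSq 3) := ⟨chiSq_three_singleton⟩

lemma chiSq_Iio_zero (k : ℕ) : chiSq k (Iio 0) = 0 := by
  have hm : Measurable fun x : Fin k → ℝ => ∑ i, x i ^ 2 := by fun_prop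
  rw [chiSq, Measure.map_apply hm measurableSet_Iio]
  have : (fun x : Fin k → ℝ => ∑ i, x i ^ 2) ⁻¹' Iio 0 = ∅ := by
    ext x
    simpa using Finset.sum_nonneg fun i _ => sq_nonneg (x i)
  rw [this, measure_empty]

/-- The weak law of large numbers for the chi-squared distributions. -/
lemma exists_chiSq_deviation_le : ∃ C : ℝ, 0 ≤ C ∧ ∀ (k : ℕ) (δ : ℝ), 0 < δ →
    (chiSq k).real {x | δ ≤ |x - k|} ≤ C * k / δ ^ 2 := by
  have hL : MemLp (fun x : ℝ => x ^ 2) 2 (gaussianReal 0 1) := by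
    have := memLp_id_gaussianReal' (μ := 0) (v := 1) 4 (by simp)
    have h2 := (this.norm_rpow_div 2)
    have h3 : (4 : ℝ≥0∞) / 2 = 2 := by
      exact ((ENNReal.eq_div_iff (by simp) (by simp)).2 (by norm_num)).symm
    rw [h3] at h2
    refine h2.congr_norm (by fun_prop) (ae_of_all _ fun x => ?_)
    simp
  have hmean : ∫ x, x ^ 2 ∂(gaussianReal 0 1) = 1 := by
    have := variance_id_gaussianReal (μ := 0) (v := 1)
    rw [variance_of_integral_eq_zero (by fun_prop) (by simp)] at this
    simpa using this
  -- Chebyshev's inequality: the law has mean `k` and variance `k` times that of one squared normal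
  -- variable.
  refine ⟨Var[fun x : ℝ => x ^ 2; gaussianReal 0 1], variance_nonneg _ _, fun k δ hδ => ?_⟩
  set P : Measure (Fin k → ℝ) := Measure.pi fun _ => gaussianReal 0 1 with hP
  set X : (Fin k → ℝ) → ℝ := fun x => ∑ i, x i ^ 2 with hX
  have hXm : Measurable X := by fun_prop
  have hLi : ∀ i, MemLp (fun x : Fin k → ℝ => x i ^ 2) 2 P := fun i =>
    hL.comp_measurePreserving (measurePreserving_eval (fun _ : Fin k => gaussianReal 0 1) i)
  have hLX : MemLp X 2 P := memLp_finsetSum _ fun i _ => hLi i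
  have hvar : Var[X; P] = k * Var[fun x : ℝ => x ^ 2; gaussianReal 0 1] := by
    have := variance_sum_pi (μ := fun _ : Fin k => gaussianReal 0 1)
      (X := fun _ (x : ℝ) => x ^ 2) (fun _ => hL)
    rw [Finset.sum_const, Finset.card_univ, Fintype.card_fin, nsmul_eq_mul] at this
    rw [← this]
    congr 1
    ext x; simp [hX]
  have hEX : ∫ x, X x ∂P = (k : ℝ) := by
    rw [hX, integral_finsetSum _ fun i _ => (hLi i).integrable one_le_two]
    have : ∀ i, ∫ x : Fin k → ℝ, x i ^ 2 ∂P = 1 := fun i => by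
      rw [← hmean, ← (measurePreserving_eval (fun _ : Fin k => gaussianReal 0 1) i).map_eq,
        integral_map (measurable_pi_apply i).aemeasurable (by fun_prop)]
    simp [this]
  have hch := meas_ge_le_variance_div_sq hLX hδ
  rw [hEX, hvar] at hch
  have hs : MeasurableSet {x : ℝ | δ ≤ |x - k|} := measurableSet_le measurable_const (by fun_prop)
  rw [chiSq, map_measureReal_apply hXm hs, measureReal_def]
  refine ENNReal.toReal_le_of_le_ofReal
    (div_nonneg (mul_nonneg (variance_nonneg _ _) (by positivity)) (by positivity)) ?_
  rw [mul_comm _ (k : ℝ)]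
  exact hch

/-! ### The minimal residual sum of squares. -/

section Residual

variable {E : Type*} [NormedAddCommGroup E] {K : Subgroup SO3} {t : SO3 ⧸ K → E} {n : ℕ}

/-- Half the residual sum of squares of the fit `B`. -/
noncomputable def halfRss (t : SO3 ⧸ K → E) (u v : Fin n → SO3 ⧸ K) (B : SO3) : ℝ :=
  (∑ i, ‖t (v i) - t (B • u i)‖ ^ 2) / 2

/-- The smallest value of `halfRss`. -/
noncomputable def minRss (t : SO3 ⧸ K → E) (u v : Fin n → SO3 ⧸ K) : ℝ :=
  ⨅ B : SO3, halfRss t u v B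

lemma halfRss_nonneg (u v : Fin n → SO3 ⧸ K) (B : SO3) : 0 ≤ halfRss t u v B := by
  unfold halfRss; positivity

lemma minRss_le (u v : Fin n → SO3 ⧸ K) (B : SO3) : minRss t u v ≤ halfRss t u v B :=
  ciInf_le ⟨0, by rintro _ ⟨B, rfl⟩; exact halfRss_nonneg u v B⟩ B

lemma continuous_halfRss (ht : Continuous t) :
    Continuous fun p : ((Fin n → SO3 ⧸ K) × (Fin n → SO3 ⧸ K)) × SO3 =>
      halfRss t p.1.1 p.1.2 p.2 := by
  unfold halfRss
  fun_prop

lemma exists_minRss_eq (ht : Continuous t) (u v : Fin n → SO3 ⧸ K) :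
    ∃ B, minRss t u v = halfRss t u v B := by
  have hc : Continuous (halfRss t u v) :=
    (continuous_halfRss ht).comp (f := fun B => ((u, v), B)) (by fun_prop)
  obtain ⟨B, -, hB⟩ := isCompact_univ.exists_isMinOn ⟨1, mem_univ _⟩ hc.continuousOn
  exact ⟨B, le_antisymm (minRss_le u v B) (le_ciInf fun B' => hB (mem_univ B'))⟩

/-- The infimum may be taken over a countable dense set of rotations. The estimate `Â` may be chosen
non-measurably; the statistics depend on it only through this minimal value. -/
lemma measurable_minRss [Finite K] (ht : Continuous t) :
    Measurable fun p : (Fin n → SO3 ⧸ K) × (Fin n → SO3 ⧸ K) => minRss t p.1 p.2 := by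
  have hc := continuous_halfRss (n := n) ht
  have hfun : (fun p : (Fin n → SO3 ⧸ K) × (Fin n → SO3 ⧸ K) => minRss t p.1 p.2) =
      fun p => ⨅ k : ℕ, halfRss t p.1 p.2 (TopologicalSpace.denseSeq SO3 k) := by
    ext p
    have hcp : Continuous (halfRss t p.1 p.2) := hc.comp (f := fun B => (p, B)) (by fun_prop)
    refine le_antisymm (le_ciInf fun k => minRss_le _ _ _) (le_ciInf fun B => ?_)
    refine (TopologicalSpace.denseRange_denseSeq SO3).induction_on
      (p := fun B => ⨅ k : ℕ, halfRss t p.1 p.2 (TopologicalSpace.denseSeq SO3 k) ≤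
        halfRss t p.1 p.2 B) B
      (isClosed_le continuous_const hcp) fun k => ?_
    exact ciInf_le ⟨0, by rintro _ ⟨B, rfl⟩; exact halfRss_nonneg _ _ _⟩ k
  rw [hfun]
  exact Measurable.iInf fun k =>
    (hc.comp (f := fun p => (p, TopologicalSpace.denseSeq SO3 k)) (by fun_prop)).measurable

end Residual

lemma norm_sq_sub_eq_of_mem {F : Type*} [NormedAddCommGroup F] [InnerProductSpace ℝ F]
    {L : Submodule ℝ F} [L.HasOrthogonalProjection] (w : F) {y : F} (hy : y ∈ L) :
    ‖w - y‖ ^ 2 = ‖Lᗮ.orthogonalProjectionOnto w‖ ^ 2 +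
      ‖(L.orthogonalProjectionOnto w : F) - y‖ ^ 2 := by
  rw [Submodule.norm_sq_eq_add_norm_sq_projection (w - y) L, map_sub, map_sub,
    Submodule.orthogonalProjectionOnto_orthogonal_apply_eq_zero hy, sub_zero, add_comm]
  have h : L.orthogonalProjectionOnto y = ⟨y, hy⟩ :=
    Submodule.orthogonalProjectionOnto_mem_subspace_eq_self (⟨y, hy⟩ : L)
  rw [h]
  rfl

/-! ### Linearization of the regression at scale `ε`. -/

section Linearization

variable {E : Type*} [NormedAddCommGroup E] [InnerProductSpace ℝ E] {K : Subgroup SO3}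
  {act : SO3 →* (E ≃ₗᵢ[ℝ] E)} {t : SO3 ⧸ K → E} {n : ℕ}

namespace RotChart

variable (ch : RotChart K t)

/-- Stated for any filter below `𝓝[>] 0` and a moving argument, so as to apply along the
ultrafilters of `tendsto_minRss`. -/
lemma tendsto_inv_smul_sub {l : Filter ℝ} (hl : l ≤ 𝓝[>] 0) {z : ℝ → EuclideanSpace ℝ (Fin 3)}
    {z₀ : EuclideanSpace ℝ (Fin 3)} (hz : Tendsto z l (𝓝 z₀)) :
    Tendsto (fun ε => ε⁻¹ • (t (rotClass K (ch.toRot (ε • z ε))) - t (rotClass K 1))) l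
      (𝓝 (ch.diff z₀)) := by
  have h0 : ∀ᶠ ε in l, (0 : ℝ) < ε := hl self_mem_nhdsWithin
  have h := (hasFDerivWithinAt_univ.2 ch.hasFDerivAt).lim (c := fun ε : ℝ => ε⁻¹)
    (d := fun ε => ε • z ε) (v := z₀) (l := l) ?_
    (Eventually.of_forall fun _ => mem_univ _) ?_
  · simpa [ch.toRot_zero] using h
  · have h1 : Tendsto (fun ε : ℝ => ε) l (𝓝 0) :=
      tendsto_id.mono_left (hl.trans nhdsWithin_le_nhds)
    simpa using h1.smul hz
  · refine hz.congr' ?_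
    filter_upwards [h0] with ε hε
    rw [smul_smul, inv_mul_cancel₀ hε.ne', one_smul]

/-- The observations with parameters `ε z` around the images of `u` under `A`. -/
noncomputable def sample (A : SO3) (U : Fin n → SO3) (z : Fin n → EuclideanSpace ℝ (Fin 3))
    (ε : ℝ) (i : Fin n) : SO3 ⧸ K :=
  rotClass K (A * U i * ch.toRot (ε • z i))

/-- The linear action on the parameters of the conjugation by the inverse of a rotation. -/
noncomputable def adj (g : SO3) : EuclideanSpace ℝ (Fin 3) →ₗ[ℝ] EuclideanSpace ℝ (Fin 3) :=
  (ch.conj g).choose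

lemma adj_injective (g : SO3) : Function.Injective (ch.adj g) := (ch.conj g).choose_spec.1

lemma inv_mul_toRot_mul (g : SO3) (z : EuclideanSpace ℝ (Fin 3)) :
    g⁻¹ * ch.toRot z * g = ch.toRot (ch.adj g z) := (ch.conj g).choose_spec.2 z

/-- The linearized regression. -/
noncomputable def design (U : Fin n → SO3) :
    EuclideanSpace ℝ (Fin 3) →ₗ[ℝ] PiLp 2 (fun _ : Fin n => EuclideanSpace ℝ (Fin 3)) :=
  (WithLp.linearEquiv 2 ℝ (Fin n → EuclideanSpace ℝ (Fin 3))).symm.toLinearMap ∘ₗ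
    LinearMap.pi fun i => ch.adj (U i)

lemma design_apply (U : Fin n → SO3) (y : EuclideanSpace ℝ (Fin 3)) (i : Fin n) :
    ch.design U y i = ch.adj (U i) y := rfl

lemma design_injective (U : Fin n → SO3) (hn : 0 < n) : Function.Injective (ch.design U) := by
  intro x y hxy
  refine ch.adj_injective (U ⟨0, hn⟩) ?_
  rw [← design_apply, hxy, design_apply]

/-- The isometry `act (A * U i)` can be removed from the `i`-th residual. So `A` disappears and `U
i` enters only by conjugating the error `G` of the fit. -/
lemma halfRss_sample (ht : IsEquivariantEmbedding K act t) (A G : SO3) (U : Fin n → SO3)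
    (z : Fin n → EuclideanSpace ℝ (Fin 3)) (ε : ℝ) :
    halfRss t (fun i => rotClass K (U i)) (ch.sample A U z ε) (A * G) =
      (∑ i, ‖t (rotClass K (ch.toRot (ε • z i))) - t (rotClass K ((U i)⁻¹ * G * U i))‖ ^ 2) / 2 := by
  unfold halfRss sample
  congr 1
  refine Finset.sum_congr rfl fun i _ => ?_
  have h2 : t ((A * G) • rotClass K (U i)) =
      act (A * U i) (t (rotClass K ((U i)⁻¹ * G * U i))) := by
    rw [← ht.apply_mul]
    change t (rotClass K (A * G * U i)) = _
    congr 2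
    group
  rw [ht.apply_mul, h2, ← map_sub, LinearIsometryEquiv.norm_map]

lemma tendsto_sum_sq {l : Filter ℝ} (hl : l ≤ 𝓝[>] 0) (U : Fin n → SO3)
    (z : Fin n → EuclideanSpace ℝ (Fin 3)) {y : ℝ → EuclideanSpace ℝ (Fin 3)}
    {y₀ : EuclideanSpace ℝ (Fin 3)} (hy : Tendsto y l (𝓝 y₀)) :
    Tendsto (fun ε => (ε ^ 2)⁻¹ * ∑ i, ‖t (rotClass K (ch.toRot (ε • z i))) -
        t (rotClass K (ch.toRot (ch.adj (U i) (ε • y ε))))‖ ^ 2) l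
      (𝓝 (‖WithLp.toLp 2 z - ch.design U y₀‖ ^ 2)) := by
  have h0 : ∀ᶠ ε in l, (0 : ℝ) < ε := hl self_mem_nhdsWithin
  have hi : ∀ i, Tendsto (fun ε => ‖ε⁻¹ • (t (rotClass K (ch.toRot (ε • z i))) - t (rotClass K 1)) -
      ε⁻¹ • (t (rotClass K (ch.toRot (ε • (ch.adj (U i) (y ε))))) - t (rotClass K 1))‖ ^ 2) l
      (𝓝 (‖ch.diff (z i) - ch.diff (ch.adj (U i) y₀)‖ ^ 2)) := by
    intro i
    have hc : Continuous (ch.adj (U i)) := LinearMap.continuous_of_finiteDimensional _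
    exact (((ch.tendsto_inv_smul_sub hl tendsto_const_nhds).sub
      (ch.tendsto_inv_smul_sub hl ((hc.tendsto y₀).comp hy))).norm).pow 2
  have hs := tendsto_finsetSum Finset.univ fun i _ => hi i
  have heq : ‖WithLp.toLp 2 z - ch.design U y₀‖ ^ 2 =
      ∑ i, ‖ch.diff (z i) - ch.diff (ch.adj (U i) y₀)‖ ^ 2 := by
    rw [PiLp.norm_sq_eq_of_L2]
    refine Finset.sum_congr rfl fun i _ => ?_
    rw [← map_sub, ch.diff.norm_map]; rfl
  rw [heq]
  refine hs.congr' ?_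
  filter_upwards [h0] with ε hε
  rw [Finset.mul_sum]
  refine Finset.sum_congr rfl fun i _ => ?_
  rw [← smul_sub, sub_sub_sub_cancel_right, norm_smul, mul_pow, norm_inv, Real.norm_eq_abs,
    abs_of_pos hε, inv_pow, map_smul]

lemma tendsto_halfRss (ht : IsEquivariantEmbedding K act t) (A : SO3) (U : Fin n → SO3)
    (z : Fin n → EuclideanSpace ℝ (Fin 3)) (y : EuclideanSpace ℝ (Fin 3)) :
    Tendsto (fun ε => 2 * (ε ^ 2)⁻¹ * halfRss t (fun i => rotClass K (U i)) (ch.sample A U z ε)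
        (A * ch.toRot (ε • y))) (𝓝[>] 0)
      (𝓝 (‖WithLp.toLp 2 z - ch.design U y‖ ^ 2)) := by
  refine (ch.tendsto_sum_sq le_rfl U z tendsto_const_nhds).congr fun ε => ?_
  rw [ch.halfRss_sample ht]
  simp_rw [inv_mul_toRot_mul]
  ring

lemma tendsto_halfRss_self (ht : IsEquivariantEmbedding K act t) (A : SO3) (U : Fin n → SO3)
    (z : Fin n → EuclideanSpace ℝ (Fin 3)) :
    Tendsto (fun ε => 2 * (ε ^ 2)⁻¹ * halfRss t (fun i => rotClass K (U i)) (ch.sample A U z ε) A)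
      (𝓝[>] 0) (𝓝 (‖WithLp.toLp 2 z‖ ^ 2)) := by
  simpa [ch.toRot_zero] using ch.tendsto_halfRss ht A U z 0

lemma sq_norm_sub_design (U : Fin n → SO3) (w : PiLp 2 (fun _ : Fin n => EuclideanSpace ℝ (Fin 3))) :
    (∀ y, ‖(LinearMap.range (ch.design U))ᗮ.orthogonalProjectionOnto w‖ ^ 2 ≤
      ‖w - ch.design U y‖ ^ 2) ∧
    ∃ y, ‖w - ch.design U y‖ ^ 2 =
      ‖(LinearMap.range (ch.design U))ᗮ.orthogonalProjectionOnto w‖ ^ 2 := by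
  refine ⟨fun y => ?_, ?_⟩
  · rw [norm_sq_sub_eq_of_mem w (LinearMap.mem_range_self (ch.design U) y)]
    exact le_add_of_nonneg_right (sq_nonneg _)
  · obtain ⟨y, hy⟩ := LinearMap.mem_range.1
      (Submodule.coe_mem ((LinearMap.range (ch.design U)).orthogonalProjectionOnto w))
    refine ⟨y, ?_⟩
    rw [norm_sq_sub_eq_of_mem w (LinearMap.mem_range_self (ch.design U) y), hy, sub_self, norm_zero]
    ring

/-- The upper bound comes from the test fit `A * toRot (ε • y₁)`, `y₁` a least squares solution. For
the lower bound, minimizers `A * G ε` are followed along an ultrafilter: their residuals are `O(ε)`,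
so `G ε` converges to some `g` that has no effect on the classes `[U i]`. After division by `g` the
parameter of the fit is `O(ε)`, and its rescaled limit `y₀` gives the value `‖z - X y₀‖²`, at least
the least squares minimum. -/
lemma tendsto_minRss (ht : IsEquivariantEmbedding K act t) (hn : 0 < n) (A : SO3)
    (U : Fin n → SO3) (z : Fin n → EuclideanSpace ℝ (Fin 3)) :
    Tendsto (fun ε => 2 * (ε ^ 2)⁻¹ * minRss t (fun i => rotClass K (U i)) (ch.sample A U z ε))
      (𝓝[>] 0)
      (𝓝 (‖(LinearMap.range (ch.design U))ᗮ.orthogonalProjectionOnto (WithLp.toLp 2 z)‖ ^ 2)) := by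
  obtain ⟨hmin, y₁, hy₁⟩ := ch.sq_norm_sub_design U (WithLp.toLp 2 z)
  set m := ‖(LinearMap.range (ch.design U))ᗮ.orthogonalProjectionOnto (WithLp.toLp 2 z)‖ ^ 2 with hm
  have hup := ch.tendsto_halfRss ht A U z y₁
  rw [hy₁] at hup
  -- Along an ultrafilter, compactness yields limits without passing to subsequences. The minimizers
  -- need not converge along `𝓝[>] 0` itself, since they are determined only up to symmetries.
  rw [tendsto_iff_ultrafilter]
  intro F hF
  have hpos : ∀ᶠ ε in (F : Filter ℝ), (0 : ℝ) < ε := hF self_mem_nhdsWithin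
  have hε0 : Tendsto (fun ε : ℝ => ε) F (𝓝 0) := tendsto_id.mono_left (hF.trans nhdsWithin_le_nhds)
  have hle : ∀ᶠ ε in (F : Filter ℝ),
      2 * (ε ^ 2)⁻¹ * minRss t (fun i => rotClass K (U i)) (ch.sample A U z ε) ≤
      2 * (ε ^ 2)⁻¹ * halfRss t (fun i => rotClass K (U i)) (ch.sample A U z ε)
        (A * ch.toRot (ε • y₁)) := by
    filter_upwards [hpos] with ε hε
    exact mul_le_mul_of_nonneg_left (minRss_le _ _ _) (by positivity)
  choose B hB using fun ε => exists_minRss_eq ht.continuous (fun i => rotClass K (U i))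
    (ch.sample A U z ε)
  set G : ℝ → SO3 := fun ε => A⁻¹ * B ε with hG
  have hBG : ∀ ε, B ε = A * G ε := fun ε => by simp [hG]
  obtain ⟨g, -, hg⟩ := isCompact_univ.ultrafilter_le_nhds (F.map G) (by simp)
  have hgt : Tendsto G F (𝓝 g) := hg
  -- each fitted residual is of order `ε`
  obtain ⟨C, hC0, hC⟩ : ∃ C : ℝ, 0 ≤ C ∧ ∀ᶠ ε in (F : Filter ℝ), ∀ i,
      ‖t (rotClass K (ch.toRot (ε • z i))) - t (rotClass K ((U i)⁻¹ * G ε * U i))‖ ≤ C * ε := by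
    refine ⟨Real.sqrt (m + 1), Real.sqrt_nonneg _, ?_⟩
    have h1 : ∀ᶠ ε in (F : Filter ℝ), 2 * (ε ^ 2)⁻¹ * halfRss t (fun i => rotClass K (U i))
        (ch.sample A U z ε) (A * ch.toRot (ε • y₁)) < m + 1 :=
      (hup.mono_left hF).eventually_lt_const (by linarith)
    filter_upwards [hpos, hle, h1] with ε hε h2 h3 i
    have h4 := h2.trans h3.le
    rw [hB, hBG, ch.halfRss_sample ht] at h4
    have h5 := Finset.single_le_sum (f := fun i => ‖t (rotClass K (ch.toRot (ε • z i))) -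
      t (rotClass K ((U i)⁻¹ * G ε * U i))‖ ^ 2) (fun i _ => sq_nonneg _) (Finset.mem_univ i)
    have h6 : ‖t (rotClass K (ch.toRot (ε • z i))) - t (rotClass K ((U i)⁻¹ * G ε * U i))‖ ^ 2 ≤
        (m + 1) * ε ^ 2 := by
      rw [← div_le_iff₀ (by positivity), div_eq_mul_inv]
      refine le_trans ?_ h4
      have := mul_le_mul_of_nonneg_right h5 (show 0 ≤ (ε ^ 2)⁻¹ by positivity)
      linarith
    have h7 := Real.le_sqrt_of_sq_le h6
    rwa [Real.sqrt_mul (by positivity), Real.sqrt_sq hε.le] at h7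
  -- hence the limit of the fits belongs to the conjugates of `K`
  have hfz : ∀ w : EuclideanSpace ℝ (Fin 3), Tendsto
      (fun ε : ℝ => t (rotClass K (ch.toRot (ε • w)))) F (𝓝 (t (rotClass K 1))) := by
    intro w
    have hc : Continuous fun ε : ℝ => t (rotClass K (ch.toRot (ε • w))) :=
      ht.continuous_comp.comp (ch.continuous_toRot.comp (by fun_prop))
    have := (hc.tendsto 0).comp hε0
    simpa [ch.toRot_zero, Function.comp_def] using this
  have hgK : ∀ i, (U i)⁻¹ * g * U i ∈ K := by
    intro i
    rw [← ht.apply_eq_iff]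
    have h1 : Tendsto (fun ε => t (rotClass K ((U i)⁻¹ * G ε * U i))) F
        (𝓝 (t (rotClass K ((U i)⁻¹ * g * U i)))) :=
      (ht.continuous_comp.tendsto _).comp ((tendsto_const_nhds.mul hgt).mul tendsto_const_nhds)
    have h2 : Tendsto (fun ε => t (rotClass K (ch.toRot (ε • z i))) -
        t (rotClass K ((U i)⁻¹ * G ε * U i))) F (𝓝 0) := by
      refine squeeze_zero_norm' (hC.mono fun ε h => h i) ?_
      simpa using hε0.const_mul C
    have h3 := tendsto_nhds_unique ((hfz (z i)).sub h1) h2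
    exact (sub_eq_zero.1 h3).symm
  -- All the `(U i)⁻¹ * g * U i` lie in `K`, so `G ε` and `G ε * g⁻¹` give the same fitted classes,
  -- and the latter tends to the identity, where the chart applies.
  set x : ℝ → EuclideanSpace ℝ (Fin 3) := fun ε => ch.symm (G ε * g⁻¹) with hx
  have h1G : Tendsto (fun ε => G ε * g⁻¹) F (𝓝 1) := by
    simpa using hgt.mul (tendsto_const_nhds (x := g⁻¹))
  have hx0 : Tendsto x F (𝓝 0) := ch.tendsto_symm.comp h1G
  have hxG : ∀ᶠ ε in (F : Filter ℝ), ∀ i, rotClass K ((U i)⁻¹ * G ε * U i) =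
      rotClass K (ch.toRot (ch.adj (U i) (x ε))) := by
    filter_upwards [h1G.eventually ch.toRot_symm] with ε hε i
    have h1 : G ε = ch.toRot (x ε) * g := by rw [hx]; simp only; rw [hε]; group
    rw [← ch.inv_mul_toRot_mul, h1]
    refine Eq.symm (QuotientGroup.eq.2 ?_)
    convert hgK i using 1
    group
  -- the parameters of the fits are of order `ε`
  obtain ⟨D, hD⟩ : ∃ D : ℝ, ∀ᶠ ε in (F : Filter ℝ), ‖ε⁻¹ • x ε‖ ≤ D := by
    set ρ := ch.adj (U ⟨0, hn⟩) with hρ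
    obtain ⟨a, ha, hρa⟩ := ρ.exists_antilipschitzWith (LinearMap.ker_eq_bot.2 (ch.adj_injective _))
    have hρx : Tendsto (fun ε => ρ (x ε)) F (𝓝 0) := by
      have hc : Continuous ρ := LinearMap.continuous_of_finiteDimensional _
      simpa [Function.comp_def] using (hc.tendsto 0).comp hx0
    have hlow := hρx.eventually (eventually_half_norm_le ch.hasFDerivAt)
    have hz0 := (ch.tendsto_inv_smul_sub hF (tendsto_const_nhds (x := z ⟨0, hn⟩))).norm
    have hz1 := hz0.eventually_lt_const (lt_add_one _)
    refine ⟨a * (2 * (C + (‖ch.diff (z ⟨0, hn⟩)‖ + 1))), ?_⟩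
    filter_upwards [hpos, hlow, hC, hxG, hz1] with ε hε h1 h2 h3 h4
    have h5 := h2 ⟨0, hn⟩
    rw [h3, ← hρ] at h5
    rw [ch.toRot_zero] at h1
    rw [norm_smul, norm_inv, Real.norm_eq_abs, abs_of_pos hε, inv_mul_lt_iff₀ hε] at h4
    have h6 := hρa.le_mul_dist (x ε) 0
    rw [map_zero, dist_zero_right, dist_zero_right] at h6
    have h7 := norm_sub_le_norm_sub_add_norm_sub (t (rotClass K (ch.toRot (ρ (x ε)))))
      (t (rotClass K (ch.toRot (ε • z ⟨0, hn⟩)))) (t (rotClass K 1))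
    rw [norm_sub_rev (t (rotClass K (ch.toRot (ρ (x ε)))))
      (t (rotClass K (ch.toRot (ε • z ⟨0, hn⟩))))] at h7
    rw [norm_smul, norm_inv, Real.norm_eq_abs, abs_of_pos hε, inv_mul_le_iff₀ hε]
    have h8 : ‖ρ (x ε)‖ ≤ 2 * ((C + (‖ch.diff (z ⟨0, hn⟩)‖ + 1)) * ε) := by linarith
    calc ‖x ε‖ ≤ a * ‖ρ (x ε)‖ := h6
      _ ≤ a * (2 * ((C + (‖ch.diff (z ⟨0, hn⟩)‖ + 1)) * ε)) := by gcongr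
      _ = _ := by ring
  obtain ⟨y₀, -, hy₀⟩ := (isCompact_closedBall (0 : EuclideanSpace ℝ (Fin 3)) D).ultrafilter_le_nhds
    (F.map fun ε => ε⁻¹ • x ε) (by
      rw [le_principal_iff]
      exact hD.mono fun ε h => by simpa using h)
  have hy₀t : Tendsto (fun ε => ε⁻¹ • x ε) F (𝓝 y₀) := hy₀
  have hlim : Tendsto (fun ε => 2 * (ε ^ 2)⁻¹ *
      minRss t (fun i => rotClass K (U i)) (ch.sample A U z ε)) F
      (𝓝 (‖WithLp.toLp 2 z - ch.design U y₀‖ ^ 2)) := by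
    refine (ch.tendsto_sum_sq hF U z hy₀t).congr' ?_
    filter_upwards [hpos, hxG] with ε hε h1
    rw [hB, hBG, ch.halfRss_sample ht]
    simp_rw [h1, smul_smul, mul_inv_cancel₀ hε.ne', one_smul]
    ring
  -- Comparison with the test fit bounds the limit above by the least squares minimum; `hmin y₀` is
  -- the opposite inequality.
  have h1 := le_of_tendsto_of_tendsto hlim (hup.mono_left hF) hle
  rwa [le_antisymm h1 (hmin y₀)] at hlim

end RotChart

end Linearization

/-! ### Laplace's method for the regression density. -/

section Invariance

variable {E : Type*} [NormedAddCommGroup E] [InnerProductSpace ℝ E] {K : Subgroup SO3}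
  {act : SO3 →* (E ≃ₗᵢ[ℝ] E)} {t : SO3 ⧸ K → E}

lemma IsEquivariantEmbedding.norm_apply (ht : IsEquivariantEmbedding K act t) (x : SO3 ⧸ K) :
    ‖t x‖ = ‖t (rotClass K 1)‖ := by
  obtain ⟨g, rfl⟩ := QuotientGroup.mk_surjective x
  have := ht.apply_mul g 1
  rw [mul_one] at this
  change ‖t (rotClass K g)‖ = _
  rw [this, LinearIsometryEquiv.norm_map]

lemma IsEquivariantEmbedding.inner_apply (ht : IsEquivariantEmbedding K act t) (x y : SO3 ⧸ K) :
    inner ℝ (t x) (t y) = ‖t (rotClass K 1)‖ ^ 2 - ‖t x - t y‖ ^ 2 / 2 := by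
  have := norm_sub_sq_real (t x) (t y)
  rw [ht.norm_apply x, ht.norm_apply y] at this
  linarith

lemma map_smul_uniformRot [Finite K] (g : SO3) :
    (uniformRot K).map (fun x => g • x) = uniformRot K := by
  have hg : Measurable fun x : SO3 ⧸ K => g • x := (continuous_const_smul g).measurable
  rw [uniformRot, Measure.map_map hg (measurable_rotClass K)]
  have : (fun x : SO3 ⧸ K => g • x) ∘ rotClass K = rotClass K ∘ fun x => g * x := rfl
  rw [this, ← Measure.map_map (measurable_rotClass K) (measurable_const_mul g),
    map_mul_left_eq_self]

end Invariance

lemma lintegral_smul_param {ε : ℝ} (hε : 0 < ε) {g : EuclideanSpace ℝ (Fin 3) → ℝ≥0∞}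
    (hg : Measurable g) :
    ∫⁻ y, g y = ENNReal.ofReal (ε ^ 3) * ∫⁻ x, g (ε • x) := by
  have h := Measure.map_addHaar_smul (volume : Measure (EuclideanSpace ℝ (Fin 3))) hε.ne'
  rw [← lintegral_map hg (measurable_const_smul ε), h, lintegral_smul_measure, smul_eq_mul,
    ← mul_assoc, ← ENNReal.ofReal_mul (by positivity), finrank_euclideanSpace_fin, abs_inv, abs_pow,
    abs_of_pos hε, mul_inv_cancel₀ (by positivity), ENNReal.ofReal_one, one_mul]

lemma integrable_japanese : Integrable fun z : EuclideanSpace ℝ (Fin 3) => ((1 + ‖z‖ ^ 2) ^ 2)⁻¹ := by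
  have h := integrable_rpow_neg_one_add_norm_sq (E := EuclideanSpace ℝ (Fin 3))
    (μ := volume) (r := 4) (by simp; norm_num)
  refine h.congr (ae_of_all _ fun z => ?_)
  simp only
  rw [show (-4 / 2 : ℝ) = -((2 : ℕ) : ℝ) by norm_num, Real.rpow_neg (by positivity),
    Real.rpow_natCast]

/-- Only this polynomial decay is kept, because it multiplies well with the bound `dens_le`. -/
lemma exists_exp_neg_mul_le {b : ℝ} (hb : 0 < b) :
    ∃ M : ℝ, 0 < M ∧ ∀ s, 0 ≤ s → Real.exp (-(b * s)) ≤ M * ((1 + s) ^ 2)⁻¹ := by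
  set r := min 1 (b / 2) with hr
  have hr0 : 0 < r := by positivity
  refine ⟨(r ^ 2)⁻¹, by positivity, fun s hs => ?_⟩
  rw [← mul_inv, ← mul_pow, Real.exp_neg]
  refine inv_anti₀ (by positivity) ?_
  have h1 : r * (1 + s) ≤ Real.exp (b * s / 2) := by
    have h2 := Real.add_one_le_exp (b * s / 2)
    have h3 : r * s ≤ b / 2 * s := mul_le_mul_of_nonneg_right (min_le_right _ _) hs
    have h4 : r ≤ 1 := min_le_left _ _
    linarith
  calc (r * (1 + s)) ^ 2 ≤ Real.exp (b * s / 2) ^ 2 := pow_le_pow_left₀ (by positivity) h1 2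
    _ = Real.exp (b * s) := by rw [← Real.exp_nat_mul]; congr 1; push_cast; ring

section Laplace

variable {E : Type*} [NormedAddCommGroup E] [InnerProductSpace ℝ E] {K : Subgroup SO3}
  {act : SO3 →* (E ≃ₗᵢ[ℝ] E)} {t : SO3 ⧸ K → E} {n : ℕ}

namespace RotChart

variable (ch : RotChart K t)

/-- The unnormalized density of the rescaled parameter of an observation, when the concentration
is `ε⁻²`. -/
noncomputable def scaledDens (ε : ℝ) (z : EuclideanSpace ℝ (Fin 3)) : ℝ :=
  Real.exp (-((ε ^ 2)⁻¹ * (‖t (rotClass K (ch.toRot (ε • z))) - t (rotClass K 1)‖ ^ 2 / 2))) *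
    ch.dens (ε • z)

lemma scaledDens_nonneg (ε : ℝ) (z : EuclideanSpace ℝ (Fin 3)) : 0 ≤ ch.scaledDens ε z :=
  mul_nonneg (Real.exp_nonneg _) (ch.dens_nonneg _)

include act in
lemma measurable_scaledDens (ht : IsEquivariantEmbedding K act t) (ε : ℝ) :
    Measurable (ch.scaledDens ε) := by
  have h1 : Continuous fun z : EuclideanSpace ℝ (Fin 3) => t (rotClass K (ch.toRot (ε • z))) :=
    ht.continuous_comp.comp (ch.continuous_toRot.comp (by fun_prop))
  have h2 : Measurable fun z : EuclideanSpace ℝ (Fin 3) => ch.dens (ε • z) :=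
    ch.measurable_dens.comp (by fun_prop)
  exact (Real.continuous_exp.comp (continuous_const.mul
    (((h1.sub continuous_const).norm.pow 2).div_const 2)).neg).measurable.mul h2

/-- Domination uniform in `ε`. With `m = min (‖z‖²) ε⁻²`, the field `lower` bounds the exponential
by a multiple of `(1 + m)⁻²`, and `dens_le` bounds the density by a multiple of `(1 + ‖ε z‖²)⁻²`.
Whichever term realizes the minimum, `(1 + m) (1 + ‖ε z‖²) ≥ 1 + ‖z‖²`. -/
lemma exists_scaledDens_le : ∃ D : ℝ, 0 < D ∧ ∀ ε, 0 < ε → ∀ z,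
    ch.scaledDens ε z ≤ D * ((1 + ‖z‖ ^ 2) ^ 2)⁻¹ := by
  obtain ⟨C, hC, hdens⟩ := ch.dens_le
  obtain ⟨a, ha, hlow⟩ := ch.lower
  obtain ⟨M, hM, hexp⟩ := exists_exp_neg_mul_le (half_pos ha)
  refine ⟨M * C, by positivity, fun ε hε z => ?_⟩
  by_cases hz : ch.dens (ε • z) = 0
  · rw [scaledDens, hz, mul_zero]; positivity
  set m := min (‖z‖ ^ 2) (ε ^ 2)⁻¹ with hm
  have hm0 : 0 ≤ m := by positivity
  have h1 : a / 2 * m ≤ (ε ^ 2)⁻¹ *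
      (‖t (rotClass K (ch.toRot (ε • z))) - t (rotClass K 1)‖ ^ 2 / 2) := by
    have h2 := hlow _ hz
    have h3 : min (‖ε • z‖ ^ 2) 1 = ε ^ 2 * m := by
      rw [hm, mul_min_of_nonneg _ _ (by positivity), mul_inv_cancel₀ (by positivity), norm_smul,
        mul_pow, Real.norm_eq_abs, sq_abs]
    rw [h3] at h2
    rw [← div_eq_inv_mul, le_div_iff₀ (by positivity)]
    linarith
  have h4 : ch.scaledDens ε z ≤ M * ((1 + m) ^ 2)⁻¹ * (C * ((1 + ‖ε • z‖ ^ 2) ^ 2)⁻¹) := by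
    refine mul_le_mul ?_ (hdens _) (ch.dens_nonneg _) (by positivity)
    exact (Real.exp_le_exp.2 (neg_le_neg h1)).trans (hexp m hm0)
  refine h4.trans ?_
  have h5 : 1 + ‖z‖ ^ 2 ≤ (1 + m) * (1 + ‖ε • z‖ ^ 2) := by
    rw [norm_smul, mul_pow, Real.norm_eq_abs, sq_abs, hm]
    rcases min_choice (‖z‖ ^ 2) (ε ^ 2)⁻¹ with h | h <;> rw [h]
    · have : 0 ≤ ‖z‖ ^ 2 * (ε ^ 2 * ‖z‖ ^ 2) := by positivity
      nlinarith [sq_nonneg (ε * ‖z‖)]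
    · have : (ε ^ 2)⁻¹ * (ε ^ 2 * ‖z‖ ^ 2) = ‖z‖ ^ 2 := by field_simp
      have h6 : 0 ≤ (ε ^ 2)⁻¹ := by positivity
      nlinarith [sq_nonneg (ε * ‖z‖)]
  have h7 : ((1 + m) ^ 2)⁻¹ * ((1 + ‖ε • z‖ ^ 2) ^ 2)⁻¹ ≤ ((1 + ‖z‖ ^ 2) ^ 2)⁻¹ := by
    rw [← mul_inv, ← mul_pow]
    exact inv_anti₀ (by positivity) (pow_le_pow_left₀ (by positivity) h5 2)
  calc _ = M * C * (((1 + m) ^ 2)⁻¹ * ((1 + ‖ε • z‖ ^ 2) ^ 2)⁻¹) := by ring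
    _ ≤ _ := by gcongr

/-- The limit of the total mass of `scaledDens`. -/
noncomputable def limMass : ℝ := ch.dens 0 * Real.sqrt (2 * Real.pi) ^ 3

lemma limMass_pos : 0 < ch.limMass := mul_pos ch.dens_zero_pos (by positivity)

lemma tendsto_scaledDens (z : EuclideanSpace ℝ (Fin 3)) :
    Tendsto (fun ε => ch.scaledDens ε z) (𝓝[>] 0) (𝓝 (ch.limMass * gaussDens z)) := by
  have h1 := ((ch.tendsto_inv_smul_sub le_rfl (tendsto_const_nhds (x := z))).norm.pow 2)
  rw [ch.diff.norm_map] at h1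
  have h2 : Tendsto (fun ε : ℝ => ch.dens (ε • z)) (𝓝[>] 0) (𝓝 (ch.dens 0)) := by
    have hc : Tendsto (fun ε : ℝ => ε • z) (𝓝[>] 0) (𝓝 0) := by
      have : Continuous fun ε : ℝ => ε • z := by fun_prop
      simpa using (this.tendsto 0).mono_left nhdsWithin_le_nhds
    exact ch.continuousAt_dens.tendsto.comp hc
  have h3 := ((Real.continuous_exp.tendsto _).comp (h1.div_const 2).neg).mul h2
  have h4 : Real.exp (-(‖z‖ ^ 2 / 2)) * ch.dens 0 = ch.limMass * gaussDens z := by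
    rw [limMass, gaussDens, inv_pow]
    have : Real.sqrt (2 * Real.pi) ^ 3 ≠ 0 := by positivity
    field_simp
  rw [h4] at h3
  refine h3.congr' ?_
  filter_upwards [self_mem_nhdsWithin] with ε hε
  have hε0 : (0 : ℝ) < ε := hε
  simp only [Function.comp_apply, scaledDens]
  congr 2
  rw [norm_smul, mul_pow, norm_inv, Real.norm_eq_abs, abs_of_pos hε0, inv_pow]
  ring

lemma uniformRot_eq_map (g : SO3) [Finite K] {ε : ℝ} (hε : 0 < ε) :
    uniformRot K = (volume.withDensity fun z => ENNReal.ofReal (ε ^ 3 * ch.dens (ε • z))).map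
      fun z => rotClass K (g * ch.toRot (ε • z)) := by
  have hm : ∀ h : SO3, Measurable fun z : EuclideanSpace ℝ (Fin 3) =>
      rotClass K (h * ch.toRot (ε • z)) := fun h =>
    ((continuous_rotClass K).comp (continuous_const.mul
      (ch.continuous_toRot.comp (by fun_prop)))).measurable
  have hm' : Measurable fun z : EuclideanSpace ℝ (Fin 3) => rotClass K (ch.toRot z) :=
    ((continuous_rotClass K).comp ch.continuous_toRot).measurable
  have hd := ch.measurable_dens
  have hg : Measurable fun x : SO3 ⧸ K => g • x := (continuous_const_smul g).measurable
  refine Measure.ext_of_lintegral _ fun f hf => ?_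
  conv_lhs => rw [← map_smul_uniformRot g, lintegral_map hf hg, ch.uniformRot_eq]
  have hfg : Measurable fun x => f (g • x) := hf.comp hg
  have hfz : Measurable fun z : EuclideanSpace ℝ (Fin 3) => f (g • rotClass K (ch.toRot z)) :=
    hfg.comp hm'
  rw [lintegral_map hfg hm', lintegral_withDensity_eq_lintegral_mul _ hd.ennreal_ofReal hfz,
    lintegral_map hf (hm g), lintegral_withDensity_eq_lintegral_mul _ (by fun_prop)
      (g := fun z => f (rotClass K (g * ch.toRot (ε • z)))) (hf.comp (hm g)),
    lintegral_smul_param hε (hd.ennreal_ofReal.mul hfz), ← lintegral_const_mul]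
  · refine lintegral_congr fun z => ?_
    simp only [Pi.mul_apply]
    rw [ENNReal.ofReal_mul (by positivity), mul_assoc]
    rfl
  · exact (hd.ennreal_ofReal.mul hfz).comp (measurable_const_smul ε)

lemma integrable_dens : Integrable ch.dens := by
  obtain ⟨C, hC, hdens⟩ := ch.dens_le
  refine (integrable_japanese.const_mul C).mono' ch.measurable_dens.aestronglyMeasurable
    (ae_of_all _ fun z => ?_)
  rw [Real.norm_of_nonneg (ch.dens_nonneg z)]
  exact hdens z

lemma pi_uniformRot_eq_map [Finite K] (A : SO3) (U : Fin n → SO3) {ε : ℝ} (hε : 0 < ε) :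
    (Measure.pi fun _ : Fin n => uniformRot K) =
      (volume.withDensity fun z : Fin n → EuclideanSpace ℝ (Fin 3) =>
        ENNReal.ofReal (∏ i, (ε ^ 3 * ch.dens (ε • z i)))).map fun z => ch.sample A U z ε := by
  have hint : Integrable fun z : EuclideanSpace ℝ (Fin 3) => ε ^ 3 * ch.dens (ε • z) :=
    (ch.integrable_dens.comp_smul hε.ne').const_mul _
  rw [volume_pi, ← pi_withDensity_ofReal volume
    (fun z => mul_nonneg (by positivity) (ch.dens_nonneg _)) hint]
  have hm : ∀ h : SO3, Measurable fun z : EuclideanSpace ℝ (Fin 3) =>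
      rotClass K (h * ch.toRot (ε • z)) := fun h =>
    ((continuous_rotClass K).comp (continuous_const.mul
      (ch.continuous_toRot.comp (by fun_prop)))).measurable
  have h1 : ∀ i, (volume.withDensity fun z => ENNReal.ofReal (ε ^ 3 * ch.dens (ε • z))).map
      (fun z => rotClass K (A * U i * ch.toRot (ε • z))) = uniformRot K := fun i =>
    (ch.uniformRot_eq_map (A * U i) hε).symm
  have : ∀ i, SigmaFinite ((volume.withDensity fun z => ENNReal.ofReal
      (ε ^ 3 * ch.dens (ε • z))).map (fun z => rotClass K (A * U i * ch.toRot (ε • z)))) := fun i => by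
    rw [h1]; infer_instance
  have h2 := Measure.pi_map_pi (μ := fun _ : Fin n => volume.withDensity fun z =>
    ENNReal.ofReal (ε ^ 3 * ch.dens (ε • z)))
    (f := fun i z => rotClass K (A * U i * ch.toRot (ε • z))) (fun i => (hm (A * U i)).aemeasurable)
  simp_rw [h1] at h2
  rw [← h2]
  rfl

/-- The total mass of `scaledDens`. -/
noncomputable def mass (ε : ℝ) : ℝ := ∫ z, ch.scaledDens ε z

include act in
-- The factors `exp (κ ρ²)` and `ε³` also appear in the numerator of the density after the change of
-- variables, so only `mass ε`, which has a positive limit, survives.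
lemma normConst_eq [Finite K] (ht : IsEquivariantEmbedding K act t) {ε : ℝ} (hε : 0 < ε) :
    normConst K t (ε ^ 2)⁻¹ =
      Real.exp ((ε ^ 2)⁻¹ * ‖t (rotClass K 1)‖ ^ 2) * (ε ^ 3 * ch.mass ε) := by
  have hm : Measurable fun z : EuclideanSpace ℝ (Fin 3) => rotClass K (1 * ch.toRot (ε • z)) :=
    ((continuous_rotClass K).comp (continuous_const.mul
      (ch.continuous_toRot.comp (by fun_prop)))).measurable
  have hc : Continuous fun x : SO3 ⧸ K =>
      Real.exp ((ε ^ 2)⁻¹ * inner ℝ (t x) (t (rotClass K 1))) := by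
    have := ht.continuous
    fun_prop
  have hd := ch.measurable_dens
  rw [normConst, ch.uniformRot_eq_map 1 hε, integral_map hm.aemeasurable
    hc.measurable.aestronglyMeasurable, integral_withDensity_eq_integral_toReal_smul (by fun_prop)
    (ae_of_all _ fun z => ENNReal.ofReal_lt_top), mass, ← integral_const_mul, ← integral_const_mul]
  refine integral_congr_ae (ae_of_all _ fun z => ?_)
  have h0 := ch.dens_nonneg (ε • z)
  simp only [one_mul, smul_eq_mul]
  rw [ENNReal.toReal_ofReal (by positivity), ht.inner_apply, mul_sub, sub_eq_add_neg, Real.exp_add,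
    scaledDens]
  ring

end RotChart

end Laplace

/-! ### Convergence of expectations under the model. -/

section Limit

variable {E : Type*} [NormedAddCommGroup E] [InnerProductSpace ℝ E] {K : Subgroup SO3} [Finite K]
  {act : SO3 →* (E ≃ₗᵢ[ℝ] E)} {t : SO3 ⧸ K → E} {n : ℕ}

namespace RotChart

variable (ch : RotChart K t)

lemma normConst_pos (ht : IsEquivariantEmbedding K act t) (κ : ℝ) : 0 < normConst K t κ := by
  have hc : Continuous fun x : SO3 ⧸ K => Real.exp (κ * inner ℝ (t x) (t (rotClass K 1))) := by
    have := ht.continuous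
    fun_prop
  refine integral_exp_pos ?_
  exact hc.integrable_of_hasCompactSupport (HasCompactSupport.of_compactSpace _)

lemma mass_pos (ht : IsEquivariantEmbedding K act t) {ε : ℝ} (hε : 0 < ε) : 0 < ch.mass ε := by
  have h := normConst_pos ht (ε ^ 2)⁻¹
  rw [ch.normConst_eq ht hε] at h
  have h1 := pos_of_mul_pos_right h (Real.exp_nonneg _)
  exact pos_of_mul_pos_right h1 (by positivity)

omit [Finite K] in
lemma integral_pi_gaussDens (f : (Fin n → EuclideanSpace ℝ (Fin 3)) → ℝ) :
    ∫ z, f z * ∏ i, gaussDens (z i) =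
      ∫ z, f z ∂(Measure.pi fun _ : Fin n => stdGaussian (EuclideanSpace ℝ (Fin 3))) := by
  have h0 : ∀ z, 0 ≤ gaussDens z := fun z => by unfold gaussDens; positivity
  have hm : Measurable gaussDens := by unfold gaussDens; fun_prop
  have hint : Integrable gaussDens := by
    refine ⟨hm.aestronglyMeasurable, ?_⟩
    rw [hasFiniteIntegral_iff_ofReal (ae_of_all _ h0)]
    have h1 : (stdGaussian (EuclideanSpace ℝ (Fin 3))) univ = 1 := measure_univ
    rw [stdGaussian_eq_withDensity, withDensity_apply _ .univ, Measure.restrict_univ] at h1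
    rw [h1]; exact ENNReal.one_lt_top
  have hpm : Measurable fun x : Fin n → EuclideanSpace ℝ (Fin 3) => ∏ i, gaussDens (x i) :=
    Finset.measurable_prod _ fun i _ => hm.comp (measurable_pi_apply i)
  simp_rw [stdGaussian_eq_withDensity]
  rw [pi_withDensity_ofReal volume h0 hint, integral_withDensity_eq_integral_toReal_smul
    hpm.ennreal_ofReal (ae_of_all _ fun z => ENNReal.ofReal_lt_top)]
  refine integral_congr_ae (ae_of_all _ fun z => ?_)
  simp only
  rw [ENNReal.toReal_ofReal (Finset.prod_nonneg fun i _ => h0 _), smul_eq_mul, mul_comm]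

omit [Finite K] in
/-- Dominated convergence for the rescaled parameters of the observations. -/
lemma tendsto_integral_mul_scaledDens (ht : IsEquivariantEmbedding K act t)
    {f : ℝ → (Fin n → EuclideanSpace ℝ (Fin 3)) → ℝ}
    {g : (Fin n → EuclideanSpace ℝ (Fin 3)) → ℝ} {M : ℝ} (hf : ∀ ε, Measurable (f ε))
    (hM : ∀ ε z, |f ε z| ≤ M) (hlim : ∀ z, Tendsto (fun ε => f ε z) (𝓝[>] 0) (𝓝 (g z))) :
    Tendsto (fun ε => ∫ z, f ε z * ∏ i, ch.scaledDens ε (z i)) (𝓝[>] 0)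
      (𝓝 (ch.limMass ^ n *
        ∫ z, g z ∂(Measure.pi fun _ : Fin n => stdGaussian (EuclideanSpace ℝ (Fin 3))))) := by
  obtain ⟨D, hD, hle⟩ := ch.exists_scaledDens_le
  have h1 : ch.limMass ^ n *
        ∫ z, g z ∂(Measure.pi fun _ : Fin n => stdGaussian (EuclideanSpace ℝ (Fin 3))) =
      ∫ z, g z * ∏ i, (ch.limMass * gaussDens (z i)) := by
    rw [← integral_pi_gaussDens, ← integral_const_mul]
    refine integral_congr_ae (ae_of_all _ fun z => ?_)
    simp only [Finset.prod_mul_distrib, Finset.prod_const, Finset.card_univ, Fintype.card_fin]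
    ring
  rw [h1]
  refine tendsto_integral_filter_of_dominated_convergence
    (fun z => M * ∏ i, (D * ((1 + ‖z i‖ ^ 2) ^ 2)⁻¹)) ?_ ?_ ?_ ?_
  · refine Eventually.of_forall fun ε => Measurable.aestronglyMeasurable ?_
    exact (hf ε).mul (Finset.measurable_prod _ fun i _ =>
      (ch.measurable_scaledDens ht ε).comp (measurable_pi_apply i))
  · filter_upwards [self_mem_nhdsWithin] with ε hε
    refine ae_of_all _ fun z => ?_
    have hε0 : (0 : ℝ) < ε := hε
    have hM0 : 0 ≤ M := (abs_nonneg _).trans (hM ε z)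
    rw [norm_mul, Real.norm_eq_abs, Real.norm_of_nonneg (Finset.prod_nonneg fun i _ =>
      ch.scaledDens_nonneg ε (z i))]
    exact mul_le_mul (hM ε z) (Finset.prod_le_prod (fun i _ => ch.scaledDens_nonneg ε (z i))
      fun i _ => hle ε hε0 (z i)) (Finset.prod_nonneg fun i _ => ch.scaledDens_nonneg ε (z i)) hM0
  · exact (Integrable.fintype_prod (f := fun _ z => D * ((1 + ‖z‖ ^ 2) ^ 2)⁻¹)
      (μ := fun _ : Fin n => (volume : Measure (EuclideanSpace ℝ (Fin 3))))
      fun _ => integrable_japanese.const_mul D).const_mul M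
  · exact ae_of_all _ fun z => (hlim z).mul
      (tendsto_finsetProd _ fun i _ => ch.tendsto_scaledDens (z i))

omit [Finite K] in
lemma tendsto_mass (ht : IsEquivariantEmbedding K act t) :
    Tendsto ch.mass (𝓝[>] 0) (𝓝 ch.limMass) := by
  have h := ch.tendsto_integral_mul_scaledDens (n := 1) ht (f := fun _ _ => 1) (g := fun _ => 1)
    (M := 1) (fun _ => measurable_const) (fun _ _ => by simp) (fun _ => tendsto_const_nhds)
  simp only [one_mul, integral_const, probReal_univ, smul_eq_mul, mul_one, pow_one] at h
  refine h.congr fun ε => ?_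
  have := integral_fintype_prod_volume_eq_prod (fun (_ : Fin 1) z => ch.scaledDens ε z)
  rw [this]; simp [mass]

/-- The change of variables `v = ch.sample A U z ε`. By equivariance the density of each `v i`
depends on `z i` alone, so the `z i` are independent with density `scaledDens ε / mass ε`, for every
`U`. -/
lemma integral_mul_regDensity (ht : IsEquivariantEmbedding K act t) (A : SO3) (U : Fin n → SO3)
    {ε : ℝ} (hε : 0 < ε) {h : (Fin n → SO3 ⧸ K) → ℝ} (hh : Measurable h) :
    ∫ v, h v * ∏ i, regDensity K t A (ε ^ 2)⁻¹ (rotClass K (U i)) (v i)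
        ∂(Measure.pi fun _ => uniformRot K) =
      ((ch.mass ε) ^ n)⁻¹ * ∫ z, h (ch.sample A U z ε) * ∏ i, ch.scaledDens ε (z i) := by
  have hreg : ∀ i, Measurable fun v : Fin n → SO3 ⧸ K =>
      regDensity K t A (ε ^ 2)⁻¹ (rotClass K (U i)) (v i) := fun i => by
    have := ht.continuous
    unfold regDensity
    exact Continuous.measurable (by fun_prop)
  have hF : Measurable fun v : Fin n → SO3 ⧸ K =>
      h v * ∏ i, regDensity K t A (ε ^ 2)⁻¹ (rotClass K (U i)) (v i) :=
    hh.mul (Finset.measurable_prod _ fun i _ => hreg i)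
  have hd := ch.measurable_dens
  have hsm : Measurable fun z : Fin n → EuclideanSpace ℝ (Fin 3) => ch.sample A U z ε :=
    (continuous_pi fun i => (continuous_rotClass K).comp (continuous_const.mul
      (ch.continuous_toRot.comp (by fun_prop)))).measurable
  have hpd : Measurable fun z : Fin n → EuclideanSpace ℝ (Fin 3) =>
      ENNReal.ofReal (∏ i, (ε ^ 3 * ch.dens (ε • z i))) := by
    refine (Finset.measurable_prod _ fun i _ => ?_).ennreal_ofReal
    exact (hd.comp (by fun_prop)).const_mul _
  rw [ch.pi_uniformRot_eq_map A U hε, integral_map hsm.aemeasurable hF.aestronglyMeasurable,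
    integral_withDensity_eq_integral_toReal_smul hpd (ae_of_all _ fun z => ENNReal.ofReal_lt_top),
    ← integral_const_mul]
  refine integral_congr_ae (ae_of_all _ fun z => ?_)
  simp only
  rw [ENNReal.toReal_ofReal (Finset.prod_nonneg fun i _ => mul_nonneg (by positivity)
    (ch.dens_nonneg _)), smul_eq_mul, mul_left_comm, ← Finset.prod_mul_distrib]
  have hfac : ∀ i, ε ^ 3 * ch.dens (ε • z i) * regDensity K t A (ε ^ 2)⁻¹ (rotClass K (U i))
      (ch.sample A U z ε i) = (ch.mass ε)⁻¹ * ch.scaledDens ε (z i) := by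
    intro i
    have hnorm : ‖t (ch.sample A U z ε i) - t (A • rotClass K (U i))‖ =
        ‖t (rotClass K (ch.toRot (ε • z i))) - t (rotClass K 1)‖ := by
      have h2 : t (A • rotClass K (U i)) = act (A * U i) (t (rotClass K 1)) := by
        rw [← ht.apply_mul, mul_one]; rfl
      rw [sample, ht.apply_mul, h2, ← map_sub, LinearIsometryEquiv.norm_map]
    have hmass := (ch.mass_pos ht hε).ne'
    rw [regDensity, ht.inner_apply, hnorm, ch.normConst_eq ht hε, mul_sub, sub_eq_add_neg,
      Real.exp_add, scaledDens]
    have hexp := (Real.exp_pos ((ε ^ 2)⁻¹ * ‖t (rotClass K 1)‖ ^ 2)).ne'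
    field_simp
  rw [Finset.prod_congr rfl fun i _ => hfac i, Finset.prod_mul_distrib, Finset.prod_const,
    Finset.card_univ, Fintype.card_fin, inv_pow]
  ring

include ch in
lemma integral_prod_regDensity (ht : IsEquivariantEmbedding K act t) (A : SO3) (U : Fin n → SO3)
    {ε : ℝ} (hε : 0 < ε) :
    ∫ v, ∏ i, regDensity K t A (ε ^ 2)⁻¹ (rotClass K (U i)) (v i)
        ∂(Measure.pi fun _ => uniformRot K) = 1 := by
  have h := ch.integral_mul_regDensity ht A U hε (h := fun _ => 1) measurable_const
  simp only [one_mul] at h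
  rw [h, integral_fintype_prod_volume_eq_prod (fun (_ : Fin n) z => ch.scaledDens ε z)]
  change (ch.mass ε ^ n)⁻¹ * ∏ _i : Fin n, ch.mass ε = 1
  rw [Finset.prod_const, Finset.card_univ, Fintype.card_fin,
    inv_mul_cancel₀ (pow_pos (ch.mass_pos ht hε) n).ne']

lemma tendsto_integral_mul_regDensity (ht : IsEquivariantEmbedding K act t) (A : SO3)
    (U : Fin n → SO3) {f : ℝ → (Fin n → SO3 ⧸ K) → ℝ}
    {g : (Fin n → EuclideanSpace ℝ (Fin 3)) → ℝ} {M : ℝ} (hf : ∀ ε, Measurable (f ε))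
    (hM : ∀ ε v, |f ε v| ≤ M)
    (hlim : ∀ z, Tendsto (fun ε => f ε (ch.sample A U z ε)) (𝓝[>] 0) (𝓝 (g z))) :
    Tendsto (fun ε => ∫ v, f ε v * ∏ i, regDensity K t A (ε ^ 2)⁻¹ (rotClass K (U i)) (v i)
        ∂(Measure.pi fun _ => uniformRot K)) (𝓝[>] 0)
      (𝓝 (∫ z, g z ∂(Measure.pi fun _ : Fin n => stdGaussian (EuclideanSpace ℝ (Fin 3))))) := by
  have hsm : ∀ ε, Measurable fun z : Fin n → EuclideanSpace ℝ (Fin 3) => ch.sample A U z ε :=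
    fun ε => (continuous_pi fun i => (continuous_rotClass K).comp (continuous_const.mul
      (ch.continuous_toRot.comp (by fun_prop)))).measurable
  have h1 := ch.tendsto_integral_mul_scaledDens ht (f := fun ε z => f ε (ch.sample A U z ε))
    (fun ε => (hf ε).comp (hsm ε)) (fun ε z => hM ε _) hlim
  have h2 := (((ch.tendsto_mass ht).pow n).inv₀ (pow_pos ch.limMass_pos n).ne').mul h1
  rw [inv_mul_cancel_left₀ (pow_pos ch.limMass_pos n).ne'] at h2
  refine h2.congr' ?_
  filter_upwards [self_mem_nhdsWithin] with ε hε
  exact (ch.integral_mul_regDensity ht A U hε (hf ε)).symm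

end RotChart

omit [Finite K] in
lemma continuous_prod_regDensity (ht : IsEquivariantEmbedding K act t) (A : SO3) (κ : ℝ) :
    Continuous fun p : (Fin n → SO3 ⧸ K) × (Fin n → SO3 ⧸ K) =>
      ∏ i, regDensity K t A κ (p.1 i) (p.2 i) := by
  have := ht.continuous
  unfold regDensity
  fun_prop

lemma prod_regDensity_nonneg (ht : IsEquivariantEmbedding K act t) (A : SO3) (κ : ℝ)
    (u v : Fin n → SO3 ⧸ K) : 0 ≤ ∏ i, regDensity K t A κ (u i) (v i) :=
  Finset.prod_nonneg fun _ _ =>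
    mul_nonneg (inv_nonneg.2 (RotChart.normConst_pos ht κ).le) (Real.exp_nonneg _)

/-- Limits of expectations in the regression model, as the concentration `ε⁻²` increases. -/
lemma RotChart.tendsto_integral_regressionLaw (ch : RotChart K t)
    (ht : IsEquivariantEmbedding K act t) (A : SO3) (ν : Measure (Fin n → SO3 ⧸ K))
    [IsProbabilityMeasure ν] {f : ℝ → (Fin n → SO3 ⧸ K) × (Fin n → SO3 ⧸ K) → ℝ} {M c : ℝ}
    (hf : ∀ ε, Measurable (f ε)) (hM : ∀ ε p, |f ε p| ≤ M)
    (hlim : ∀ U : Fin n → SO3, ∃ g : (Fin n → EuclideanSpace ℝ (Fin 3)) → ℝ,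
      (∀ z, Tendsto (fun ε => f ε ((fun i => rotClass K (U i)), ch.sample A U z ε)) (𝓝[>] 0)
        (𝓝 (g z))) ∧
      ∫ z, g z ∂(Measure.pi fun _ : Fin n => stdGaussian (EuclideanSpace ℝ (Fin 3))) = c) :
    Tendsto (fun ε => ∫ p, f ε p ∂(regressionLaw K t A (ε ^ 2)⁻¹ ν)) (𝓝[>] 0) (𝓝 c) := by
  set π : Measure (Fin n → SO3 ⧸ K) := Measure.pi fun _ => uniformRot K with hπ
  have hcont := fun κ => continuous_prod_regDensity (n := n) ht A κ
  have hpos := fun κ u v => prod_regDensity_nonneg (n := n) ht A κ u v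
  have e1 : ∀ ε, ∫ p, f ε p ∂(regressionLaw K t A (ε ^ 2)⁻¹ ν) =
      ∫ u, ∫ v, f ε (u, v) * ∏ i, regDensity K t A (ε ^ 2)⁻¹ (u i) (v i) ∂π ∂ν := by
    intro ε
    have hint : Integrable (fun p : (Fin n → SO3 ⧸ K) × (Fin n → SO3 ⧸ K) =>
        f ε p * ∏ i, regDensity K t A (ε ^ 2)⁻¹ (p.1 i) (p.2 i)) (ν.prod π) := by
      refine Integrable.bdd_mul (c := M) ?_ (hf ε).aestronglyMeasurable
        (ae_of_all _ fun p => hM ε p)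
      exact (hcont _).integrable_of_hasCompactSupport (HasCompactSupport.of_compactSpace _)
    rw [← integral_prod (fun p => f ε p * ∏ i, regDensity K t A (ε ^ 2)⁻¹ (p.1 i) (p.2 i)) hint,
      regressionLaw, integral_withDensity_eq_integral_toReal_smul
      (hcont _).measurable.ennreal_ofReal (ae_of_all _ fun z => ENNReal.ofReal_lt_top)]
    refine integral_congr_ae (ae_of_all _ fun p => ?_)
    simp only
    rw [ENNReal.toReal_ofReal (hpos _ _ _), smul_eq_mul, mul_comm]
  have e2 : c = ∫ _u, c ∂ν := by simp
  rw [e2]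
  simp_rw [e1]
  -- Dominated convergence in `u`: the conditional expectations are bounded by `M`, and each tends
  -- to the same `c`. The limit function `g` may depend on `U`, but its Gaussian integral may not.
  refine tendsto_integral_filter_of_dominated_convergence (fun _ => M) ?_ ?_ (integrable_const _) ?_
  · refine Eventually.of_forall fun ε => ?_
    have h1 : StronglyMeasurable fun p : (Fin n → SO3 ⧸ K) × (Fin n → SO3 ⧸ K) =>
        f ε p * ∏ i, regDensity K t A (ε ^ 2)⁻¹ (p.1 i) (p.2 i) :=
      ((hf ε).mul (hcont _).measurable).stronglyMeasurable
    exact h1.integral_prod_right.aestronglyMeasurable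
  · filter_upwards [self_mem_nhdsWithin] with ε hε
    refine ae_of_all _ fun u => ?_
    choose U hU using fun i => QuotientGroup.mk_surjective (s := K) (u i)
    have hu : u = fun i => rotClass K (U i) := funext fun i => (hU i).symm
    have h1 := ch.integral_prod_regDensity ht A U hε
    have hc : Continuous fun v : Fin n → SO3 ⧸ K =>
        ∏ i, regDensity K t A (ε ^ 2)⁻¹ (u i) (v i) :=
      (hcont _).comp (f := fun v => (u, v)) (by fun_prop)
    calc ‖∫ v, f ε (u, v) * ∏ i, regDensity K t A (ε ^ 2)⁻¹ (u i) (v i) ∂π‖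
        ≤ ∫ v, M * ∏ i, regDensity K t A (ε ^ 2)⁻¹ (u i) (v i) ∂π := by
          refine norm_integral_le_of_norm_le ?_ (ae_of_all _ fun v => ?_)
          · exact (hc.integrable_of_hasCompactSupport (HasCompactSupport.of_compactSpace _)).const_mul _
          · rw [norm_mul, Real.norm_of_nonneg (hpos _ u v)]
            exact mul_le_mul_of_nonneg_right (hM ε _) (hpos _ u v)
      _ = M := by rw [integral_const_mul, hu, h1, mul_one]
  · refine ae_of_all _ fun u => ?_
    choose U hU using fun i => QuotientGroup.mk_surjective (s := K) (u i)
    have hu : u = fun i => rotClass K (U i) := funext fun i => (hU i).symm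
    obtain ⟨g, hg, hgc⟩ := hlim U
    rw [← hgc, hu]
    exact ch.tendsto_integral_mul_regDensity ht A U
      (f := fun ε v => f ε ((fun i => rotClass K (U i)), v))
      (fun ε => (hf ε).comp (by fun_prop)) (fun ε v => hM ε _) hg

end Limit

/-! ### From the statistics of the model to chi-squared limits. -/

section Statistics

variable {E : Type*} [NormedAddCommGroup E] [InnerProductSpace ℝ E] {K : Subgroup SO3}
  {act : SO3 →* (E ≃ₗᵢ[ℝ] E)} {t : SO3 ⧸ K → E} {n : ℕ}

lemma fitInner_eq (ht : IsEquivariantEmbedding K act t) (B U V : SO3) :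
    fitInner K t B U V = inner ℝ (t (rotClass K V)) (t (rotClass K (B * U))) := by
  have h1 : t (rotClass K 1) = act V⁻¹ (t (rotClass K V)) := by
    rw [← ht.apply_mul, inv_mul_cancel]
  rw [fitInner, mul_assoc, ht.apply_mul, h1, LinearIsometryEquiv.inner_map_map]

lemma residualSum_eq_halfRss (ht : IsEquivariantEmbedding K act t) (U V : Fin n → SO3) (B : SO3) :
    residualSum K t U V B =
      halfRss t (fun i => rotClass K (U i)) (fun i => rotClass K (V i)) B := by
  rw [residualSum, halfRss, Finset.sum_div]
  refine Finset.sum_congr rfl fun i _ => ?_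
  rw [fitInner_eq ht, ht.inner_apply, sub_sub_cancel]
  rfl

lemma residualSum_eq_sub_sum_inner (ht : IsEquivariantEmbedding K act t) (U V : Fin n → SO3)
    (B : SO3) : residualSum K t U V B = n * ‖t (rotClass K 1)‖ ^ 2 -
      ∑ i, inner ℝ (t (rotClass K (V i))) (t (rotClass K (B * U i))) := by
  simp_rw [residualSum, fitInner_eq ht]
  rw [Finset.sum_sub_distrib, Finset.sum_const, Finset.card_univ, Fintype.card_fin, nsmul_eq_mul]

lemma IsRotationMLE.residualSum_le (ht : IsEquivariantEmbedding K act t) {U V : Fin n → SO3}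
    {B : SO3} (hB : IsRotationMLE K t U V B) (B' : SO3) :
    residualSum K t U V B ≤ residualSum K t U V B' := by
  rw [residualSum_eq_sub_sum_inner ht, residualSum_eq_sub_sum_inner ht]
  exact sub_le_sub_left (hB B') _

lemma IsRotationMLE.residualSum_eq_minRss (ht : IsEquivariantEmbedding K act t) {U V : Fin n → SO3}
    {B : SO3} (hB : IsRotationMLE K t U V B) :
    residualSum K t U V B = minRss t (fun i => rotClass K (U i)) (fun i => rotClass K (V i)) := by
  refine le_antisymm (le_ciInf fun B' => ?_) ?_
  · rw [← residualSum_eq_halfRss ht]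
    exact hB.residualSum_le ht B'
  · rw [residualSum_eq_halfRss ht]
    exact minRss_le _ _ _

lemma fitGain_eq_sub (U V : Fin n → SO3) (B B' : SO3) :
    fitGain K t U V B B' = residualSum K t U V B' - residualSum K t U V B := by
  rw [fitGain, residualSum, residualSum, ← Finset.sum_sub_distrib]
  exact Finset.sum_congr rfl fun i _ => by ring

lemma RotChart.finrank_range_design (ch : RotChart K t) (U : Fin n → SO3) (hn : 0 < n) :
    Module.finrank ℝ (LinearMap.range (ch.design U)) = 3 := by
  rw [LinearMap.finrank_range_of_inj (ch.design_injective U hn), finrank_euclideanSpace_fin]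

lemma RotChart.finrank_range_design_orthogonal (ch : RotChart K t) (U : Fin n → SO3) (hn : 0 < n) :
    Module.finrank ℝ (LinearMap.range (ch.design U))ᗮ = 3 * (n - 1) := by
  have h := (LinearMap.range (ch.design U)).finrank_add_finrank_orthogonal
  have h2 : Module.finrank ℝ (PiLp 2 fun _ : Fin n => EuclideanSpace ℝ (Fin 3)) = n * 3 := by
    rw [(WithLp.linearEquiv 2 ℝ _).finrank_eq, Module.finrank_pi_fintype]; simp
  rw [ch.finrank_range_design U hn, h2] at h
  omega

/-- The residual sums of squares of the best and of the correct rotation have asymptotically the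
distribution of the squared norms of two orthogonal projections of a normal vector. -/
lemma tendsto_integral_rss [Finite K] (ht : IsEquivariantEmbedding K act t) (hn : 0 < n) (A : SO3)
    (ν : Measure (Fin n → SO3 ⧸ K)) [IsProbabilityMeasure ν]
    (φ : BoundedContinuousFunction (ℝ × ℝ) ℝ) :
    Tendsto (fun ε => ∫ p, φ (2 * (ε ^ 2)⁻¹ * minRss t p.1 p.2,
        2 * (ε ^ 2)⁻¹ * (halfRss t p.1 p.2 A - minRss t p.1 p.2))
          ∂(regressionLaw K t A (ε ^ 2)⁻¹ ν)) (𝓝[>] 0)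
      (𝓝 (∫ x, φ x ∂((chiSq (3 * (n - 1))).prod (chiSq 3)))) := by
  obtain ⟨ch⟩ := ht.nonempty_rotChart
  have hmin := measurable_minRss (n := n) ht.continuous
  have hhalf : Measurable fun p : (Fin n → SO3 ⧸ K) × (Fin n → SO3 ⧸ K) => halfRss t p.1 p.2 A :=
    ((continuous_halfRss ht.continuous).comp (f := fun p => (p, A)) (by fun_prop)).measurable
  refine ch.tendsto_integral_regressionLaw ht A ν (M := ‖φ‖)
    (f := fun ε p => φ (2 * (ε ^ 2)⁻¹ * minRss t p.1 p.2,
        2 * (ε ^ 2)⁻¹ * (halfRss t p.1 p.2 A - minRss t p.1 p.2)))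
    (fun ε => φ.continuous.measurable.comp
      ((hmin.const_mul _).prodMk ((hhalf.sub hmin).const_mul _)))
    (fun ε p => φ.norm_coe_le_norm _) fun U => ?_
  set L := LinearMap.range (ch.design U) with hL
  refine ⟨fun z => φ (‖Lᗮ.orthogonalProjectionOnto (WithLp.toLp 2 z)‖ ^ 2,
    ‖L.orthogonalProjectionOnto (WithLp.toLp 2 z)‖ ^ 2), fun z => ?_, ?_⟩
  · have h1 := ch.tendsto_minRss ht hn A U z
    have h2 := ch.tendsto_halfRss_self ht A U z
    have h3 : ‖L.orthogonalProjectionOnto (WithLp.toLp 2 z)‖ ^ 2 = ‖WithLp.toLp 2 z‖ ^ 2 -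
        ‖Lᗮ.orthogonalProjectionOnto (WithLp.toLp 2 z)‖ ^ 2 := by
      rw [Submodule.norm_sq_eq_add_norm_sq_projection (WithLp.toLp 2 z) L, add_sub_cancel_right]
    simp only [h3]
    refine (φ.continuous.tendsto _).comp ((h1.prodMk_nhds (h2.sub h1)).congr fun ε => ?_)
    rw [mul_sub]
  -- The subspace `L` varies with `U`, but its dimension is always `3`, and Cochran's theorem sees
  -- only dimensions.
  · have h := stdGaussian_map_norm_sq_projections L
    rw [hL, ch.finrank_range_design_orthogonal U hn, ch.finrank_range_design U hn, ← hL] at h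
    have hm : Measurable fun x : PiLp 2 (fun _ : Fin n => EuclideanSpace ℝ (Fin 3)) =>
        (‖Lᗮ.orthogonalProjectionOnto x‖ ^ 2, ‖L.orthogonalProjectionOnto x‖ ^ 2) := by fun_prop
    have hm2 : Measurable (WithLp.toLp 2 : (Fin n → EuclideanSpace ℝ (Fin 3)) →
        PiLp 2 fun _ : Fin n => EuclideanSpace ℝ (Fin 3)) := by fun_prop
    rw [← h, integral_map hm.aemeasurable φ.continuous.aestronglyMeasurable,
      stdGaussian_piLp (ι := Fin n) (F := EuclideanSpace ℝ (Fin 3))]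
    exact (integral_map hm2.aemeasurable
      (φ.continuous.measurable.comp hm).aestronglyMeasurable).symm

end Statistics

section Convergence

variable {E : Type*} [NormedAddCommGroup E] [InnerProductSpace ℝ E] {K : Subgroup SO3} [Finite K]
  {act : SO3 →* (E ≃ₗᵢ[ℝ] E)} {t : SO3 ⧸ K → E} {n : ℕ} {A : SO3}
  {Ω : Ioi (0 : ℝ) → Type*} [∀ κ, MeasurableSpace (Ω κ)] {P : ∀ κ, Measure (Ω κ)}
  [∀ κ, IsProbabilityMeasure (P κ)] {ν : Measure (Fin n → SO3 ⧸ K)} [IsProbabilityMeasure ν]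
  {U V : ∀ κ, Fin n → Ω κ → SO3} {Ahat : ∀ κ, Ω κ → SO3}

lemma tendsto_inv_sqrt_atTop :
    Tendsto (fun κ : Ioi (0 : ℝ) => (Real.sqrt κ)⁻¹) atTop (𝓝[>] 0) := by
  have h : Tendsto (fun κ : Ioi (0 : ℝ) => (κ : ℝ)) atTop atTop :=
    tendsto_comp_val_Ioi_atTop.2 tendsto_id
  exact tendsto_inv_atTop_nhdsGT_zero.comp (Real.tendsto_sqrt_atTop.comp h)

/-- Both coordinates are functions of `minRss` and of `halfRss` at `A`, so `tendsto_integral_rss`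
applies with `ε = κ^(-1/2)`. The remaining limits of part (i) are continuous images of this joint
one. -/
lemma tendstoInDistribution_residualSum_fitGain (ht : IsEquivariantEmbedding K act t) (hn : 0 < n)
    (hUV : ∀ κ : Ioi (0 : ℝ), IsRegressionSample K t A (κ : ℝ) ν (P κ) (U κ) (V κ))
    (hAhat : ∀ κ ω, IsRotationMLE K t (fun i => U κ i ω) (fun i => V κ i ω) (Ahat κ ω)) :
    TendstoInDistribution
      (fun (κ : Ioi (0 : ℝ)) ω =>
        (2 * (κ : ℝ) * residualSum K t (fun i => U κ i ω) (fun i => V κ i ω) (Ahat κ ω),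
          2 * (κ : ℝ) * fitGain K t (fun i => U κ i ω) (fun i => V κ i ω) (Ahat κ ω) A))
      atTop id P ((chiSq (3 * (n - 1))).prod (chiSq 3)) := by
  set Y : ∀ κ : Ioi (0 : ℝ), Ω κ → (Fin n → SO3 ⧸ K) × (Fin n → SO3 ⧸ K) := fun κ ω =>
    ((fun i => rotClass K (U κ i ω)), (fun i => rotClass K (V κ i ω))) with hY
  set s : ℝ → (Fin n → SO3 ⧸ K) × (Fin n → SO3 ⧸ K) → ℝ × ℝ := fun κ p =>
    (2 * κ * minRss t p.1 p.2, 2 * κ * (halfRss t p.1 p.2 A - minRss t p.1 p.2)) with hs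
  have hYm : ∀ κ, Measurable (Y κ) := fun κ =>
    (measurable_pi_lambda _ fun i => (measurable_rotClass K).comp
      ((hUV κ).measurable_left i)).prodMk (measurable_pi_lambda _ fun i =>
      (measurable_rotClass K).comp ((hUV κ).measurable_right i))
  have hmin := measurable_minRss (n := n) ht.continuous
  have hhalf : Measurable fun p : (Fin n → SO3 ⧸ K) × (Fin n → SO3 ⧸ K) => halfRss t p.1 p.2 A :=
    ((continuous_halfRss ht.continuous).comp (f := fun p => (p, A)) (by fun_prop)).measurable
  have hsm : ∀ κ, Measurable (s κ) := fun κ =>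
    (hmin.const_mul _).prodMk ((hhalf.sub hmin).const_mul _)
  have heq : ∀ κ : Ioi (0 : ℝ), (fun ω : Ω κ =>
      (2 * (κ : ℝ) * residualSum K t (fun i => U κ i ω) (fun i => V κ i ω) (Ahat κ ω),
        2 * (κ : ℝ) * fitGain K t (fun i => U κ i ω) (fun i => V κ i ω) (Ahat κ ω) A)) =
      s κ ∘ Y κ := by
    intro κ
    ext ω
    · simp only [(hAhat κ ω).residualSum_eq_minRss ht]; rfl
    · simp only [fitGain_eq_sub, (hAhat κ ω).residualSum_eq_minRss ht, residualSum_eq_halfRss ht]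
      rfl
  refine ⟨fun κ => ?_, aemeasurable_id, ?_⟩
  · rw [heq]; exact ((hsm κ).comp (hYm κ)).aemeasurable
  refine ProbabilityMeasure.tendsto_iff_forall_integral_tendsto.2 fun φ => ?_
  simp only [ProbabilityMeasure.coe_mk, Measure.map_id]
  refine ((tendsto_integral_rss ht hn A ν φ).comp tendsto_inv_sqrt_atTop).congr fun κ => ?_
  have hκ : (((Real.sqrt κ)⁻¹) ^ 2)⁻¹ = (κ : ℝ) := by
    rw [inv_pow, inv_inv, Real.sq_sqrt (le_of_lt κ.2)]
  simp only [Function.comp_apply, hκ]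
  rw [heq, ← Measure.map_map (hsm κ) (hYm κ), (hUV κ).law,
    integral_map (hsm κ).aemeasurable φ.continuous.aestronglyMeasurable]

lemma MeasureTheory.TendstoInDistribution.tendsto_id_of_map_eq {ι F G : Type*} {Ω : ι → Type*}
    [∀ i, MeasurableSpace (Ω i)] {μ : ∀ i, Measure (Ω i)} [∀ i, IsProbabilityMeasure (μ i)]
    [TopologicalSpace F] [MeasurableSpace F] [OpensMeasurableSpace F] [TopologicalSpace G]
    [MeasurableSpace G] [BorelSpace G] {l : Filter ι} {X : ∀ i, Ω i → F} {μ₁ : Measure F}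
    [IsProbabilityMeasure μ₁] {μ₂ : Measure G} [IsProbabilityMeasure μ₂]
    (h : TendstoInDistribution X l id μ μ₁) {g : F → G} (hg : Continuous g)
    (hμ : μ₁.map g = μ₂) : TendstoInDistribution (fun i ω => g (X i ω)) l id μ μ₂ := by
  have h1 := h.continuous_comp hg
  refine ⟨h1.forall_aemeasurable, aemeasurable_id, ?_⟩
  exact h1.tendsto.mono_right (le_of_eq (congrArg 𝓝 (Subtype.ext (by
    simp only [Function.comp_id, Measure.map_id, hμ]))))

lemma tendstoInDistribution_residualSum_mle (ht : IsEquivariantEmbedding K act t) (hn : 0 < n)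
    (hUV : ∀ κ : Ioi (0 : ℝ), IsRegressionSample K t A (κ : ℝ) ν (P κ) (U κ) (V κ))
    (hAhat : ∀ κ ω, IsRotationMLE K t (fun i => U κ i ω) (fun i => V κ i ω) (Ahat κ ω)) :
    TendstoInDistribution
      (fun (κ : Ioi (0 : ℝ)) ω =>
        2 * (κ : ℝ) * residualSum K t (fun i => U κ i ω) (fun i => V κ i ω) (Ahat κ ω))
      atTop id P (chiSq (3 * (n - 1))) :=
  TendstoInDistribution.tendsto_id_of_map_eq
    (tendstoInDistribution_residualSum_fitGain ht hn hUV hAhat) continuous_fst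
    (by rw [← Measure.fst, Measure.fst_prod])

lemma tendstoInDistribution_fitGain (ht : IsEquivariantEmbedding K act t) (hn : 0 < n)
    (hUV : ∀ κ : Ioi (0 : ℝ), IsRegressionSample K t A (κ : ℝ) ν (P κ) (U κ) (V κ))
    (hAhat : ∀ κ ω, IsRotationMLE K t (fun i => U κ i ω) (fun i => V κ i ω) (Ahat κ ω)) :
    TendstoInDistribution
      (fun (κ : Ioi (0 : ℝ)) ω =>
        2 * (κ : ℝ) * fitGain K t (fun i => U κ i ω) (fun i => V κ i ω) (Ahat κ ω) A)
      atTop id P (chiSq 3) :=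
  TendstoInDistribution.tendsto_id_of_map_eq
    (tendstoInDistribution_residualSum_fitGain ht hn hUV hAhat) continuous_snd
    (by rw [← Measure.snd, Measure.snd_prod])

lemma tendstoInDistribution_residualSum (ht : IsEquivariantEmbedding K act t) (hn : 0 < n)
    (hUV : ∀ κ : Ioi (0 : ℝ), IsRegressionSample K t A (κ : ℝ) ν (P κ) (U κ) (V κ))
    (hAhat : ∀ κ ω, IsRotationMLE K t (fun i => U κ i ω) (fun i => V κ i ω) (Ahat κ ω)) :
    TendstoInDistribution
      (fun (κ : Ioi (0 : ℝ)) ω =>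
        2 * (κ : ℝ) * residualSum K t (fun i => U κ i ω) (fun i => V κ i ω) A)
      atTop id P (chiSq (3 * n)) := by
  have h := TendstoInDistribution.tendsto_id_of_map_eq (μ₂ := chiSq (3 * n))
    (tendstoInDistribution_residualSum_fitGain ht hn hUV hAhat)
    (g := fun p : ℝ × ℝ => p.1 + p.2) (by fun_prop)
    (by rw [chiSq_prod_map_add, show 3 * (n - 1) + 3 = 3 * n by omega])
  -- `S(A) = S(Â) + D(A)`.
  refine h.congr (fun κ => ae_of_all _ fun ω => ?_) (ae_of_all _ fun _ => rfl)
  simp only [fitGain_eq_sub]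
  ring

end Convergence

/-! ### Quantiles and coverage probabilities. -/

lemma continuous_measureReal_Iio (μ : Measure ℝ) [IsProbabilityMeasure μ] [NullSingletonClass μ] :
    Continuous fun x => μ.real (Iio x) := by
  rw [continuous_iff_continuousAt]
  intro b
  have h0 : Tendsto (fun x => μ.real (Icc (b - |x - b|) (b + |x - b|))) (𝓝 b) (𝓝 0) := by
    have h1 : Tendsto (fun x : ℝ => |x - b|) (𝓝 b) (𝓝 0) := by
      have : Continuous fun x : ℝ => |x - b| := by fun_prop
      simpa using this.tendsto b
    exact (ENNReal.tendsto_toReal ENNReal.zero_ne_top).comp ((tendsto_measure_Icc μ b).comp h1)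
  rw [ContinuousAt, tendsto_iff_dist_tendsto_zero]
  refine squeeze_zero (fun _ => dist_nonneg) (fun x => ?_) h0
  have key : ∀ c d : ℝ, μ.real (Iio d) ≤ μ.real (Iio c) + μ.real (Icc c d) := fun c d =>
    (measureReal_mono (fun y (hy : y < d) => (lt_or_ge y c).imp id fun h => ⟨h, hy.le⟩)).trans
      (measureReal_union_le _ _)
  have h1 : μ.real (Icc b x) ≤ μ.real (Icc (b - |x - b|) (b + |x - b|)) :=
    measureReal_mono (Icc_subset_Icc (by linarith [abs_nonneg (x - b)])
      (by linarith [le_abs_self (x - b)]))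
  have h2 : μ.real (Icc x b) ≤ μ.real (Icc (b - |x - b|) (b + |x - b|)) :=
    measureReal_mono (Icc_subset_Icc (by linarith [neg_abs_le (x - b)])
      (by linarith [abs_nonneg (x - b)]))
  rw [Real.dist_eq, abs_le]
  constructor <;> linarith [key b x, key x b]

/-- The distribution function is continuous, so the infimum defining the quantile is attained, and
smaller values fall short of `1 - α`; the strict inequality in the region costs nothing. -/
lemma chiSq_three_real_Iio_chiSqUpper {α : ℝ} (h0 : 0 < α) (h1 : α < 1) :
    (chiSq 3).real (Iio (chiSqUpper 3 α)) = 1 - α := by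
  set F : ℝ → ℝ := fun x => (chiSq 3).real (Iio x) with hF
  have hc : Continuous F := continuous_measureReal_Iio _
  have hIoi : ∀ c, (chiSq 3).real (Ioi c) = 1 - F c := fun c => by
    have h := probReal_compl_eq_one_sub (μ := chiSq 3) (measurableSet_Iic (a := c))
    rw [compl_Iic, measureReal_congr (Iio_ae_eq_Iic (μ := chiSq 3) (a := c)).symm] at h
    exact h
  have htop : Tendsto F atTop (𝓝 1) := by
    refine (tendsto_cdf_atTop (chiSq 3)).congr fun x => ?_
    rw [cdf_eq_real]
    exact (measureReal_congr (Iio_ae_eq_Iic (μ := chiSq 3) (a := x))).symm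
  have hset : {c : ℝ | (chiSq 3).real (Ioi c) ≤ α} = {c | 1 - α ≤ F c} := by
    ext c; simp only [mem_ofPred_eq, hIoi]; constructor <;> intro h <;> linarith
  have hne : {c | 1 - α ≤ F c}.Nonempty :=
    (htop.eventually (eventually_ge_nhds (by linarith : 1 - α < 1))).exists
  have hbdd : BddBelow {c | 1 - α ≤ F c} := by
    refine ⟨0, fun c (hc : 1 - α ≤ F c) => ?_⟩
    by_contra! hlt
    have : F c = 0 := by
      have h2 : chiSq 3 (Iio c) = 0 := measure_mono_null (Iio_subset_Iio hlt.le) (chiSq_Iio_zero 3)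
      simp [hF, measureReal_def, h2]
    linarith
  have hq : chiSqUpper 3 α = sInf {c | 1 - α ≤ F c} := by rw [chiSqUpper, hset]
  set q := chiSqUpper 3 α
  refine le_antisymm ?_ ?_
  · change F q ≤ 1 - α
    refine le_of_tendsto (hc.continuousWithinAt (s := Iio q) (x := q)) ?_
    filter_upwards [self_mem_nhdsWithin] with c hcq
    have := notMem_of_lt_csInf (hq ▸ hcq : c < sInf _) hbdd
    exact (not_le.1 this).le
  · change q ∈ {c | 1 - α ≤ F c}
    rw [hq]
    exact (isClosed_le continuous_const hc).csInf_mem hne hbdd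

lemma MeasureTheory.TendstoInDistribution.tendsto_measureReal {ι F : Type*} {Ω : ι → Type*}
    [∀ i, MeasurableSpace (Ω i)] {μ : ∀ i, Measure (Ω i)} [∀ i, IsProbabilityMeasure (μ i)]
    [PseudoEMetricSpace F] [MeasurableSpace F] [BorelSpace F] {l : Filter ι}
    {X : ∀ i, Ω i → F} {ν : Measure F} [IsProbabilityMeasure ν]
    (h : TendstoInDistribution X l id μ ν) {s : Set F} (hs : MeasurableSet s)
    (hfr : ν (frontier s) = 0) :
    Tendsto (fun i => (μ i).real {ω | X i ω ∈ s}) l (𝓝 (ν.real s)) := by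
  have h1 := ProbabilityMeasure.tendsto_measure_of_null_frontier_of_tendsto' h.tendsto (E := s)
    (by simpa [Measure.map_id] using hfr)
  simp only [ProbabilityMeasure.coe_mk, Measure.map_id] at h1
  refine ((ENNReal.tendsto_toReal (measure_ne_top _ _)).comp h1).congr fun i => ?_
  rw [Function.comp_apply, Measure.map_apply_of_aemeasurable (h.forall_aemeasurable i) hs]
  rfl

/-- A limiting `chiSq 3` law yields asymptotically correct coverage, even when the statistic is
rescaled by a random factor close to one. -/
lemma exists_coverage_tolerance {α ε : ℝ} (h0 : 0 < α) (h1 : α < 1) (hε : 0 < ε) :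
    ∃ δ : ℝ, 0 < δ ∧ ∀ {ι : Type*} {Ω : ι → Type*} [∀ i, MeasurableSpace (Ω i)]
      {μ : ∀ i, Measure (Ω i)} [∀ i, IsProbabilityMeasure (μ i)] {l : Filter ι}
      {D ρ : ∀ i, Ω i → ℝ}, TendstoInDistribution D l id μ (chiSq 3) → (∀ i ω, 0 ≤ D i ω) →
      (∀ᶠ i in l, (μ i).real {ω | δ ≤ |ρ i ω - 1|} < ε / 2) →
      ∀ᶠ i in l, |(μ i).real {ω | ρ i ω * D i ω < chiSqUpper 3 α} - (1 - α)| < ε := by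
  set q := chiSqUpper 3 α with hq
  set F : ℝ → ℝ := fun x => (chiSq 3).real (Iio x) with hF
  have hFq : F q = 1 - α := chiSq_three_real_Iio_chiSqUpper h0 h1
  have hc : Continuous F := continuous_measureReal_Iio _
  have hplus : Tendsto (fun δ : ℝ => F (q / (1 + δ))) (𝓝 0) (𝓝 (1 - α)) := by
    have h : Tendsto (fun δ : ℝ => q / (1 + δ)) (𝓝 0) (𝓝 (q / (1 + 0))) :=
      tendsto_const_nhds.div (tendsto_const_nhds.add tendsto_id) (by norm_num)
    rw [add_zero, div_one] at h
    rw [← hFq]; exact (hc.tendsto q).comp h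
  have hminus : Tendsto (fun δ : ℝ => F (q / (1 - δ))) (𝓝 0) (𝓝 (1 - α)) := by
    have h : Tendsto (fun δ : ℝ => q / (1 - δ)) (𝓝 0) (𝓝 (q / (1 - 0))) :=
      tendsto_const_nhds.div (tendsto_const_nhds.sub tendsto_id) (by norm_num)
    rw [sub_zero, div_one] at h
    rw [← hFq]; exact (hc.tendsto q).comp h
  have hev : ∀ᶠ δ : ℝ in 𝓝[>] 0, 0 < δ ∧ δ < 1 ∧ 1 - α - ε / 2 < F (q / (1 + δ)) ∧
      F (q / (1 - δ)) < 1 - α + ε / 2 := by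
    filter_upwards [self_mem_nhdsWithin, nhdsWithin_le_nhds (eventually_lt_nhds one_pos),
      nhdsWithin_le_nhds (hplus.eventually (eventually_gt_nhds (by linarith : 1 - α - ε / 2 < 1 - α))),
      nhdsWithin_le_nhds (hminus.eventually (eventually_lt_nhds (by linarith : 1 - α < 1 - α + ε / 2)))] with δ a b c d
    exact ⟨a, b, c, d⟩
  -- Outside the event `δ ≤ |ρ - 1|`, `D < q / (1 + δ)` implies `ρ D < q`, which implies `D < q / (1
  -- - δ)`, because `D ≥ 0`. The tolerance `δ` depends only on `α` and `ε`, so the sample size may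
  -- be chosen after it.
  obtain ⟨δ, hδ0, hδ1, hp, hm⟩ := hev.exists
  refine ⟨δ, hδ0, fun {ι Ω _ μ _ l D ρ} hD hDnn hbad => ?_⟩
  have hlim : ∀ x, Tendsto (fun i => (μ i).real {ω | D i ω ∈ Iio x}) l (𝓝 (F x)) := fun x =>
    hD.tendsto_measureReal measurableSet_Iio (by rw [frontier_Iio]; exact measure_singleton x)
  filter_upwards [hbad, (hlim (q / (1 + δ))).eventually (eventually_gt_nhds hp),
    (hlim (q / (1 - δ))).eventually (eventually_lt_nhds hm)] with i hb hlo hhi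
  have e1 : (μ i).real {ω | D i ω ∈ Iio (q / (1 + δ))} ≤
      (μ i).real {ω | ρ i ω * D i ω < q} + (μ i).real {ω | δ ≤ |ρ i ω - 1|} := by
    refine (measureReal_mono fun ω hω => ?_).trans (measureReal_union_le _ _)
    refine (lt_or_ge |ρ i ω - 1| δ).imp (fun h => ?_) id
    have h2 : D i ω * (1 + δ) < q := (lt_div_iff₀ (by linarith)).1 hω
    have h3 : ρ i ω ≤ 1 + δ := by linarith [(abs_lt.1 h).2]
    have := mul_le_mul_of_nonneg_right h3 (hDnn i ω)
    simp only [mem_ofPred_eq]; linarith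
  have e2 : (μ i).real {ω | ρ i ω * D i ω < q} ≤
      (μ i).real {ω | D i ω ∈ Iio (q / (1 - δ))} + (μ i).real {ω | δ ≤ |ρ i ω - 1|} := by
    refine (measureReal_mono fun ω hω => ?_).trans (measureReal_union_le _ _)
    refine (lt_or_ge |ρ i ω - 1| δ).imp (fun h => ?_) id
    have h2 : ρ i ω * D i ω < q := hω
    have h3 : 1 - δ ≤ ρ i ω := by linarith [(abs_lt.1 h).1]
    have := mul_le_mul_of_nonneg_right h3 (hDnn i ω)
    change D i ω < q / (1 - δ)
    rw [lt_div_iff₀ (by linarith)]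
    linarith
  rw [abs_lt]
  constructor <;> linarith

/-! ### Minimizers of the profile `G k * exp (k r)`. -/

section Profile

/-- A quantitative form of `x < exp (x - 1)` away from `x = 1`: `exp (x - 1) ≥ ((1 + x) / 2)² = x +
(x - 1)² / 4`, and `(x - 1)² (1 + δ) ≥ δ² x` when `|x - 1| ≥ δ`. -/
lemma mul_le_exp_sub_one {x δ : ℝ} (hx : 0 < x) (hδ : 0 < δ) (h : δ ≤ |x - 1|) :
    x * (1 + δ ^ 2 / (4 * (1 + δ))) ≤ Real.exp (x - 1) := by
  have h1 : ((1 + x) / 2) ^ 2 ≤ Real.exp (x - 1) := by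
    have h2 : (1 + x) / 2 ≤ Real.exp ((x - 1) / 2) := by
      linarith [Real.add_one_le_exp ((x - 1) / 2)]
    calc ((1 + x) / 2) ^ 2 ≤ Real.exp ((x - 1) / 2) ^ 2 := pow_le_pow_left₀ (by linarith) h2 2
      _ = Real.exp (x - 1) := by rw [← Real.exp_nat_mul]; congr 1; push_cast; ring
  refine le_trans ?_ h1
  have h2 : δ ^ 2 * x ≤ (x - 1) ^ 2 * (1 + δ) := by
    rcases le_abs.1 h with h | h
    · nlinarith [mul_nonneg hδ.le (mul_nonneg (by linarith : 0 ≤ x - 1) (by linarith : 0 ≤ x - 1 - δ))]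
    · nlinarith [mul_self_nonneg (x - 1), mul_pos hδ hδ]
  have h3 : x * (δ ^ 2 / (4 * (1 + δ))) ≤ (x - 1) ^ 2 / 4 := by
    rw [← mul_div_assoc, div_le_div_iff₀ (by positivity) (by norm_num)]
    linarith
  linarith

variable {G : ℝ → ℝ} {C δ : ℝ}

/-- If `G k` decays like a multiple of `k ^ (-3/2)`, the minimizers of `G k * exp (k * r)` are close
to `3 / (2 * r)` for small `r`. -/
lemma exists_lt_mul_exp (hC : 0 < C) (hpos : ∀ k, 0 < k → 0 < G k) (hanti : AntitoneOn G (Ioi 0))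
    (hlim : Tendsto (fun k => k ^ 3 * G k ^ 2) atTop (𝓝 C)) (hδ : 0 < δ) :
    ∃ r₀ : ℝ, 0 < r₀ ∧ ∀ r, 0 < r → r < r₀ → ∀ k, 0 < k → δ ≤ |2 * k * r / 3 - 1| →
      G (3 / (2 * r)) * Real.exp (3 / (2 * r) * r) < G k * Real.exp (k * r) := by
  -- `c` is the relative gain of `mul_le_exp_sub_one`. The asymptotics of `G` are used to within a
  -- factor `1 + c` at both `k₀` and `k`; the cube of the gain more than compensates.
  set c := δ ^ 2 / (4 * (1 + δ)) with hc
  have hc0 : 0 < c := by positivity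
  have hlo : C / (1 + c) < C := (div_lt_self hC (by linarith))
  have hhi : C < C * (1 + c) := by nlinarith
  obtain ⟨M₀, hM₀⟩ := eventually_atTop.1 ((hlim.eventually (eventually_gt_nhds hlo)).and
    (hlim.eventually (eventually_lt_nhds hhi)))
  set M := max M₀ 1 with hM
  have hM1 : 1 ≤ M := le_max_right _ _
  have hGM := hpos M (by linarith)
  -- `k₀ ≥ T` serves the small `k < M`, where the asymptotics say nothing: there `G k ≥ G M`, while
  -- the value at `k₀` is `O(k₀^(-3/2))`.
  set T := max M (C * (1 + c) * Real.exp 3 / G M ^ 2) with hT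
  have hT1 : 1 ≤ T := hM1.trans (le_max_left _ _)
  refine ⟨3 / (2 * T), by positivity, fun r hr hrr k hk hkδ => ?_⟩
  set k₀ := 3 / (2 * r) with hk₀
  have hk₀r : k₀ * r = 3 / 2 := by rw [hk₀]; field_simp
  have hk₀T : T ≤ k₀ := by
    rw [lt_div_iff₀ (by positivity)] at hrr
    rw [hk₀, le_div_iff₀ (by positivity)]
    linarith
  have hk₀0 : 0 < k₀ := by positivity
  have hQ₀ : k₀ ^ 3 * G k₀ ^ 2 < C * (1 + c) :=
    (hM₀ k₀ ((le_max_left _ _).trans ((le_max_left _ _).trans hk₀T))).2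
  have hexp3 : Real.exp (3 / 2) ^ 2 = Real.exp 3 := by
    rw [← Real.exp_nat_mul]; norm_num
  -- Squaring replaces the exponent `3/2` by the integer `3`.
  refine lt_of_pow_lt_pow_left₀ 2 (by have := hpos k hk; positivity) ?_
  rw [mul_pow, mul_pow, hk₀r, hexp3]
  rw [← mul_lt_mul_iff_right₀ (pow_pos hk₀0 3)]
  have hL : k₀ ^ 3 * (G k₀ ^ 2 * Real.exp 3) < C * (1 + c) * Real.exp 3 := by
    rw [← mul_assoc]; exact mul_lt_mul_of_pos_right hQ₀ (Real.exp_pos _)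
  refine hL.trans_le ?_
  rcases le_or_gt M k with hMk | hMk
  · have hQ : C / (1 + c) < k ^ 3 * G k ^ 2 := (hM₀ k ((le_max_left _ _).trans hMk)).1
    have hx : 2 * k * r / 3 = k / k₀ := by rw [hk₀]; field_simp
    have he : (k / k₀ * (1 + c)) ^ 3 * Real.exp 3 ≤ Real.exp (k * r) ^ 2 := by
      have h := mul_le_exp_sub_one (x := k / k₀) (by positivity) hδ (hx ▸ hkδ)
      have h2 : Real.exp (k * r) ^ 2 = Real.exp (k / k₀ - 1) ^ 3 * Real.exp 3 := by
        rw [← Real.exp_nat_mul, ← Real.exp_nat_mul, ← Real.exp_add, ← hx]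
        congr 1; push_cast; ring
      rw [h2]
      exact mul_le_mul_of_nonneg_right (pow_le_pow_left₀ (by positivity) h 3) (Real.exp_nonneg _)
    calc C * (1 + c) * Real.exp 3
        ≤ C * (1 + c) ^ 2 * Real.exp 3 := by
          refine mul_le_mul_of_nonneg_right ?_ (Real.exp_nonneg _)
          nlinarith [mul_pos hC hc0]
      _ = C / (1 + c) * ((1 + c) ^ 3 * Real.exp 3) := by field_simp
      _ ≤ k ^ 3 * G k ^ 2 * ((1 + c) ^ 3 * Real.exp 3) :=
          mul_le_mul_of_nonneg_right hQ.le (by positivity)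
      _ = k₀ ^ 3 * (G k ^ 2 * ((k / k₀ * (1 + c)) ^ 3 * Real.exp 3)) := by field_simp
      _ ≤ k₀ ^ 3 * (G k ^ 2 * Real.exp (k * r) ^ 2) := by gcongr
  · have h1 : C * (1 + c) * Real.exp 3 ≤ k₀ * G M ^ 2 := by
      rw [← div_le_iff₀ (by positivity)]
      exact (le_max_right _ _).trans hk₀T
    have h2 : G M ≤ G k := hanti (mem_Ioi.2 hk) (mem_Ioi.2 (by linarith)) hMk.le
    have h3 : 1 ≤ Real.exp (k * r) := Real.one_le_exp (by positivity)
    have h4 : k₀ ≤ k₀ ^ 3 := le_self_pow₀ (hT1.trans hk₀T) (by norm_num)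
    calc C * (1 + c) * Real.exp 3 ≤ k₀ * G M ^ 2 := h1
      _ ≤ k₀ ^ 3 * G k ^ 2 := by gcongr
      _ ≤ k₀ ^ 3 * (G k ^ 2 * Real.exp (k * r) ^ 2) := by
        gcongr
        exact le_mul_of_one_le_right (sq_nonneg _) (one_le_pow₀ h3)

/-- A minimizer over the compact interval `[(1 - δ) k₀, (1 + δ) k₀]` is a global one, because by
`exists_lt_mul_exp` every `k` outside loses to `k₀` itself. -/
lemma exists_minimizer_mul_exp (hC : 0 < C) (hcont : Continuous G) (hpos : ∀ k, 0 < k → 0 < G k)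
    (hanti : AntitoneOn G (Ioi 0)) (hlim : Tendsto (fun k => k ^ 3 * G k ^ 2) atTop (𝓝 C))
    (hδ : 0 < δ) (hδ1 : δ < 1) :
    ∃ r₀ : ℝ, 0 < r₀ ∧ ∀ r, 0 < r → r < r₀ →
      (∃ k, 0 < k ∧ ∀ k', 0 < k' → G k * Real.exp (k * r) ≤ G k' * Real.exp (k' * r)) ∧
      ∀ k, 0 < k → (∀ k', 0 < k' → G k * Real.exp (k * r) ≤ G k' * Real.exp (k' * r)) →
        |2 * k * r / 3 - 1| < δ := by
  obtain ⟨r₀, hr₀, h⟩ := exists_lt_mul_exp hC hpos hanti hlim hδ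
  refine ⟨r₀, hr₀, fun r hr hrr => ⟨?_, fun k hk hmin => ?_⟩⟩
  · set k₀ := 3 / (2 * r) with hk₀
    have hk₀0 : 0 < k₀ := by positivity
    have hF : Continuous fun k => G k * Real.exp (k * r) := by fun_prop
    obtain ⟨k, hk, hmin⟩ := (isCompact_Icc (a := (1 - δ) * k₀) (b := (1 + δ) * k₀)).exists_isMinOn
      ⟨k₀, by constructor <;> nlinarith⟩ hF.continuousOn
    refine ⟨k, lt_of_lt_of_le (by nlinarith) hk.1, fun k' hk' => ?_⟩
    by_cases hk'm : k' ∈ Icc ((1 - δ) * k₀) ((1 + δ) * k₀)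
    · exact hmin hk'm
    · have h1 : G k * Real.exp (k * r) ≤ G k₀ * Real.exp (k₀ * r) :=
        hmin (by constructor <;> nlinarith : k₀ ∈ Icc ((1 - δ) * k₀) ((1 + δ) * k₀))
      refine h1.trans (h r hr hrr k' hk' ?_).le
      by_contra! hlt
      refine hk'm ?_
      have hx : 2 * k' * r / 3 = k' / k₀ := by rw [hk₀]; field_simp
      rw [hx, abs_lt] at hlt
      constructor
      · rw [← le_div_iff₀ hk₀0]; linarith
      · rw [← div_le_iff₀ hk₀0]; linarith
  · by_contra! hge
    exact (h r hr hrr k hk hge).not_ge (hmin _ (by positivity))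

end Profile

/-! ### The joint likelihood of the rotation and the concentration. -/

section Likelihood

variable {E : Type*} [NormedAddCommGroup E] [InnerProductSpace ℝ E] {K : Subgroup SO3} [Finite K]
  {act : SO3 →* (E ≃ₗᵢ[ℝ] E)} {t : SO3 ⧸ K → E} {n : ℕ}

/-- The normalizing constant of the density relative to its mode. -/
noncomputable def relConst (K : Subgroup SO3) (t : SO3 ⧸ K → E) (κ : ℝ) : ℝ :=
  Real.exp (-(κ * ‖t (rotClass K 1)‖ ^ 2)) * normConst K t κ

omit [Finite K] in
lemma relConst_eq_integral (ht : IsEquivariantEmbedding K act t) (κ : ℝ) :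
    relConst K t κ =
      ∫ x, Real.exp (-(κ * (‖t x - t (rotClass K 1)‖ ^ 2 / 2))) ∂(uniformRot K) := by
  rw [relConst, normConst, ← integral_const_mul]
  refine integral_congr_ae (ae_of_all _ fun x => ?_)
  simp only
  rw [← Real.exp_add, ht.inner_apply]
  congr 1
  ring

lemma relConst_pos (ht : IsEquivariantEmbedding K act t) (κ : ℝ) : 0 < relConst K t κ :=
  mul_pos (Real.exp_pos _) (RotChart.normConst_pos ht κ)

lemma continuous_relConst (ht : IsEquivariantEmbedding K act t) : Continuous (relConst K t) := by
  have hc := ht.continuous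
  have h : relConst K t = fun κ => ∫ x in univ,
      Real.exp (-(κ * (‖t x - t (rotClass K 1)‖ ^ 2 / 2))) ∂(uniformRot K) := by
    ext κ; rw [relConst_eq_integral ht, Measure.restrict_univ]
  rw [h]
  exact continuous_parametric_integral_of_continuous
    (f := fun κ x => Real.exp (-(κ * (‖t x - t (rotClass K 1)‖ ^ 2 / 2))))
    (by unfold Function.uncurry; fun_prop) isCompact_univ

lemma antitone_relConst (ht : IsEquivariantEmbedding K act t) : Antitone (relConst K t) := by
  have hc := ht.continuous
  intro a b hab
  rw [relConst_eq_integral ht, relConst_eq_integral ht]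
  have hint : ∀ κ : ℝ, Integrable
      (fun x => Real.exp (-(κ * (‖t x - t (rotClass K 1)‖ ^ 2 / 2)))) (uniformRot K) := fun κ =>
    Continuous.integrable_of_hasCompactSupport (by fun_prop) (HasCompactSupport.of_compactSpace _)
  refine integral_mono (hint b) (hint a) fun x => Real.exp_le_exp.2 (neg_le_neg ?_)
  gcongr

/-- Laplace's asymptotics in dimension three, `relConst κ ~ limMass * κ^(-3/2)`, in squared form. -/
lemma RotChart.tendsto_relConst (ch : RotChart K t) (ht : IsEquivariantEmbedding K act t) :
    Tendsto (fun κ => κ ^ 3 * relConst K t κ ^ 2) atTop (𝓝 (ch.limMass ^ 2)) := by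
  have h1 : Tendsto (fun κ : ℝ => (Real.sqrt κ)⁻¹) atTop (𝓝[>] 0) :=
    tendsto_inv_atTop_nhdsGT_zero.comp Real.tendsto_sqrt_atTop
  refine (((ch.tendsto_mass ht).comp h1).pow 2).congr' ?_
  filter_upwards [eventually_gt_atTop 0] with κ hκ
  have hs := Real.sqrt_pos.2 hκ
  have h2 := ch.normConst_eq ht (inv_pos.2 hs)
  have h3 : (((Real.sqrt κ)⁻¹) ^ 2)⁻¹ = κ := by rw [inv_pow, inv_inv, Real.sq_sqrt hκ.le]
  rw [h3] at h2
  have h4 : κ ^ 3 = (Real.sqrt κ ^ 3) ^ 2 := by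
    rw [← pow_mul, mul_comm 3 2, pow_mul, Real.sq_sqrt hκ.le]
  rw [relConst, h2, ← mul_assoc, ← Real.exp_add, neg_add_cancel, Real.exp_zero, one_mul, h4,
    Function.comp_apply]
  field_simp

omit [Finite K] in
-- The likelihood decreases with the residual sum for every positive `k`, so the optimal rotation
-- does not depend on `k` and the concentration minimizes the profile `relConst k * exp (k S / n)`.
lemma prod_regDensity_eq (ht : IsEquivariantEmbedding K act t) (hn : 0 < n) (U V : Fin n → SO3)
    (B : SO3) (k : ℝ) :
    ∏ i, regDensity K t B k (rotClass K (U i)) (rotClass K (V i)) =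
      ((relConst K t k * Real.exp (k * (residualSum K t U V B / n))) ^ n)⁻¹ := by
  have hn0 : (n : ℝ) ≠ 0 := by positivity
  have hS := residualSum_eq_sub_sum_inner ht U V B
  have h1 : (relConst K t k * Real.exp (k * (residualSum K t U V B / n))) ^ n =
      normConst K t k ^ n * Real.exp (-∑ i,
        k * inner ℝ (t (rotClass K (V i))) (t (B • rotClass K (U i)))) := by
    rw [relConst, mul_right_comm, mul_pow, ← Real.exp_add, mul_comm, ← Real.exp_nat_mul]
    congr 2
    rw [← Finset.mul_sum]
    have h2 : ∑ i, inner ℝ (t (rotClass K (V i))) (t (B • rotClass K (U i))) =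
        n * ‖t (rotClass K 1)‖ ^ 2 - residualSum K t U V B := by
      rw [hS]; simp only [sub_sub_cancel]; rfl
    rw [h2]
    field_simp
    ring
  simp only [regDensity]
  rw [h1, Finset.prod_mul_distrib, Finset.prod_const, Finset.card_univ, Fintype.card_fin,
    ← Real.exp_sum, mul_inv, ← Real.exp_neg, neg_neg, inv_pow]

/-- Shows that the likelihood attains its maximum, which is needed before anything is known about
the estimate of `κ`. -/
lemma isJointMLE_of_minimizer (ht : IsEquivariantEmbedding K act t) (hn : 0 < n)
    {U V : Fin n → SO3} {B : SO3} (hB : IsRotationMLE K t U V B) {k : ℝ} (hk : 0 < k)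
    (hmin : ∀ k', 0 < k' → relConst K t k * Real.exp (k * (residualSum K t U V B / n)) ≤
      relConst K t k' * Real.exp (k' * (residualSum K t U V B / n))) :
    IsJointMLE K t U V B k := by
  refine ⟨hk, fun B' k' hk' => ?_⟩
  have hpos := fun κ => relConst_pos ht κ
  rw [prod_regDensity_eq ht hn, prod_regDensity_eq ht hn]
  refine inv_anti₀ (pow_pos (mul_pos (hpos k) (Real.exp_pos _)) n)
    (pow_le_pow_left₀ (mul_pos (hpos k) (Real.exp_pos _)).le ((hmin k' hk').trans ?_) n)
  refine mul_le_mul_of_nonneg_left (Real.exp_le_exp.2 ?_) (hpos k').le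
  exact mul_le_mul_of_nonneg_left
    (div_le_div_of_nonneg_right (hB.residualSum_le ht B') (Nat.cast_nonneg n)) hk'.le

lemma IsJointMLE.le_of_pos (ht : IsEquivariantEmbedding K act t) (hn : 0 < n)
    {U V : Fin n → SO3} {B : SO3} {k : ℝ} (h : IsJointMLE K t U V B k) {k' : ℝ} (hk' : 0 < k') :
    relConst K t k * Real.exp (k * (residualSum K t U V B / n)) ≤
      relConst K t k' * Real.exp (k' * (residualSum K t U V B / n)) := by
  have hpos := fun κ => mul_pos (relConst_pos ht κ)
    (Real.exp_pos (κ * (residualSum K t U V B / n)))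
  have h1 := h.2 B k' hk'
  rw [prod_regDensity_eq ht hn, prod_regDensity_eq ht hn,
    inv_le_inv₀ (pow_pos (hpos k') n) (pow_pos (hpos k) n),
    pow_le_pow_iff_left₀ (hpos k).le (hpos k').le hn.ne'] at h1
  exact h1

end Likelihood

section Concentration

variable {E : Type*} [NormedAddCommGroup E] [InnerProductSpace ℝ E] {K : Subgroup SO3} [Finite K]
  {act : SO3 →* (E ≃ₗᵢ[ℝ] E)} {t : SO3 ⧸ K → E}

/-- The maximum likelihood estimate of a high concentration `κ` is close to `3 * n / (2 * S)`, where
`S` is the residual sum of the fitted rotation. -/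
lemma exists_concentration_mle_close (ht : IsEquivariantEmbedding K act t) {δ : ℝ} (hδ : 0 < δ) :
    ∃ δ' : ℝ, 0 < δ' ∧ ∃ κ₀ : ℝ, 0 < κ₀ ∧ ∀ {n : ℕ}, 0 < n → ∀ {U V : Fin n → SO3} {B : SO3}
      {k κ : ℝ}, IsRotationMLE K t U V B →
      ((∃ B' k', IsJointMLE K t U V B' k') → IsJointMLE K t U V B k) → κ₀ < κ →
      |2 * κ * residualSum K t U V B / (3 * n) - 1| < δ' → |k / κ - 1| < δ := by
  obtain ⟨ch⟩ := ht.nonempty_rotChart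
  -- With `x = 2kr/3` and `y = 2κr/3` both within `δ'` of one, `|k/κ - 1| = |x - y| / y < 2δ' /
  -- (1/2) ≤ δ`.
  set δ' := min (1 / 2) (δ / 4) with hδ'
  have hδ'0 : 0 < δ' := by positivity
  have hδ'1 : δ' ≤ 1 / 2 := min_le_left _ _
  have hδ'2 : δ' ≤ δ / 4 := min_le_right _ _
  obtain ⟨r₀, hr₀, h⟩ := exists_minimizer_mul_exp (pow_pos ch.limMass_pos 2) (continuous_relConst ht)
    (fun k _ => relConst_pos ht k) ((antitone_relConst ht).antitoneOn _) (ch.tendsto_relConst ht)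
    hδ'0 (by linarith)
  refine ⟨δ', hδ'0, 3 / r₀, by positivity, fun {n} hn {U V B k κ} hB hJ hκ hS => ?_⟩
  have hκ0 : 0 < κ := lt_trans (by positivity) hκ
  have hn0 : (0 : ℝ) < n := by exact_mod_cast hn
  set r := residualSum K t U V B / n with hr
  have hy : 2 * κ * residualSum K t U V B / (3 * n) = 2 * κ * r / 3 := by rw [hr]; field_simp
  rw [hy] at hS
  obtain ⟨hS1, hS2⟩ := abs_lt.1 hS
  have hr0 : 0 < r := by
    by_contra! hneg
    nlinarith [mul_nonneg hκ0.le (neg_nonneg.2 hneg)]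
  -- `2κr/3 < 3/2` gives `κ r < 9/4`, whereas `κ r₀ > 3`.
  have hrr : r < r₀ := by
    rw [div_lt_iff₀ hr₀] at hκ
    by_contra! hge
    nlinarith [mul_le_mul_of_nonneg_left hge hκ0.le]
  obtain ⟨⟨k', hk', hmin⟩, hclose⟩ := h r hr0 hrr
  have hjoint := hJ ⟨B, k', isJointMLE_of_minimizer ht hn hB hk' hmin⟩
  have hk := abs_lt.1 (hclose k hjoint.1 fun k' hk' => hjoint.le_of_pos ht hn hk')
  set y := 2 * κ * r / 3 with hyd
  have hkκ : k / κ = (2 * k * r / 3) / y := by rw [hyd]; field_simp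
  have hy0 : 0 < y := by linarith
  rw [hkκ, div_sub_one hy0.ne', abs_div, abs_of_pos hy0, div_lt_iff₀ hy0]
  have h1 : |2 * k * r / 3 - y| < 2 * δ' := by
    rw [abs_lt]; constructor <;> linarith [hk.1, hk.2]
  have h2 : δ / 2 ≤ δ * y := by nlinarith
  linarith

omit [Finite K] in
lemma fitGain_nonneg (ht : IsEquivariantEmbedding K act t) {n : ℕ} {U V : Fin n → SO3} {B : SO3}
    (hB : IsRotationMLE K t U V B) (A : SO3) : 0 ≤ fitGain K t U V B A := by
  rw [fitGain_eq_sub]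
  exact sub_nonneg.2 (hB.residualSum_le ht A)

end Concentration

/-- The half of the portmanteau theorem for closed sets; it needs no continuity of the limit law,
which for `n = 1` is a point mass. -/
lemma eventually_measureReal_closed_lt {ι F : Type*} {Ω : ι → Type*}
    [∀ i, MeasurableSpace (Ω i)] {μ : ∀ i, Measure (Ω i)} [∀ i, IsProbabilityMeasure (μ i)]
    [PseudoEMetricSpace F] [MeasurableSpace F] [BorelSpace F] {l : Filter ι}
    {X : ∀ i, Ω i → F} {ν : Measure F} [IsProbabilityMeasure ν]
    (h : TendstoInDistribution X l id μ ν) {s : Set F} (hs : IsClosed s) {η : ℝ}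
    (hη : ν.real s < η) : ∀ᶠ i in l, (μ i).real {ω | X i ω ∈ s} < η := by
  have h1 := ProbabilityMeasure.limsup_measure_closed_le_of_tendsto h.tendsto hs
  simp only [ProbabilityMeasure.coe_mk, Measure.map_id] at h1
  have hη0 : 0 < η := measureReal_nonneg.trans_lt hη
  have h2 : ν s < ENNReal.ofReal η := by
    rw [← ENNReal.ofReal_toReal (measure_ne_top ν s)]
    exact (ENNReal.ofReal_lt_ofReal_iff hη0).2 hη
  filter_upwards [eventually_lt_of_limsup_lt (h1.trans_lt h2)] with i hi
  rw [Measure.map_apply_of_aemeasurable (h.forall_aemeasurable i) hs.measurableSet] at hi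
  rw [measureReal_def]
  exact (ENNReal.lt_ofReal_iff_toReal_lt (measure_ne_top _ _)).1 hi

lemma exists_forall_chiSq_deviation_lt {δ η : ℝ} (hδ : 0 < δ) (hη : 0 < η) :
    ∃ N : ℕ, ∀ n, N ≤ n →
      (chiSq (3 * (n - 1))).real {x | δ ≤ |x / (3 * n) - 1|} < η := by
  obtain ⟨C, hC, h⟩ := exists_chiSq_deviation_le
  -- The first bound, `n δ > 2`, absorbs the gap between the mean `3(n - 1)` and the divisor `3n`
  -- into half of the deviation `3nδ`; the second makes Chebyshev's bound smaller than `η`.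
  obtain ⟨N, hN⟩ := exists_nat_gt (max (2 / δ) (4 * C / (3 * δ ^ 2) / η))
  refine ⟨max N 1, fun n hn => ?_⟩
  have hn1 : 1 ≤ n := (le_max_right _ _).trans hn
  have hnN : (N : ℝ) ≤ n := by exact_mod_cast (le_max_left _ _).trans hn
  have hn0 : (0 : ℝ) < n := by exact_mod_cast hn1
  have h2 : 2 / δ < n := (le_max_left _ _).trans_lt (hN.trans_le hnN)
  have h3 : 4 * C / (3 * δ ^ 2) / η < n := (le_max_right _ _).trans_lt (hN.trans_le hnN)
  rw [div_lt_iff₀ hδ] at h2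
  rw [div_lt_iff₀ hη] at h3
  have hcast : ((3 * (n - 1) : ℕ) : ℝ) = 3 * n - 3 := by
    rw [Nat.cast_mul, Nat.cast_sub hn1]; push_cast; ring
  calc (chiSq (3 * (n - 1))).real {x | δ ≤ |x / (3 * n) - 1|}
      ≤ (chiSq (3 * (n - 1))).real {x | 3 * n * δ / 2 ≤ |x - (3 * (n - 1) : ℕ)|} := by
        refine measureReal_mono fun x (hx : δ ≤ _) => ?_
        change 3 * (n : ℝ) * δ / 2 ≤ |x - ((3 * (n - 1) : ℕ) : ℝ)|
        have h4 : |x / (3 * n) - 1| * (3 * n) = |x - 3 * n| := by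
          nth_rw 2 [← abs_of_pos (by positivity : (0 : ℝ) < 3 * n)]
          rw [← abs_mul]; congr 1; field_simp
        have h5 : δ * (3 * n) ≤ |x - 3 * n| := by rw [← h4]; gcongr
        have h6 : |x - 3 * n| ≤ |x - (3 * n - 3)| + 3 := by
          have := abs_sub_le x (3 * n - 3) (3 * n)
          simpa using this
        rw [hcast]; linarith
    _ ≤ C * (3 * (n - 1) : ℕ) / (3 * n * δ / 2) ^ 2 := h _ _ (by positivity)
    _ ≤ C * (3 * n) / (3 * n * δ / 2) ^ 2 := by
        rw [hcast]; gcongr; linarith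
    _ = 4 * C / (3 * δ ^ 2) / n := by field_simp; ring
    _ < η := by rw [div_lt_iff₀ hn0]; linarith

theorem proposition3
    {E : Type*} [NormedAddCommGroup E] [InnerProductSpace ℝ E]
    (K : Subgroup SO3) [Finite K] (act : SO3 →* (E ≃ₗᵢ[ℝ] E)) (t : SO3 ⧸ K → E)
    (ht : IsEquivariantEmbedding K act t) (A : SO3)
    -- for every sample size `n` and concentration `κ > 0`, a sample from the model
    {Ω : ℕ → Set.Ioi (0 : ℝ) → Type*} [∀ n κ, MeasurableSpace (Ω n κ)]
    (P : ∀ n κ, Measure (Ω n κ)) [∀ n κ, IsProbabilityMeasure (P n κ)]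
    (ν : ∀ n, Measure (Fin n → SO3 ⧸ K)) [∀ n, IsProbabilityMeasure (ν n)]
    (U V : ∀ n κ, Fin n → Ω n κ → SO3)
    (hUV : ∀ n (κ : Set.Ioi (0 : ℝ)), IsRegressionSample K t A (κ : ℝ) (ν n) (P n κ) (U n κ) (V n κ))
    -- the maximum likelihood estimate of `A`
    (Ahat : ∀ n κ, Ω n κ → SO3)
    (hAhat : ∀ n κ ω,
      IsRotationMLE K t (fun i => U n κ i ω) (fun i => V n κ i ω) (Ahat n κ ω)) :
    -- (i)
    (∀ n : ℕ, 1 ≤ n →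
      TendstoInDistribution
        (fun (κ : Set.Ioi (0 : ℝ)) ω =>
          2 * (κ : ℝ) * residualSum K t (fun i => U n κ i ω) (fun i => V n κ i ω) A)
        atTop id (P n) (chiSq (3 * n)) ∧
      TendstoInDistribution
        (fun (κ : Set.Ioi (0 : ℝ)) ω =>
          2 * (κ : ℝ) *
            residualSum K t (fun i => U n κ i ω) (fun i => V n κ i ω) (Ahat n κ ω))
        atTop id (P n) (chiSq (3 * (n - 1))) ∧
      TendstoInDistribution
        (fun (κ : Set.Ioi (0 : ℝ)) ω =>
          2 * (κ : ℝ) *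
            fitGain K t (fun i => U n κ i ω) (fun i => V n κ i ω) (Ahat n κ ω) A)
        atTop id (P n) (chiSq 3) ∧
      TendstoInDistribution
        (fun (κ : Set.Ioi (0 : ℝ)) ω =>
          (2 * (κ : ℝ) *
            residualSum K t (fun i => U n κ i ω) (fun i => V n κ i ω) (Ahat n κ ω),
           2 * (κ : ℝ) *
            fitGain K t (fun i => U n κ i ω) (fun i => V n κ i ω) (Ahat n κ ω) A))
        atTop id (P n) ((chiSq (3 * (n - 1))).prod (chiSq 3))) ∧
    -- (ii), with an estimate of `κ` whose ratio to `κ` tends to one in probability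
    (∀ n : ℕ, 1 ≤ n → ∀ κhat : ∀ κ, Ω n κ → ℝ, (∀ κ, Measurable (κhat κ)) →
      (∀ ε : ℝ, 0 < ε →
        Tendsto (fun κ : Set.Ioi (0 : ℝ) => (P n κ).real {ω | ε ≤ |κhat κ ω / (κ : ℝ) - 1|})
          atTop (𝓝 0)) →
      ∀ α : ℝ, 0 < α → α < 1 →
        Tendsto (fun κ : Set.Ioi (0 : ℝ) => (P n κ).real
          {ω | A ∈ confidenceRegion K t (fun i => U n κ i ω) (fun i => V n κ i ω)
            (Ahat n κ ω) (κhat κ ω) α}) atTop (𝓝 (1 - α))) ∧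
    -- (ii), with the maximum likelihood estimate of `κ`
    (∀ κhat : ∀ n κ, Ω n κ → ℝ, (∀ n κ, Measurable (κhat n κ)) →
      (∀ n κ ω,
        (∃ B k, IsJointMLE K t (fun i => U n κ i ω) (fun i => V n κ i ω) B k) →
          IsJointMLE K t (fun i => U n κ i ω) (fun i => V n κ i ω)
            (Ahat n κ ω) (κhat n κ ω)) →
      ∀ α : ℝ, 0 < α → α < 1 → ∀ ε : ℝ, 0 < ε → ∃ N : ℕ, ∀ n : ℕ, N ≤ n →
        ∀ᶠ κ : Set.Ioi (0 : ℝ) in atTop,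
          |(P n κ).real
            {ω | A ∈ confidenceRegion K t (fun i => U n κ i ω) (fun i => V n κ i ω)
              (Ahat n κ ω) (κhat n κ ω) α} - (1 - α)| < ε) := by
  have hfin (n : ℕ) (κ : Set.Ioi (0 : ℝ)) (ω : Ω n κ) :
      0 ≤ 2 * (κ : ℝ) *
        fitGain K t (fun i => U n κ i ω) (fun i => V n κ i ω) (Ahat n κ ω) A :=
    mul_nonneg (mul_nonneg zero_le_two (le_of_lt κ.2)) (fitGain_nonneg ht (hAhat n κ ω) A)
  have hgain (n : ℕ) (hn : 1 ≤ n) := tendstoInDistribution_fitGain ht hn (hUV n) (hAhat n)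
  -- The region event in terms of the ratio `κ̂/κ` and of `2κ D(A)`, the statistic whose limit is
  -- known.
  have hregion (n : ℕ) (κ : Set.Ioi (0 : ℝ)) (k : Ω n κ → ℝ) (α : ℝ) :
      {ω | A ∈ confidenceRegion K t (fun i => U n κ i ω) (fun i => V n κ i ω)
        (Ahat n κ ω) (k ω) α} =
      {ω | k ω / (κ : ℝ) * (2 * (κ : ℝ) *
        fitGain K t (fun i => U n κ i ω) (fun i => V n κ i ω) (Ahat n κ ω) A) <
          chiSqUpper 3 α} := by
    have hκ : (κ : ℝ) ≠ 0 := ne_of_gt κ.2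
    ext ω
    have h : k ω / (κ : ℝ) * (2 * (κ : ℝ) *
        fitGain K t (fun i => U n κ i ω) (fun i => V n κ i ω) (Ahat n κ ω) A) =
        2 * k ω * fitGain K t (fun i => U n κ i ω) (fun i => V n κ i ω) (Ahat n κ ω) A := by
      field_simp
    simp only [mem_ofPred_eq, h, confidenceRegion]
  refine ⟨fun n hn => ⟨tendstoInDistribution_residualSum ht hn (hUV n) (hAhat n),
    tendstoInDistribution_residualSum_mle ht hn (hUV n) (hAhat n), hgain n hn,
    tendstoInDistribution_residualSum_fitGain ht hn (hUV n) (hAhat n)⟩, ?_, ?_⟩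
  · intro n hn κhat _ hκhat α hα0 hα1
    rw [Metric.tendsto_nhds]
    intro ε hε
    obtain ⟨δ, hδ, hcov⟩ := exists_coverage_tolerance hα0 hα1 hε
    have h := hcov (ρ := fun κ ω => κhat κ ω / (κ : ℝ)) (hgain n hn) (hfin n)
      ((hκhat δ hδ).eventually (eventually_lt_nhds (half_pos hε)))
    filter_upwards [h] with κ hκ
    rw [Real.dist_eq, hregion]
    exact hκ
  · intro κhat _ hκhat α hα0 hα1 ε hε
    -- The choices are made in the order `δ`, `δ'`, `N`, and `κ` last: only the spread of
    -- `χ²_{3(n-1)} / (3n)` depends on `n`, and it does not shrink as `κ` grows.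
    obtain ⟨δ, hδ, hcov⟩ := exists_coverage_tolerance hα0 hα1 hε
    obtain ⟨δ', hδ', κ₀, hκ₀, hclose⟩ := exists_concentration_mle_close ht hδ
    obtain ⟨N, hN⟩ := exists_forall_chiSq_deviation_lt hδ' (half_pos hε)
    refine ⟨max N 1, fun n hn => ?_⟩
    have hn1 : 1 ≤ n := (le_max_right _ _).trans hn
    have hdev := eventually_measureReal_closed_lt
      (tendstoInDistribution_residualSum_mle ht hn1 (hUV n) (hAhat n))
      (s := {x | δ' ≤ |x / (3 * n) - 1|}) (isClosed_le continuous_const (by fun_prop))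
      (hN n ((le_max_left _ _).trans hn))
    have hbad : ∀ᶠ κ : Set.Ioi (0 : ℝ) in atTop,
        (P n κ).real {ω | δ ≤ |κhat n κ ω / (κ : ℝ) - 1|} < ε / 2 := by
      filter_upwards [hdev, eventually_gt_atTop (⟨κ₀, hκ₀⟩ : Set.Ioi (0 : ℝ))] with κ hκ hlt
      refine (measureReal_mono fun ω hω => ?_).trans_lt hκ
      by_contra hnot
      exact (hclose hn1 (hAhat n κ ω) (hκhat n κ ω) hlt (not_le.1 hnot)).not_ge hω
    filter_upwards [hcov (ρ := fun κ ω => κhat n κ ω / (κ : ℝ)) (hgain n hn1) (hfin n) hbad]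
      with κ hκ
    rw [hregion]
    exact hκ
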